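/- Let $\lambda_k$ denote $k$-dimensional Lebesgue measure. For $S\subseteq\mathbb{R}^2$ let $\operatorname{Seg}(S)=\{(A,B)\in S\times S : \overline{AB}\subseteq S\}\subseteq\mathbb{R}^2\times\mathbb{R}^2$, where $\overline{AB}$ is the closed line segment with endpoints $A$ and $B$. The Beer index $b(S)$ is said to be defined if $S$ is Lebesgue measurable with $0<\lambda_2(S)<\infty$ and $\operatorname{Seg}(S)$ is Lebesgue measurable; in that case put $$b(S)=\frac{\lambda_4(\operatorname{Seg}(S))}{\lambda_2(S)^2},\qquad c(S)=\frac{\sup\{\lambda_2(K) : K\subseteq S,\ K\text{ convex}\}}{\lambda_2(S)}.$$ The p-components of $S$ are the equivalence classes of the relation on $S$ under which $A$ and $B$ are related if they can be joined by a polygonal curve (a finite chain of closed line segments, possibly a single point) contained in $S$. The set $S$ is p-componentwise simply connected if each of its p-components, with the subspace topology, is simply connected (path-connected with trivial fundamental group). Theorem. Let $S\subseteq\mathbb{R}^2$ be a p-componentwise simply connected set for which $b(S)$ is defined. Then $$b(S)\le 180\,c(S).$$ -/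

import Mathlib

open MeasureTheory
open scoped ENNReal

namespace BeerConvexity

/-- The space `ℝ^d` with its Euclidean norm and Lebesgue measure `volume`. -/
abbrev Space (d : ℕ) : Type := EuclideanSpace ℝ (Fin d)

/-- The segment set `Seg(S)`: pairs of points of `S` whose closed segment lies in `S`. -/
def segSet {d : ℕ} (S : Set (Space d)) : Set (Space d × Space d) :=
  {p | p.1 ∈ S ∧ p.2 ∈ S ∧ segment ℝ p.1 p.2 ⊆ S}

/-- The condition under which the Beer index of `S` is defined. Lebesgue measurability (with
respect to the completed measure) is `NullMeasurableSet`. -/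
structure BeerIndexDefined {d : ℕ} (S : Set (Space d)) : Prop where
  measurable : NullMeasurableSet S volume
  pos : 0 < volume S
  finite : volume S < ∞
  measurable_seg : NullMeasurableSet (segSet S) volume

/-- The Beer index of convexity, `b(S) = λ(Seg(S)) / λ(S)²`. It is meaningful under
`BeerIndexDefined S`. -/
noncomputable def beerIndex {d : ℕ} (S : Set (Space d)) : ℝ :=
  (volume (segSet S)).toReal / (volume S).toReal ^ 2

/-- The supremum of the Lebesgue measures of the convex subsets of `S`. -/
noncomputable def convexSup {d : ℕ} (S : Set (Space d)) : ℝ≥0∞ :=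
  sSup {m : ℝ≥0∞ | ∃ K : Set (Space d), K ⊆ S ∧ Convex ℝ K ∧ m = volume K}

/-- The convexity ratio `c(S)`. It is meaningful when `S` is measurable with
`0 < λ(S) < ∞`. -/
noncomputable def convexityRatio {d : ℕ} (S : Set (Space d)) : ℝ :=
  (convexSup S).toReal / (volume S).toReal

/-- `A` and `B` are joined in `X` by the polygonal curve with vertices `v 0, …, v n`
(for `n = 0` this is the one-point curve). -/
def PolygonallyJoined {d : ℕ} (X : Set (Space d)) (A B : Space d) : Prop :=
  A ∈ X ∧ ∃ (n : ℕ) (v : ℕ → Space d), v 0 = A ∧ v n = B ∧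
    ∀ i < n, segment ℝ (v i) (v (i + 1)) ⊆ X

/-- `C` is a p-component of `X`: a class of the relation `PolygonallyJoined X` on `X`. -/
def IsPComponent {d : ℕ} (X C : Set (Space d)) : Prop :=
  ∃ A ∈ X, C = {B | PolygonallyJoined X A B}

/-- Every p-component of `X` is simply connected. -/
def PComponentwiseSimplyConnected {d : ℕ} (X : Set (Space d)) : Prop :=
  ∀ C : Set (Space d), IsPComponent X C → IsSimplyConnected C

end BeerConvexity

namespace BeerConvexity

/-! Simple connectivity is used only through `HasLoopLog`: along a loop in the set, `z - p` has a
closed logarithm for every missing point `p`. This property passes to intersections with convex sets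
and, here, to `interior S`. It has two planar consequences: a triangle whose sides lie in the set
lies in the set (`HasLoopLog.convexCombo_mem`), and a chord, that is, a maximal open segment in a
bounded open `U`, separates its two sides (`IsHolefree.sep`).

Reduction to open sets. At a density point `(A, B)` of `segSet S` there are three nearby segments in
`S` that enclose any given point of the middle four fifths of `AB`; the enclosed triangle lies in
`S`, so that middle part lies in `interior S`. Shrinking the pair to its middle part scales
four-dimensional measure by `(4/5)^2`, so the bound `96 c λ(U)` for the visible pairs of an open `U`
gives `150 c λ(S)`, where `c` bounds the areas of convex subsets. This is stronger than the claimed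
`180`.

The open case. Fix a root `O` and let `level k` consist of the points reached by at most `k`
segments. Each level `V = star U K` is convex relative to `U`, and its boundary inside `U` is made
of chords, the windows. For a visible pair let `k` be least such that the segment meets `level (k +
1)`; it does so in an interval. If this interval contains the middle half, the pair shrunk to that
half lies in `level (k + 1)` and does not meet `level k` (for `k = 0`, both points see `O`). Such
pairs have measure at most `16 c` times the area of the shell: both points lie behind one window,
and triangles in `U` confine the point nearer to the window to a parallelogram of area `8 c`
(`IsHolefree.volume_levelSlice_le`). Otherwise the segment enters `level (k + 1)` late from one of
its ends `A`; the other end then lies in the fourfold enlargement of a convex cone with apex `A`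
over a window, of area at most `16 c` (`IsHolefree.volume_lateSlice_le`). Altogether `4 * 16 + 16 +
16 = 96`, and the shells are disjoint. -/

/-! ### Loops and logarithms -/

/-- A point of the plane as a complex number. -/
def toC (z : Space 2) : ℂ := ⟨z 0, z 1⟩

/-- The planar cross product. -/
def cross (u v : Space 2) : ℝ := u 0 * v 1 - u 1 * v 0

@[fun_prop]
theorem continuous_toC : Continuous toC := by
  have : toC = fun z : Space 2 => ((z 0 : ℝ) : ℂ) + (z 1 : ℝ) * Complex.I := by
    ext z
    apply Complex.ext <;> simp [toC]
  rw [this]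
  fun_prop

theorem toC_eq_zero {z : Space 2} : toC z = 0 ↔ z = 0 := by
  constructor
  · intro h
    have h0 := congrArg Complex.re h
    have h1 := congrArg Complex.im h
    ext i
    fin_cases i
    · simpa [toC] using h0
    · simpa [toC] using h1
  · rintro rfl
    apply Complex.ext <;> simp [toC]

theorem toC_sub_ne_zero {z p : Space 2} (h : z ≠ p) : toC (z - p) ≠ 0 := by
  rwa [Ne, toC_eq_zero, sub_eq_zero]

theorem toC_add (z p : Space 2) : toC (z + p) = toC z + toC p := by
  apply Complex.ext <;> simp [toC]

theorem toC_smul (a : ℝ) (z : Space 2) : toC (a • z) = a * toC z := by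
  apply Complex.ext <;> simp [toC]

theorem norm_toC (z : Space 2) : ‖toC z‖ = ‖z‖ := by
  rw [EuclideanSpace.norm_eq, Complex.norm_def, Complex.normSq_apply, Fin.sum_univ_two]
  simp [toC, sq]

/-- Along every loop in `X`, the function `z - p` with `p ∉ X` has a closed logarithm. -/
def HasLoopLog (X : Set (Space 2)) : Prop :=
  ∀ (x : Space 2) (γ : Path x x), (∀ t, γ t ∈ X) → ∀ p ∉ X,
    ∃ g : C(unitInterval, ℂ), (∀ t, Complex.exp (g t) = toC (γ t - p)) ∧ g 0 = g 1

/-- A null-homotopy of the loop, composed with `z ↦ z - p`, avoids `0` and lifts through the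
covering `exp`. Homotopic paths have lifts with the same end, and a constant path lifts to a
constant. -/
theorem _root_.IsSimplyConnected.hasLoopLog {X : Set (Space 2)} (hX : IsSimplyConnected X) :
    HasLoopLog X := by
  intro x γ hγ p hp
  obtain ⟨-, h⟩ := isSimplyConnected_iff_exists_homotopy_refl_forall_mem.1 hX
  obtain ⟨F, hF⟩ := h x γ hγ
  have hne : ∀ z ∈ X, toC (z - p) ≠ 0 := fun z hz =>
    toC_sub_ne_zero (fun h => hp (h ▸ hz))
  let f : C(X, {z : ℂ // z ≠ 0}) := ⟨fun z => ⟨toC (z - p), hne z z.2⟩, by fun_prop⟩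
  have hx : x ∈ X := by simpa using hγ 0
  let γ₀ : C(unitInterval, {z : ℂ // z ≠ 0}) := ⟨fun t => ⟨toC (γ t - p), hne _ (hγ t)⟩, by fun_prop⟩
  let γ₁ : C(unitInterval, {z : ℂ // z ≠ 0}) := .const _ ⟨toC (x - p), hne _ hx⟩
  have hom : γ₀.HomotopicRel γ₁ {0, 1} := by
    refine ⟨{ toFun := fun ts => ⟨toC (F ts - p), hne _ (hF ts)⟩
              continuous_toFun := by fun_prop
              map_zero_left := ?_
              map_one_left := ?_
              prop' := ?_ }⟩
    · intro t; simp [γ₀]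
    · intro t; simp [γ₁]
    · intro t s hs
      have := F.eq_fst t hs
      simpa [γ₀] using congrArg (fun z => toC (z - p)) this
  have hb : toC (x - p) = Complex.exp (Complex.log (toC (x - p))) :=
    (Complex.exp_log (hne _ hx)).symm
  have h0 : γ₀ 0 = (⟨_, Complex.exp_ne_zero (Complex.log (toC (x - p)))⟩ : {z : ℂ // z ≠ 0}) := by
    apply Subtype.ext
    simp [γ₀, ← hb]
  have h1 : γ₁ 0 = (⟨_, Complex.exp_ne_zero (Complex.log (toC (x - p)))⟩ : {z : ℂ // z ≠ 0}) := by
    apply Subtype.ext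
    simp [γ₁, ← hb]
  have key := Complex.isCoveringMap_exp.liftPath_apply_one_eq_of_homotopicRel hom _ h0 h1
  refine ⟨Complex.isCoveringMap_exp.liftPath γ₀ _ h0, fun t => ?_, ?_⟩
  · have := congrFun (Complex.isCoveringMap_exp.liftPath_lifts γ₀ _ h0) t
    simpa [γ₀] using congrArg Subtype.val this
  · rw [key, Complex.isCoveringMap_exp.liftPath_zero]
    have : Complex.isCoveringMap_exp.liftPath γ₁ _ h1 = .const _ (Complex.log (toC (x - p))) :=
      Complex.isCoveringMap_exp.liftPath_const h1
    rw [this]; rfl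

theorem log_increment_unique {g L : unitInterval → ℂ} (hg : Continuous g) (hL : Continuous L)
    (h : ∀ t, Complex.exp (g t) = Complex.exp (L t)) : g 1 - g 0 = L 1 - L 0 := by
  have := Complex.isCoveringMap_exp.eq_of_comp_eq hg
    (g₂ := fun t => L t + (g 0 - L 0)) (by fun_prop) (by
      funext t
      apply Subtype.ext
      have h0 : Complex.exp (g 0 - L 0) = 1 := by
        rw [Complex.exp_sub, h 0, div_self (Complex.exp_ne_zero _)]
      simp [Complex.exp_add, h0, h t]) 0 (by simp)
  rw [congrFun this 1]
  ring

/-- If `u * f` avoids the negative real axis, the increment of a logarithm of `f` is computed by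
the principal branch. -/
theorem log_increment_eq {g f : unitInterval → ℂ} (hg : Continuous g) (hf : Continuous f)
    (h : ∀ t, Complex.exp (g t) = f t) {u : ℂ} (hu : u ≠ 0) (hs : ∀ t, u * f t ∈ Complex.slitPlane) :
    g 1 - g 0 = Complex.log (u * f 1) - Complex.log (u * f 0) := by
  have h2 : Continuous fun t => Complex.log (u * f t) :=
    (continuous_const.mul hf).clog hs
  have := log_increment_unique hg (L := fun t => Complex.log (u * f t) - Complex.log u)
    (h2.sub continuous_const) (fun t => by
      rw [Complex.exp_sub, Complex.exp_log hu, Complex.exp_log (Complex.slitPlane_ne_zero (hs t)),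
        h t, mul_div_cancel_left₀ _ hu])
  rw [this]
  ring

/-- `δ` is the increment along `γ` of a logarithm of `z - p`. -/
def LogIncrement (p : Space 2) {a b : Space 2} (γ : Path a b) (δ : ℂ) : Prop :=
  ∃ g : unitInterval → ℂ, Continuous g ∧ (∀ t, Complex.exp (g t) = toC (γ t - p)) ∧ g 1 - g 0 = δ

theorem LogIncrement.of_trans {p a b c : Space 2} {γ : Path a b} {γ' : Path b c} {δ : ℂ}
    (h : LogIncrement p (γ.trans γ') δ) :
    ∃ δ₁ δ₂, LogIncrement p γ δ₁ ∧ LogIncrement p γ' δ₂ ∧ δ = δ₁ + δ₂ := by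
  obtain ⟨g, hg, hexp, hδ⟩ := h
  let l : unitInterval → unitInterval := fun t => ⟨t / 2, by have := t.2.1; positivity,
    by have := t.2.2; linarith⟩
  let r : unitInterval → unitInterval := fun t => ⟨(t + 1) / 2, by have := t.2.1; positivity,
    by have := t.2.2; linarith⟩
  have hl : Continuous l := Continuous.subtype_mk (by fun_prop) _
  have hr : Continuous r := Continuous.subtype_mk (by fun_prop) _
  refine ⟨_, _, ⟨g ∘ l, hg.comp hl, fun t => ?_, rfl⟩, ⟨g ∘ r, hg.comp hr, fun t => ?_, rfl⟩, ?_⟩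
  · have : (γ.trans γ') (l t) = γ t := by
      rw [Path.trans_apply, dif_pos (show (l t : ℝ) ≤ 1 / 2 by
        have := t.2.2; simp only [l]; linarith)]
      congr 1
      apply Subtype.ext
      simp [l]; ring
    rw [Function.comp_apply, hexp, this]
  · have : (γ.trans γ') (r t) = γ' t := by
      by_cases ht : (t : ℝ) = 0
      · have ht' : t = 0 := Subtype.ext ht
        rw [Path.trans_apply, dif_pos (show (r t : ℝ) ≤ 1 / 2 by simp [r, ht])]
        subst ht'
        have e : (⟨2 * (r 0 : ℝ), by simp [r]⟩ : unitInterval) = 1 := by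
          apply Subtype.ext; simp [r]
        rw [e]; simp
      · have hpos : 0 < (t : ℝ) := lt_of_le_of_ne t.2.1 (Ne.symm ht)
        rw [Path.trans_apply, dif_neg (show ¬ (r t : ℝ) ≤ 1 / 2 by
          simp only [r]; linarith)]
        congr 1
        apply Subtype.ext
        simp [r]; ring
    rw [Function.comp_apply, hexp, this]
  · have h1 : r 1 = 1 := Subtype.ext (by simp [r])
    have h2 : l 0 = 0 := Subtype.ext (by simp [l])
    have h3 : l 1 = r 0 := Subtype.ext (by simp [r, l])
    simp only [Function.comp_apply, h1, h2, h3, ← hδ]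
    ring

theorem HasLoopLog.logIncrement {X : Set (Space 2)} (hX : HasLoopLog X) {a b c p : Space 2}
    {γ₁ : Path a b} {γ₂ : Path b c} {γ₃ : Path c a} (h₁ : ∀ t, γ₁ t ∈ X) (h₂ : ∀ t, γ₂ t ∈ X)
    (h₃ : ∀ t, γ₃ t ∈ X) (hp : p ∉ X) :
    ∃ δ₁ δ₂ δ₃, LogIncrement p γ₁ δ₁ ∧ LogIncrement p γ₂ δ₂ ∧ LogIncrement p γ₃ δ₃ ∧
      δ₁ + δ₂ + δ₃ = 0 := by
  obtain ⟨g, hg, h01⟩ := hX a ((γ₁.trans γ₂).trans γ₃) (fun t => by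
    have : ((γ₁.trans γ₂).trans γ₃) t ∈ Set.range ((γ₁.trans γ₂).trans γ₃) := ⟨t, rfl⟩
    rw [Path.trans_range, Path.trans_range] at this
    rcases this with (⟨s, hs⟩ | ⟨s, hs⟩) | ⟨s, hs⟩ <;> rw [← hs]
    exacts [h₁ s, h₂ s, h₃ s]) p hp
  have : LogIncrement p ((γ₁.trans γ₂).trans γ₃) 0 := ⟨g, g.continuous, hg, by rw [h01, sub_self]⟩
  obtain ⟨δ, δ₃, h, h3, e⟩ := this.of_trans
  obtain ⟨δ₁, δ₂, h1, h2, rfl⟩ := h.of_trans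
  exact ⟨δ₁, δ₂, δ₃, h1, h2, h3, e.symm⟩

theorem joinedIn_segment (a b : Space 2) : JoinedIn (segment ℝ a b) a b :=
  ((convex_segment a b).isPathConnected ⟨a, left_mem_segment ℝ a b⟩).joinedIn _
    (left_mem_segment ℝ a b) _ (right_mem_segment ℝ a b)

theorem _root_.Convex.hasLoopLog {X : Set (Space 2)} (hX : Convex ℝ X) : HasLoopLog X := by
  intro x γ hγ
  have hne : X.Nonempty := ⟨_, hγ 0⟩
  have : ContractibleSpace X := hX.contractibleSpace hne
  have : IsSimplyConnected X := (inferInstance : SimplyConnectedSpace X)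
  exact this.hasLoopLog x γ hγ

/-- A point outside `X ∩ Y` is missing from one of the two sets, and that set supplies the
logarithm. This permits truncation by balls. -/
theorem HasLoopLog.inter_convex {X Y : Set (Space 2)} (hX : HasLoopLog X) (hY : Convex ℝ Y) :
    HasLoopLog (X ∩ Y) := by
  intro x γ hγ p hp
  by_cases h : p ∈ X
  · exact hY.hasLoopLog x γ (fun t => (hγ t).2) p (fun h' => hp ⟨h, h'⟩)
  · exact hX x γ (fun t => (hγ t).1) p h

/-! ### Chord separation -/

theorem im_div_toC (a b : Space 2) :
    (toC a / toC b).im = cross b a / Complex.normSq (toC b) := by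
  rw [Complex.div_im]
  simp only [toC, cross]
  ring

/-- The quotient is a negative real only when `z` lies strictly between `e₁` and `e₂`. -/
theorem toC_div_mem_slitPlane {e₁ e₂ z : Space 2} (h₁ : z ≠ e₁) (h₂ : z ≠ e₂)
    (h : z ∉ openSegment ℝ e₁ e₂) : toC (z - e₁) / toC (z - e₂) ∈ Complex.slitPlane := by
  by_contra hcon
  have hb := toC_sub_ne_zero h₂
  have ha := toC_sub_ne_zero h₁
  set R := toC (z - e₁) / toC (z - e₂) with hR
  rw [Complex.mem_slitPlane_iff] at hcon
  push Not at hcon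
  obtain ⟨hre, him⟩ := hcon
  have hRre : R = ((R.re : ℝ) : ℂ) := Complex.ext (by simp) (by simp [him])
  have hne : R ≠ 0 := div_ne_zero ha hb
  have hlt : R.re < 0 := lt_of_le_of_ne hre (fun h0 => hne (by rw [hRre, h0]; simp))
  set ρ := -R.re with hρ
  have hρ0 : 0 < ρ := by linarith
  have e : toC ((z - e₁) + ρ • (z - e₂)) = 0 := by
    rw [toC_add, toC_smul]
    have : toC (z - e₁) = R * toC (z - e₂) := by rw [hR, div_mul_cancel₀ _ hb]
    rw [this, hRre, hρ]
    push_cast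
    ring
  rw [toC_eq_zero] at e
  apply h
  refine ⟨1 / (1 + ρ), ρ / (1 + ρ), by positivity, by positivity, by field_simp, ?_⟩
  have e2 : (1 + ρ) • z = e₁ + ρ • e₂ := by
    have : (1 + ρ) • z - (e₁ + ρ • e₂) = (z - e₁) + ρ • (z - e₂) := by module
    rw [← sub_eq_zero, this, e]
  calc (1 / (1 + ρ)) • e₁ + (ρ / (1 + ρ)) • e₂ = (1 / (1 + ρ)) • (e₁ + ρ • e₂) := by module
    _ = z := by rw [← e2, smul_smul]; rw [one_div_mul_cancel (by positivity), one_smul]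

theorem toC_div_of_mem_openSegment {e₁ e₂ z : Space 2} (hne : e₁ ≠ e₂)
    (h : z ∈ openSegment ℝ e₁ e₂) : ∃ ρ : ℝ, 0 < ρ ∧ toC (z - e₁) / toC (z - e₂) = -(ρ : ℂ) := by
  obtain ⟨a, b, ha, hb, hab, rfl⟩ := h
  refine ⟨b / a, by positivity, ?_⟩
  have h1 : a • e₁ + b • e₂ - e₁ = b • (e₂ - e₁) := by
    obtain rfl : a = 1 - b := by linarith
    module
  have h2 : a • e₁ + b • e₂ - e₂ = (-a) • (e₂ - e₁) := by
    obtain rfl : b = 1 - a := by linarith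
    module
  rw [h1, h2, toC_smul, toC_smul]
  have : toC (e₂ - e₁) ≠ 0 := toC_sub_ne_zero hne.symm
  have : (a : ℂ) ≠ 0 := by exact_mod_cast ha.ne'
  push_cast
  field_simp

/-- The loop through `c`, `k₁`, `k₂` crosses the segment `e₁e₂` once, so its winding numbers about
`e₁` and `e₂` would differ by one, while closed logarithms make both vanish. The difference is read
off from `R z = (z - e₁) / (z - e₂)`, which is negative real exactly on the chord and has imaginary
part of the sign of the side. -/
theorem HasLoopLog.false_of_cross_chord {U : Set (Space 2)} (hL : HasLoopLog U) {e₁ e₂ : Space 2}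
    (he₁ : e₁ ∉ U) (he₂ : e₂ ∉ U) {c k₁ k₂ : Space 2} (hc : c ∈ openSegment ℝ e₁ e₂)
    (p₁ : JoinedIn (U ∩ {z | 0 ≤ cross (z - e₂) (z - e₁)}) c k₁)
    (p₂ : JoinedIn (U \ openSegment ℝ e₁ e₂) k₁ k₂)
    (p₃ : JoinedIn (U ∩ {z | cross (z - e₂) (z - e₁) ≤ 0}) k₂ c)
    (h₁ : 0 < cross (k₁ - e₂) (k₁ - e₁)) (h₂ : cross (k₂ - e₂) (k₂ - e₁) < 0) : False := by
  obtain ⟨γ₁, hγ₁⟩ := p₁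
  obtain ⟨γ₂, hγ₂⟩ := p₂
  obtain ⟨γ₃, hγ₃⟩ := p₃
  obtain ⟨a₁, a₂, a₃, A1, A2, A3, hA⟩ := hL.logIncrement (fun t => (hγ₁ t).1) (fun t => (hγ₂ t).1)
    (fun t => (hγ₃ t).1) he₁
  obtain ⟨b₁, b₂, b₃, B1, B2, B3, hB⟩ := hL.logIncrement (fun t => (hγ₁ t).1) (fun t => (hγ₂ t).1)
    (fun t => (hγ₃ t).1) he₂
  have hne : e₁ ≠ e₂ := by
    rintro rfl
    have : cross (k₁ - e₁) (k₁ - e₁) = 0 := by simp only [cross]; ring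
    linarith
  let R : Space 2 → ℂ := fun z => toC (z - e₁) / toC (z - e₂)
  have hUne : ∀ z ∈ U, z ≠ e₁ ∧ z ≠ e₂ := fun z hz =>
    ⟨fun h => he₁ (h ▸ hz), fun h => he₂ (h ▸ hz)⟩
  have hR0 : ∀ z ∈ U, R z ≠ 0 := fun z hz =>
    div_ne_zero (toC_sub_ne_zero (hUne z hz).1) (toC_sub_ne_zero (hUne z hz).2)
  have hns : ∀ z ∈ U, 0 < Complex.normSq (toC (z - e₂)) := fun z hz =>
    Complex.normSq_pos.2 (toC_sub_ne_zero (hUne z hz).2)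
  have hRc : ∀ {a b : Space 2} (γ : Path a b), (∀ t, γ t ∈ U) → Continuous fun t => R (γ t) := by
    intro a b γ hγ
    exact Continuous.div (by fun_prop) (by fun_prop) (fun t => toC_sub_ne_zero (hUne _ (hγ t)).2)
  have combine : ∀ {a b : Space 2} {γ : Path a b} {α β u : ℂ}, (∀ t, γ t ∈ U) →
      LogIncrement e₁ γ α → LogIncrement e₂ γ β → u ≠ 0 →
      (∀ t, u * R (γ t) ∈ Complex.slitPlane) →
      α - β = Complex.log (u * R b) - Complex.log (u * R a) := by
    rintro a b γ α β u hγ ⟨g, hg, hge, rfl⟩ ⟨g', hg', hge', rfl⟩ hu hs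
    have := log_increment_eq (g := fun t => g t - g' t) (f := fun t => R (γ t)) (hg.sub hg')
      (hRc γ hγ) (fun t => by rw [Complex.exp_sub, hge, hge']) hu hs
    simp only [Path.source, Path.target] at this
    rw [← this]; ring
  have slit_of_re : ∀ w : ℂ, w ≠ 0 → 0 ≤ w.re → w ∈ Complex.slitPlane := by
    intro w hw hre
    rw [Complex.mem_slitPlane_iff]
    rcases hre.lt_or_eq with h | h
    · exact Or.inl h
    · right
      intro him
      exact hw (Complex.ext h.symm him)
  -- On the positive side `R` lies in the closed upper half-plane; the factor `-I` turns it into the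
  -- right half-plane, so that the principal branch also works at `c`. Off the chord the factor `1`
  -- suffices, and on the negative side `I` plays the same role.
  have i1 := combine (u := -Complex.I) (fun t => (hγ₁ t).1) A1 B1 (by simp) (fun t => by
    apply slit_of_re
    · exact mul_ne_zero (by simp) (hR0 _ (hγ₁ t).1)
    · have : 0 ≤ (R (γ₁ t)).im := by
        rw [im_div_toC]
        exact div_nonneg (hγ₁ t).2 (hns _ (hγ₁ t).1).le
      simpa using this)
  have i2 := combine (u := 1) (fun t => (hγ₂ t).1) A2 B2 (by simp) (fun t => by
    rw [one_mul]
    exact toC_div_mem_slitPlane (hUne _ (hγ₂ t).1).1 (hUne _ (hγ₂ t).1).2 (hγ₂ t).2)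
  have i3 := combine (u := Complex.I) (fun t => (hγ₃ t).1) A3 B3 (by simp) (fun t => by
    apply slit_of_re
    · exact mul_ne_zero (by simp) (hR0 _ (hγ₃ t).1)
    · have : (R (γ₃ t)).im ≤ 0 := by
        rw [im_div_toC]
        exact div_nonpos_of_nonpos_of_nonneg (hγ₃ t).2 (hns _ (hγ₃ t).1).le
      simpa using this)
  obtain ⟨ρ, hρ, hRρ⟩ := toC_div_of_mem_openSegment hne hc
  have hk1 : k₁ ∈ U := by simpa using (hγ₂ 0).1
  have hk2 : k₂ ∈ U := by simpa using (hγ₂ 1).1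
  have him1 : 0 < (R k₁).im := by
    rw [im_div_toC]; exact div_pos h₁ (hns _ hk1)
  have him2 : (R k₂).im < 0 := by
    rw [im_div_toC]; exact div_neg_of_neg_of_pos h₂ (hns _ hk2)
  have e1 : Complex.log (-Complex.I * R c) = Complex.log ρ + Real.pi / 2 * Complex.I := by
    have : -Complex.I * R c = ρ * Complex.I := by
      simp only [R, hRρ]; ring
    rw [this, Complex.log_ofReal_mul hρ Complex.I_ne_zero, Complex.log_I, Complex.ofReal_log hρ.le]
  have e2 : Complex.log (Complex.I * R c) = Complex.log ρ - Real.pi / 2 * Complex.I := by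
    have : Complex.I * R c = ρ * (-Complex.I) := by
      simp only [R, hRρ]; ring
    rw [this, Complex.log_ofReal_mul hρ (by simp), Complex.log_neg_I, Complex.ofReal_log hρ.le]
    ring
  have e3 : Complex.log (-Complex.I * R k₁) = Complex.log (R k₁) - Real.pi / 2 * Complex.I := by
    rw [Complex.log_mul_eq_add_log_iff (by simp) (hR0 _ hk1) |>.2, Complex.log_neg_I]
    · ring
    · rw [Complex.arg_neg_I]
      have h1 := Complex.arg_le_pi (R k₁)
      have h2 := Complex.arg_nonneg_iff.2 him1.le
      constructor <;> linarith [Real.pi_pos]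
  have e4 : Complex.log (Complex.I * R k₂) = Complex.log (R k₂) + Real.pi / 2 * Complex.I := by
    rw [Complex.log_mul_eq_add_log_iff (by simp) (hR0 _ hk2) |>.2, Complex.log_I]
    · ring
    · rw [Complex.arg_I]
      have h1 := Complex.arg_neg_iff.2 him2
      have h2 := Complex.neg_pi_lt_arg (R k₂)
      constructor <;> linarith [Real.pi_pos]
  have hsum : (a₁ - b₁) + (a₂ - b₂) + (a₃ - b₃) = 0 := by
    linear_combination hA - hB
  rw [i1, i2, i3, e1, e2, e3, e4, one_mul, one_mul] at hsum
  -- The logarithms of `ρ`, `R k₁` and `R k₂` cancel; four quarter turns in the same direction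
  -- remain.
  have h2pi : (2 * Real.pi * Complex.I : ℂ) = 0 := by linear_combination -hsum
  simp at h2pi

/-! ### Triangles -/

/-- A nonpositive real ratio would put `p` on the segment from `z` to `A`. -/
theorem toC_div_mem_slitPlane_of_mem_segment {p A B z : Space 2} (hp : p ∉ segment ℝ A B)
    (hz : z ∈ segment ℝ A B) : (toC (A - p))⁻¹ * toC (z - p) ∈ Complex.slitPlane := by
  have hA : A ≠ p := fun h => hp (h ▸ left_mem_segment ℝ A B)
  rw [mul_comm, ← div_eq_mul_inv]
  by_contra hcon
  have hb := toC_sub_ne_zero hA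
  set R := toC (z - p) / toC (A - p) with hR
  rw [Complex.mem_slitPlane_iff] at hcon
  push Not at hcon
  obtain ⟨hre, him⟩ := hcon
  have hRre : R = ((R.re : ℝ) : ℂ) := Complex.ext (by simp) (by simp [him])
  set ρ := -R.re with hρ
  have hρ0 : 0 ≤ ρ := by linarith
  have e : toC ((z - p) + ρ • (A - p)) = 0 := by
    rw [toC_add, toC_smul]
    have : toC (z - p) = R * toC (A - p) := by rw [hR, div_mul_cancel₀ _ hb]
    rw [this, hRre, hρ]
    push_cast
    ring
  rw [toC_eq_zero] at e
  apply hp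
  have e2 : (1 + ρ) • p = z + ρ • A := by
    have : (1 + ρ) • p - (z + ρ • A) = -((z - p) + ρ • (A - p)) := by module
    rw [← sub_eq_zero, this, e, neg_zero]
  have : p = (1 / (1 + ρ)) • z + (ρ / (1 + ρ)) • A := by
    calc p = (1 / (1 + ρ)) • ((1 + ρ) • p) := by
          rw [smul_smul, one_div_mul_cancel (by positivity), one_smul]
      _ = (1 / (1 + ρ)) • z + (ρ / (1 + ρ)) • A := by rw [e2]; module
  rw [this]
  exact convex_segment A B hz (left_mem_segment ℝ A B) (by positivity) (by positivity)
    (by field_simp)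

theorem LogIncrement.eq_log_div {p A B : Space 2} {γ : Path A B} {δ : ℂ} (h : LogIncrement p γ δ)
    (hp : p ∉ segment ℝ A B) (hγ : ∀ t, γ t ∈ segment ℝ A B) :
    δ = Complex.log (toC (B - p) / toC (A - p)) := by
  obtain ⟨g, hg, hge, rfl⟩ := h
  have hA := toC_sub_ne_zero (fun h => hp (h ▸ left_mem_segment ℝ A B) : A ≠ p)
  have := log_increment_eq (f := fun t => toC (γ t - p)) hg (by fun_prop) hge (inv_ne_zero hA)
    (fun t => toC_div_mem_slitPlane_of_mem_segment hp (hγ t))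
  rw [this]
  simp only [Path.source, Path.target, inv_mul_cancel₀ hA, Complex.log_one, sub_zero]
  rw [mul_comm, ← div_eq_mul_inv]

theorem toC_div_mem_slitPlane_of_notMem_segment {p A B : Space 2} (hp : p ∉ segment ℝ A B) :
    toC (B - p) / toC (A - p) ∈ Complex.slitPlane := by
  have := toC_div_mem_slitPlane_of_mem_segment hp (right_mem_segment ℝ A B)
  rwa [mul_comm, ← div_eq_mul_inv] at this

/-- If the boundary of a triangle lies in a set with closed logarithms along loops, so does the
triangle. -/
theorem HasLoopLog.convexCombo_mem {X : Set (Space 2)} (hX : HasLoopLog X) {A B C : Space 2}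
    (hAB : segment ℝ A B ⊆ X) (hBC : segment ℝ B C ⊆ X) (hCA : segment ℝ C A ⊆ X) {α β γ : ℝ}
    (hα : 0 ≤ α) (hβ : 0 ≤ β) (hγ : 0 ≤ γ) (hsum : α + β + γ = 1) :
    α • A + β • B + γ • C ∈ X := by
  set p := α • A + β • B + γ • C with hpdef
  by_contra hp
  have pAB : p ∉ segment ℝ A B := fun h => hp (hAB h)
  have pBC : p ∉ segment ℝ B C := fun h => hp (hBC h)
  have pCA : p ∉ segment ℝ C A := fun h => hp (hCA h)
  have hα' : 0 < α := lt_of_le_of_ne hα (fun h => pBC ⟨β, γ, hβ, hγ, by linarith, by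
    rw [hpdef, ← h]; simp⟩)
  have hβ' : 0 < β := lt_of_le_of_ne hβ (fun h => pCA ⟨γ, α, hγ, hα, by linarith, by
    rw [hpdef, ← h]; simp [add_comm]⟩)
  have hγ' : 0 < γ := lt_of_le_of_ne hγ (fun h => pAB ⟨α, β, hα, hβ, by linarith, by
    rw [hpdef, ← h]; simp⟩)
  obtain ⟨γ₁, h₁⟩ := joinedIn_segment A B
  obtain ⟨γ₂, h₂⟩ := joinedIn_segment B C
  obtain ⟨γ₃, h₃⟩ := joinedIn_segment C A
  obtain ⟨δ₁, δ₂, δ₃, i1, i2, i3, hδ⟩ := hX.logIncrement (fun t => hAB (h₁ t))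
    (fun t => hBC (h₂ t)) (fun t => hCA (h₃ t)) hp
  rw [i1.eq_log_div pAB h₁, i2.eq_log_div pBC h₂, i3.eq_log_div pCA h₃] at hδ
  have hA := toC_sub_ne_zero (fun h => pAB (h ▸ left_mem_segment ℝ A B) : A ≠ p)
  have hB := toC_sub_ne_zero (fun h => pBC (h ▸ left_mem_segment ℝ B C) : B ≠ p)
  have hC := toC_sub_ne_zero (fun h => pCA (h ▸ left_mem_segment ℝ C A) : C ≠ p)
  have s1 := toC_div_mem_slitPlane_of_notMem_segment pAB
  have s2 := toC_div_mem_slitPlane_of_notMem_segment pBC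
  have s3 := toC_div_mem_slitPlane_of_notMem_segment pCA
  have hcomb : α • (A - p) + β • (B - p) + γ • (C - p) = 0 := by
    have : α • (A - p) + β • (B - p) + γ • (C - p) = p - (α + β + γ) • p := by
      rw [hpdef]; module
    rw [this, hsum, one_smul, sub_self]
  have h0 := congrArg (fun z : Space 2 => z 0) hcomb
  have h1 := congrArg (fun z : Space 2 => z 1) hcomb
  simp only [PiLp.add_apply, PiLp.smul_apply, smul_eq_mul, PiLp.zero_apply] at h0 h1
  -- The vanishing weighted sum, crossed with `A - p` and `B - p`, shows that the three consecutive
  -- cross products have the same sign.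
  have x1 : β * cross (A - p) (B - p) = γ * cross (C - p) (A - p) := by
    simp only [cross]
    linear_combination (A - p) 0 * h1 - (A - p) 1 * h0
  have x2 : γ * cross (B - p) (C - p) = α * cross (A - p) (B - p) := by
    simp only [cross]
    linear_combination (B - p) 0 * h1 - (B - p) 1 * h0
  have nA := Complex.normSq_pos.2 hA
  have nB := Complex.normSq_pos.2 hB
  have nC := Complex.normSq_pos.2 hC
  have him := congrArg Complex.im hδ
  simp only [Complex.add_im, Complex.log_im, Complex.zero_im] at him
  -- If that sign is nonzero, the three arguments are all negative or all positive, so they cannot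
  -- add up to `0`. If it is zero, the ratios are positive reals, so `A - p`, `B - p`, `C - p` point
  -- the same way and no positive combination of them vanishes.
  rcases lt_trichotomy (cross (A - p) (B - p)) 0 with h | h | h
  · have y2 : cross (B - p) (C - p) < 0 := by
      by_contra hc
      nlinarith [mul_nonneg hγ'.le (not_lt.1 hc)]
    have y3 : cross (C - p) (A - p) < 0 := by
      by_contra hc
      nlinarith [mul_nonneg hγ'.le (not_lt.1 hc)]
    have z1 := Complex.arg_neg_iff.2 (show (toC (B - p) / toC (A - p)).im < 0 by
      rw [im_div_toC]; exact div_neg_of_neg_of_pos h nA)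
    have z2 := Complex.arg_neg_iff.2 (show (toC (C - p) / toC (B - p)).im < 0 by
      rw [im_div_toC]; exact div_neg_of_neg_of_pos y2 nB)
    have z3 := Complex.arg_neg_iff.2 (show (toC (A - p) / toC (C - p)).im < 0 by
      rw [im_div_toC]; exact div_neg_of_neg_of_pos y3 nC)
    linarith
  · have y2 : cross (B - p) (C - p) = 0 := by
      rw [h, mul_zero] at x2
      exact (mul_eq_zero.1 x2).resolve_left hγ'.ne'
    have key : ∀ {w : ℂ}, w ∈ Complex.slitPlane → w.im = 0 → 0 < w.re ∧ w = (w.re : ℂ) := by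
      intro w hw hw0
      rw [Complex.mem_slitPlane_iff] at hw
      exact ⟨hw.resolve_right (fun h => h hw0), Complex.ext (by simp) (by simp [hw0])⟩
    obtain ⟨r1, e1⟩ := key s1 (by rw [im_div_toC, h, zero_div])
    obtain ⟨r2, e2⟩ := key s2 (by rw [im_div_toC, y2, zero_div])
    have hc := congrArg toC hcomb
    rw [toC_add, toC_add, toC_smul, toC_smul, toC_smul, toC_eq_zero.2 rfl] at hc
    set R1 := (toC (B - p) / toC (A - p)).re
    set R2 := (toC (C - p) / toC (B - p)).re
    rw [div_eq_iff hA] at e1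
    rw [div_eq_iff hB, e1] at e2
    rw [e2, e1] at hc
    have : ((α + β * R1 + γ * (R2 * R1) : ℝ) : ℂ) * toC (A - p) = 0 := by
      push_cast; linear_combination hc
    have h3 : (α + β * R1 + γ * (R2 * R1) : ℝ) = 0 := by
      exact_mod_cast (mul_eq_zero.1 this).resolve_right hA
    have : 0 < α + β * R1 + γ * (R2 * R1) := by positivity
    linarith
  · have y2 : 0 < cross (B - p) (C - p) := by
      by_contra hc
      nlinarith [mul_nonneg hγ'.le (neg_nonneg.2 (not_lt.1 hc))]
    have y3 : 0 < cross (C - p) (A - p) := by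
      by_contra hc
      nlinarith [mul_nonneg hγ'.le (neg_nonneg.2 (not_lt.1 hc))]
    have pos : ∀ {w : ℂ}, 0 < w.im → 0 < w.arg := by
      intro w hw
      refine lt_of_le_of_ne (Complex.arg_nonneg_iff.2 hw.le) (fun h => ?_)
      have := (Complex.arg_eq_zero_iff.1 h.symm).2
      linarith
    have z1 := pos (show 0 < (toC (B - p) / toC (A - p)).im by
      rw [im_div_toC]; exact div_pos h nA)
    have z2 := pos (show 0 < (toC (C - p) / toC (B - p)).im by
      rw [im_div_toC]; exact div_pos y2 nB)
    have z3 := pos (show 0 < (toC (A - p) / toC (C - p)).im by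
      rw [im_div_toC]; exact div_pos y3 nC)
    linarith

/-! ### The interior of a p-componentwise simply connected set -/

theorem PolygonallyJoined.right_mem {X : Set (Space 2)} {A B : Space 2}
    (h : PolygonallyJoined X A B) : B ∈ X := by
  obtain ⟨hA, n, v, rfl, rfl, h⟩ := h
  rcases n with _ | n
  · exact hA
  · exact h n (by omega) (right_mem_segment ℝ _ _)

theorem PolygonallyJoined.trans_segment {X : Set (Space 2)} {A B C : Space 2}
    (h : PolygonallyJoined X A B) (hBC : segment ℝ B C ⊆ X) : PolygonallyJoined X A C := by
  obtain ⟨hA, n, v, hv0, hvn, h⟩ := h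
  refine ⟨hA, n + 1, fun i => if i ≤ n then v i else C, by simp [hv0], by simp, ?_⟩
  intro i hi
  rcases (Nat.lt_succ_iff.1 hi).lt_or_eq with h' | rfl
  · simpa [h'.le, Nat.succ_le_iff.2 h'] using h i h'
  · simpa [hvn] using hBC

theorem IsPComponent.mem_of_segment {X C : Set (Space 2)} (hC : IsPComponent X C) {A B : Space 2}
    (hA : A ∈ C) (h : segment ℝ A B ⊆ X) : B ∈ C := by
  obtain ⟨O, hO, rfl⟩ := hC
  exact PolygonallyJoined.trans_segment hA h

theorem IsPComponent.segment_subset {X C : Set (Space 2)} (hC : IsPComponent X C) {A B : Space 2}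
    (hA : A ∈ C) (h : segment ℝ A B ⊆ X) : segment ℝ A B ⊆ C := fun _ hz =>
  hC.mem_of_segment hA (((convex_segment A B).segment_subset (left_mem_segment ℝ A B) hz).trans h)

theorem exists_isPComponent {X : Set (Space 2)} {A : Space 2} (hA : A ∈ X) :
    ∃ C, IsPComponent X C ∧ A ∈ C ∧ C ⊆ X :=
  ⟨{B | PolygonallyJoined X A B}, ⟨A, hA, rfl⟩, ⟨hA, 0, fun _ => A, rfl, rfl, by simp⟩,
    fun _ h => h.right_mem⟩

theorem PComponentwiseSimplyConnected.convexCombo_mem {S : Set (Space 2)}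
    (hS : PComponentwiseSimplyConnected S) {A B C : Space 2}
    (hAB : segment ℝ A B ⊆ S) (hBC : segment ℝ B C ⊆ S) (hCA : segment ℝ C A ⊆ S) {α β γ : ℝ}
    (hα : 0 ≤ α) (hβ : 0 ≤ β) (hγ : 0 ≤ γ) (hsum : α + β + γ = 1) :
    α • A + β • B + γ • C ∈ S := by
  obtain ⟨P, hP, hA, hPS⟩ := exists_isPComponent (hAB (left_mem_segment ℝ A B))
  have hB := hP.mem_of_segment hA hAB
  have hC := hP.mem_of_segment hB hBC
  exact hPS ((hS P hP).hasLoopLog.convexCombo_mem (hP.segment_subset hA hAB)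
    (hP.segment_subset hB hBC) (hP.segment_subset hC hCA) hα hβ hγ hsum)

/-- A loop in the interior stays in one p-component, since being in it is an open and closed
condition along the loop. A point `p` outside the interior may still belong to `S`, so it is
replaced by a nearby point `q` outside `S`. -/
theorem PComponentwiseSimplyConnected.hasLoopLog_interior {S : Set (Space 2)}
    (hS : PComponentwiseSimplyConnected S) : HasLoopLog (interior S) := by
  intro x γ hγ p hp
  obtain ⟨P, hP, hxP, hPS⟩ := exists_isPComponent (interior_subset (by simpa using hγ 0) : x ∈ S)
  have hloc : ∀ t : unitInterval, ∃ ε > 0, Metric.ball (γ t) ε ⊆ S := fun t =>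
    Metric.mem_nhds_iff.1 (mem_interior_iff_mem_nhds.1 (hγ t))
  have hseg : ∀ {z w : Space 2} {ε : ℝ}, w ∈ Metric.ball z ε → segment ℝ z w ⊆ Metric.ball z ε := by
    intro z w ε hw
    exact (convex_ball z ε).segment_subset
      (Metric.mem_ball_self (lt_of_le_of_lt dist_nonneg (Metric.mem_ball.1 hw))) hw
  have hclopen : IsClopen {t | γ t ∈ P} := by
    constructor
    · rw [← isOpen_compl_iff, isOpen_iff_mem_nhds]
      intro t ht
      obtain ⟨ε, hε, hb⟩ := hloc t
      filter_upwards [γ.continuous.continuousAt.preimage_mem_nhds (Metric.ball_mem_nhds _ hε)]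
        with s hs h'
      apply ht
      apply hP.mem_of_segment h'
      rw [segment_symm]
      exact (hseg hs).trans hb
    · rw [isOpen_iff_mem_nhds]
      intro t ht
      obtain ⟨ε, hε, hb⟩ := hloc t
      filter_upwards [γ.continuous.continuousAt.preimage_mem_nhds (Metric.ball_mem_nhds _ hε)]
        with s hs
      exact hP.mem_of_segment ht ((hseg hs).trans hb)
  have hall : ∀ t, γ t ∈ P := by
    have : {t | γ t ∈ P} = Set.univ := hclopen.eq_univ ⟨0, by simpa using hxP⟩
    intro t
    exact this.ge (Set.mem_univ t)
  obtain ⟨r, hr, hdist⟩ : ∃ r > 0, ∀ t, r ≤ dist (γ t) p := by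
    obtain ⟨t₀, -, ht₀⟩ := isCompact_univ.exists_isMinOn (Set.univ_nonempty (α := unitInterval))
      (f := fun t => dist (γ t) p) (by fun_prop)
    refine ⟨dist (γ t₀) p, dist_pos.2 (fun h => hp (h ▸ hγ t₀)), fun t => ht₀ (Set.mem_univ t)⟩
  obtain ⟨q, hqS, hqp⟩ : ∃ q ∉ S, dist q p < r / 2 := by
    by_contra hcon
    push Not at hcon
    apply hp
    rw [mem_interior_iff_mem_nhds, Metric.mem_nhds_iff]
    refine ⟨r / 2, by positivity, fun q hq => ?_⟩
    by_contra hqS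
    exact absurd (Metric.mem_ball.1 hq) (not_lt.2 (hcon q hqS))
  obtain ⟨g, hg, h01⟩ := (hS P hP).hasLoopLog x γ hall q (fun h => hqS (hPS h))
  have hne : ∀ t, toC (γ t - q) ≠ 0 := fun t =>
    toC_sub_ne_zero (fun h => hqS (h ▸ hPS (hall t)))
  -- Since `q` is closer to `p` than to the loop, `(γ t - p) / (γ t - q)` stays within distance `1`
  -- of `1`, and its principal logarithm corrects the logarithm of `z - q`.
  have hratio : ∀ t, 1 + toC (q - p) / toC (γ t - q) ∈ Complex.slitPlane := by
    intro t
    apply Complex.mem_slitPlane_of_norm_lt_one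
    rw [norm_div, norm_toC, norm_toC, ← dist_eq_norm, ← dist_eq_norm,
      div_lt_one (dist_pos.2 (fun h : γ t = q => hqS (h ▸ hPS (hall t))))]
    have := dist_triangle (γ t) q p
    linarith [hdist t]
  refine ⟨⟨fun t => g t + Complex.log (1 + toC (q - p) / toC (γ t - q)), ?_⟩, fun t => ?_, ?_⟩
  · apply g.continuous.add
    refine Continuous.clog ?_ hratio
    exact continuous_const.add (Continuous.div (by fun_prop) (by fun_prop) hne)
  · simp only [ContinuousMap.coe_mk]
    rw [Complex.exp_add, hg, Complex.exp_log (Complex.slitPlane_ne_zero (hratio t)), mul_add,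
      mul_one, mul_div_cancel₀ _ (hne t), ← toC_add]
    congr 1
    abel
  · simp [h01]

open Set Filter Topology

/-! ### Planar linear algebra -/

theorem cross_add_right (u v w : Space 2) : cross u (v + w) = cross u v + cross u w := by
  simp only [cross, PiLp.add_apply]; ring

theorem cross_sub_right (u v w : Space 2) : cross u (v - w) = cross u v - cross u w := by
  simp only [cross, PiLp.sub_apply]; ring

theorem cross_smul_right (a : ℝ) (u v : Space 2) : cross u (a • v) = a * cross u v := by
  simp only [cross, PiLp.smul_apply, smul_eq_mul]; ring

theorem cross_add_left (u v w : Space 2) : cross (u + v) w = cross u w + cross v w := by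
  simp only [cross, PiLp.add_apply]; ring

theorem cross_smul_left (a : ℝ) (u v : Space 2) : cross (a • u) v = a * cross u v := by
  simp only [cross, PiLp.smul_apply, smul_eq_mul]; ring

theorem cross_self (u : Space 2) : cross u u = 0 := by simp only [cross]; ring

theorem cross_swap (u v : Space 2) : cross u v = -cross v u := by simp only [cross]; ring

theorem cross_neg_left (u v : Space 2) : cross (-u) v = -cross u v := by
  simp only [cross, PiLp.neg_apply]; ring

@[fun_prop]
theorem continuous_cross {α : Type*} [TopologicalSpace α] {f g : α → Space 2} (hf : Continuous f)
    (hg : Continuous g) : Continuous fun a => cross (f a) (g a) := by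
  unfold cross
  fun_prop

theorem norm_sq_eq (v : Space 2) : ‖v‖ ^ 2 = v 0 ^ 2 + v 1 ^ 2 := by
  rw [EuclideanSpace.norm_sq_eq, Fin.sum_univ_two]
  simp

/-- The counterclockwise rotation by a right angle. -/
def rot (v : Space 2) : Space 2 := !₂[-v 1, v 0]

theorem cross_rot_right (v : Space 2) : cross v (rot v) = ‖v‖ ^ 2 := by
  rw [norm_sq_eq]; simp [cross, rot]; ring

theorem cross_rot_left (v : Space 2) : cross (rot v) v = -‖v‖ ^ 2 := by
  rw [cross_swap, cross_rot_right]

theorem exists_smul_eq_of_cross_eq_zero {u v : Space 2} (hu : u ≠ 0) (h : cross u v = 0) :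
    ∃ t : ℝ, v = t • u := by
  have hn : 0 < ‖u‖ ^ 2 := by positivity
  rw [norm_sq_eq] at hn
  refine ⟨(u 0 * v 0 + u 1 * v 1) / (u 0 ^ 2 + u 1 ^ 2), ?_⟩
  simp only [cross] at h
  ext i
  fin_cases i
  · simp only [Fin.zero_eta, PiLp.smul_apply, smul_eq_mul]
    field_simp
    linear_combination (-u 1) * h
  · simp only [Fin.mk_one, PiLp.smul_apply, smul_eq_mul]
    field_simp
    linear_combination (u 0) * h

/-- Two segments whose endpoints are strictly separated by each other's lines intersect. -/
theorem segment_inter_of_cross {A B C D : Space 2}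
    (h1 : cross (B - A) (C - A) * cross (B - A) (D - A) < 0)
    (h2 : cross (D - C) (A - C) * cross (D - C) (B - C) < 0) :
    (segment ℝ A B ∩ segment ℝ C D).Nonempty := by
  set a := cross (D - C) (A - C)
  set b := cross (D - C) (B - C)
  set c := cross (B - A) (C - A)
  set d := cross (B - A) (D - A)
  have hab : a - b = -cross (D - C) (B - A) := by
    simp only [a, b, cross, PiLp.sub_apply]; ring
  have hcd : c - d = cross (D - C) (B - A) := by
    simp only [c, d, cross, PiLp.sub_apply]; ring
  have habne : a - b ≠ 0 := by
    intro h
    have : a = b := by linarith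
    rw [this] at h2
    nlinarith [mul_self_nonneg b]
  have hN : cross (D - C) (B - A) ≠ 0 := by
    intro h; rw [h] at hab; exact habne (by linarith)
  have frac : ∀ {x y : ℝ}, x * y < 0 → 0 ≤ x / (x - y) ∧ x / (x - y) ≤ 1 := by
    intro x y hxy
    rcases lt_or_gt_of_ne (show x ≠ 0 by rintro rfl; simp at hxy) with hx | hx
    · have hy : 0 < y := by by_contra hy; nlinarith
      exact ⟨div_nonneg_of_nonpos hx.le (by linarith),
        (div_le_one_of_neg (by linarith)).2 (by linarith)⟩
    · have hy : y < 0 := by by_contra hy; nlinarith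
      exact ⟨div_nonneg hx.le (by linarith), (div_le_one (by linarith)).2 (by linarith)⟩
  have e : A + (a / (a - b)) • (B - A) = C + (c / (c - d)) • (D - C) := by
    rw [hab, hcd]
    ext i
    fin_cases i
    · simp only [Fin.zero_eta, PiLp.add_apply, PiLp.smul_apply, PiLp.sub_apply, smul_eq_mul]
      field_simp
      simp only [a, c, cross, PiLp.sub_apply]
      ring
    · simp only [Fin.mk_one, PiLp.add_apply, PiLp.smul_apply, PiLp.sub_apply, smul_eq_mul]
      field_simp
      simp only [a, c, cross, PiLp.sub_apply]
      ring
  refine ⟨A + (a / (a - b)) • (B - A), ?_, ?_⟩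
  · rw [segment_eq_image']
    exact ⟨_, frac h2, rfl⟩
  · rw [e, segment_eq_image']
    exact ⟨_, frac h1, rfl⟩

/-! ### Visibility -/

/-- `x` sees `y` within `U`. -/
def Sees (U : Set (Space 2)) (x y : Space 2) : Prop := segment ℝ x y ⊆ U

theorem Sees.symm {U : Set (Space 2)} {x y : Space 2} (h : Sees U x y) : Sees U y x := by
  unfold Sees at *; rwa [segment_symm]

theorem Sees.left {U : Set (Space 2)} {x y : Space 2} (h : Sees U x y) : x ∈ U :=
  h (left_mem_segment ℝ x y)

theorem Sees.right {U : Set (Space 2)} {x y : Space 2} (h : Sees U x y) : y ∈ U :=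
  h (right_mem_segment ℝ x y)

theorem Sees.refl {U : Set (Space 2)} {x : Space 2} (h : x ∈ U) : Sees U x x := by
  unfold Sees; rw [segment_same]; simpa using h

theorem Sees.sub {U : Set (Space 2)} {x y a b : Space 2} (h : Sees U x y)
    (ha : a ∈ segment ℝ x y) (hb : b ∈ segment ℝ x y) : Sees U a b :=
  ((convex_segment x y).segment_subset ha hb).trans h

theorem sees_line_iff {U : Set (Space 2)} {p v : Space 2} {a b : ℝ} :
    Sees U (p + a • v) (p + b • v) ↔ ∀ s ∈ uIcc a b, p + s • v ∈ U := by
  have : segment ℝ (p + a • v) (p + b • v) = (fun s : ℝ => p + s • v) '' uIcc a b := by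
    rw [← segment_eq_uIcc]
    have := image_segment ℝ (AffineMap.lineMap p (p + v) : ℝ →ᵃ[ℝ] Space 2) a b
    simp only [AffineMap.lineMap_apply, vsub_eq_sub, add_sub_cancel_left, vadd_eq_add] at this
    rw [add_comm p, add_comm p, ← this]
    congr 1
    funext s
    rw [AffineMap.lineMap_apply]
    simp [add_comm]
  unfold Sees
  rw [this]
  simp [subset_def]

theorem sees_iff {U : Set (Space 2)} {x y : Space 2} :
    Sees U x y ↔ ∀ s ∈ Icc (0 : ℝ) 1, x + s • (y - x) ∈ U := by
  have := sees_line_iff (U := U) (p := x) (v := y - x) (a := 0) (b := 1)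
  rw [uIcc_of_le zero_le_one] at this
  simpa using this

theorem Sees.line_trans {U : Set (Space 2)} {p v : Space 2} {a b c : ℝ}
    (h₁ : Sees U (p + a • v) (p + b • v)) (h₂ : Sees U (p + b • v) (p + c • v)) :
    Sees U (p + a • v) (p + c • v) := by
  rw [sees_line_iff] at *
  intro s hs
  rcases uIcc_subset_uIcc_union_uIcc hs with h | h
  exacts [h₁ s h, h₂ s h]

/-- Compactness of the parameter interval `[0, 1]`. -/
theorem isOpen_sees {U : Set (Space 2)} (hU : IsOpen U) :
    IsOpen {q : Space 2 × Space 2 | Sees U q.1 q.2} := by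
  rw [isOpen_iff_mem_nhds]
  rintro ⟨x, y⟩ h
  have h' : Sees U x y := h
  rw [sees_iff] at h'
  have := (isCompact_Icc (a := (0 : ℝ)) (b := 1)).eventually_forall_of_forall_eventually
    (x₀ := (x, y)) (P := fun q s => q.1 + s • (q.2 - q.1) ∈ U) (fun s hs => by
      have hc : Continuous fun z : (Space 2 × Space 2) × ℝ =>
          z.1.1 + z.2 • (z.1.2 - z.1.1) := by fun_prop
      exact hc.continuousAt.preimage_mem_nhds (hU.mem_nhds (h' s hs)))
  filter_upwards [this] with q hq
  exact sees_iff.2 hq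

theorem Sees.eventually {α : Type*} {l : Filter α} {U : Set (Space 2)} (hU : IsOpen U)
    {x y : Space 2} (h : Sees U x y) {f g : α → Space 2} (hf : Tendsto f l (𝓝 x))
    (hg : Tendsto g l (𝓝 y)) : ∀ᶠ a in l, Sees U (f a) (g a) :=
  (hf.prodMk_nhds hg).eventually ((isOpen_sees hU).mem_nhds h)

theorem Sees.joinedIn {U : Set (Space 2)} {x y : Space 2} (h : Sees U x y) : JoinedIn U x y :=
  JoinedIn.mono (joinedIn_segment x y) h

/-- The part of the line through `z` in direction `v` that `z` sees within `U`. -/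
def chord (U : Set (Space 2)) (z v : Space 2) : Set (Space 2) :=
  {c | ∃ t : ℝ, c = z + t • v ∧ Sees U z c}

theorem mem_chord_self {U : Set (Space 2)} {z : Space 2} (v : Space 2) (hz : z ∈ U) :
    z ∈ chord U z v := ⟨0, by simp, Sees.refl hz⟩

theorem chord_subset (U : Set (Space 2)) (z v : Space 2) : chord U z v ⊆ U := by
  rintro c ⟨t, -, h⟩
  exact h.right

theorem chord_eq_of_mem {U : Set (Space 2)} {z v c : Space 2} (h : c ∈ chord U z v) :
    chord U c v = chord U z v := by
  obtain ⟨t, rfl, ht⟩ := h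
  ext w
  constructor
  · rintro ⟨s, rfl, hs⟩
    have e : z + t • v + s • v = z + (t + s) • v := by module
    refine ⟨t + s, e, ?_⟩
    rw [e] at hs ⊢
    have h1 : Sees U (z + (0 : ℝ) • v) (z + t • v) := by simpa using ht
    have := h1.line_trans hs
    simpa using this
  · rintro ⟨s, rfl, hs⟩
    refine ⟨s - t, by module, ?_⟩
    have h1 : Sees U (z + t • v) (z + (0 : ℝ) • v) := by simpa using ht.symm
    have h2 : Sees U (z + (0 : ℝ) • v) (z + s • v) := by simpa using hs
    exact h1.line_trans h2

theorem sees_of_mem_chord {U : Set (Space 2)} {z v c c' : Space 2} (h : c ∈ chord U z v)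
    (h' : c' ∈ chord U z v) : Sees U c c' := by
  rw [← chord_eq_of_mem h] at h'
  exact h'.choose_spec.2

theorem segment_subset_chord {U : Set (Space 2)} {z v c c' : Space 2} (h : c ∈ chord U z v)
    (h' : c' ∈ chord U z v) : segment ℝ c c' ⊆ chord U z v := by
  intro w hw
  have hs := sees_of_mem_chord h h'
  rw [← chord_eq_of_mem h] at h' ⊢
  obtain ⟨t, rfl, ht⟩ := h'
  rw [segment_eq_image'] at hw
  obtain ⟨s, hs01, rfl⟩ := hw
  refine ⟨s * t, by simp [smul_smul], ?_⟩
  exact hs.sub (left_mem_segment ℝ _ _) (by rw [segment_eq_image']; exact ⟨s, hs01, rfl⟩)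

theorem cross_of_mem_chord {U : Set (Space 2)} {z v c : Space 2} (h : c ∈ chord U z v) :
    cross v (c - z) = 0 := by
  obtain ⟨t, rfl, -⟩ := h
  simp [cross_smul_right, cross_self]

theorem mem_chord_of_cross {U : Set (Space 2)} {z v c k : Space 2} (hv : v ≠ 0)
    (hc : c ∈ chord U z v) (hk : Sees U c k) (h : cross v (k - z) = 0) : k ∈ chord U z v := by
  have h0 : cross v (k - c) = 0 := by
    have := cross_of_mem_chord hc
    have e : k - c = (k - z) - (c - z) := by abel
    rw [e, cross_sub_right, h, this, sub_zero]
  obtain ⟨t, ht⟩ := exists_smul_eq_of_cross_eq_zero hv h0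
  rw [← chord_eq_of_mem hc]
  exact ⟨t, by rw [← ht]; abel, hk⟩

/-- Bounded open plane sets without holes. -/
structure IsHolefree (U : Set (Space 2)) : Prop where
  isOpen : IsOpen U
  isBounded : Bornology.IsBounded U
  hasLoopLog : HasLoopLog U

theorem IsHolefree.exists_exit {U : Set (Space 2)} (hU : IsHolefree U) {z v : Space 2} (hz : z ∈ U)
    (hv : v ≠ 0) : ∃ t : ℝ, 0 < t ∧ z + t • v ∉ U ∧ ∀ s, 0 ≤ s → s < t → z + s • v ∈ U := by
  let T : Set ℝ := {t | 0 ≤ t ∧ z + t • v ∉ U}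
  have hcl : IsClosed T := by
    apply isClosed_Ici.inter
    have : Continuous fun t : ℝ => z + t • v := by fun_prop
    exact hU.isOpen.isClosed_compl.preimage this
  have hne : T.Nonempty := by
    obtain ⟨R, hR⟩ := hU.isBounded.exists_norm_le
    have hvn : 0 < ‖v‖ := norm_pos_iff.2 hv
    refine ⟨(|R| + ‖z‖ + 1) / ‖v‖, by positivity, fun h => ?_⟩
    have h1 := hR _ h
    have h2 : ‖((|R| + ‖z‖ + 1) / ‖v‖) • v‖ = |R| + ‖z‖ + 1 := by
      rw [norm_smul, Real.norm_of_nonneg (by positivity)]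
      field_simp
    have h3 := norm_sub_le (z + ((|R| + ‖z‖ + 1) / ‖v‖) • v) z
    rw [add_sub_cancel_left, h2] at h3
    linarith [le_abs_self R]
  have hbd : BddBelow T := ⟨0, fun t ht => ht.1⟩
  have hmem := hcl.csInf_mem hne hbd
  refine ⟨sInf T, lt_of_le_of_ne hmem.1 (fun h => hmem.2 (by rw [← h]; simpa using hz)), hmem.2,
    fun s hs hst => ?_⟩
  by_contra h
  exact absurd (csInf_le hbd ⟨hs, h⟩) (not_le.2 hst)

/-- The ends are the first exits from `U` in the directions `v` and `-v`; being outside `U`, they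
serve as the two missing points in `HasLoopLog.false_of_cross_chord`. -/
theorem IsHolefree.chord_eq_openSegment {U : Set (Space 2)} (hU : IsHolefree U) {z v : Space 2}
    (hz : z ∈ U) (hv : v ≠ 0) : ∃ a b : ℝ, a < 0 ∧ 0 < b ∧ z + a • v ∉ U ∧ z + b • v ∉ U ∧
      chord U z v = openSegment ℝ (z + b • v) (z + a • v) := by
  obtain ⟨b, hb, hbU, hb'⟩ := hU.exists_exit hz hv
  obtain ⟨a, ha, haU, ha'⟩ := hU.exists_exit hz (neg_ne_zero.2 hv)
  refine ⟨-a, b, by linarith, hb, by simpa using haU, hbU, ?_⟩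
  ext c
  constructor
  · rintro ⟨t, rfl, ht⟩
    have ht' : Sees U (z + (0 : ℝ) • v) (z + t • v) := by simpa using ht
    rw [sees_line_iff] at ht'
    have h1 : t < b := by
      by_contra h
      exact hbU (ht' b (mem_uIcc.2 (Or.inl ⟨hb.le, not_lt.1 h⟩)))
    have h2 : -a < t := by
      by_contra h
      exact haU (by simpa using ht' (-a) (mem_uIcc.2 (Or.inr ⟨not_lt.1 h, by linarith⟩)))
    refine ⟨(t + a) / (b + a), (b - t) / (b + a), div_pos (by linarith) (by linarith),
      div_pos (by linarith) (by linarith), ?_, ?_⟩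
    · field_simp; ring
    · have hba : b + a ≠ 0 := by linarith
      have e1 : (t + a) / (b + a) + (b - t) / (b + a) = 1 := by field_simp; ring
      have e2 : (t + a) / (b + a) * b + (b - t) / (b + a) * (-a) = t := by field_simp; ring
      calc _ = ((t + a) / (b + a) + (b - t) / (b + a)) • z +
            ((t + a) / (b + a) * b + (b - t) / (b + a) * (-a)) • v := by module
        _ = _ := by rw [e1, e2, one_smul]
  · rintro ⟨p, q, hp, hq, hpq, rfl⟩
    have e : p • (z + b • v) + q • (z + -a • v) = z + (p * b - q * a) • v := by
      have : p • (z + b • v) + q • (z + -a • v) = (p + q) • z + (p * b - q * a) • v := by module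
      rw [this, hpq, one_smul]
    have l1 : p * b - q * a < b := by nlinarith
    have l2 : -a < p * b - q * a := by nlinarith
    refine ⟨p * b - q * a, e, ?_⟩
    rw [e]
    have : Sees U (z + (0 : ℝ) • v) (z + (p * b - q * a) • v) := by
      rw [sees_line_iff]
      intro s hs
      rcases mem_uIcc.1 hs with h | h
      · exact hb' s h.1 (by linarith)
      · have := ha' (-s) (by linarith) (by linarith)
        simpa using this
    simpa using this

/-- A chord separates its two sides. -/
theorem IsHolefree.sep {U : Set (Space 2)} (hU : IsHolefree U) {z v c₁ c₂ k₁ k₂ : Space 2}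
    (hz : z ∈ U) (hv : v ≠ 0) (hc₁ : c₁ ∈ chord U z v) (hc₂ : c₂ ∈ chord U z v)
    (h₁ : Sees U c₁ k₁) (h₂ : Sees U c₂ k₂) (hJ : JoinedIn (U \ chord U z v) k₁ k₂)
    (hk₁ : 0 < cross v (k₁ - z)) : 0 ≤ cross v (k₂ - z) := by
  by_contra hk₂
  rw [not_le] at hk₂
  obtain ⟨a, b, ha, hb, haU, hbU, he⟩ := hU.chord_eq_openSegment hz hv
  have hcr : ∀ w, cross (w - (z + a • v)) (w - (z + b • v)) = (b - a) * cross v (w - z) := by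
    intro w
    simp only [cross, PiLp.sub_apply, PiLp.add_apply, PiLp.smul_apply, smul_eq_mul]; ring
  have hline : ∀ {c k : Space 2}, c ∈ chord U z v → ∀ w ∈ segment ℝ c k, ∃ s : ℝ, 0 ≤ s ∧
      cross v (w - z) = s * cross v (k - z) := by
    intro c k hc w hw
    rw [segment_eq_image'] at hw
    obtain ⟨s, hs, rfl⟩ := hw
    refine ⟨s, hs.1, ?_⟩
    have e : c + s • (k - c) - z = (1 - s) • (c - z) + s • (k - z) := by module
    simp only [e, cross_add_right, cross_smul_right, cross_of_mem_chord hc]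
    ring
  have hba : 0 < b - a := by linarith
  refine hU.hasLoopLog.false_of_cross_chord hbU haU (c := c₁) (he ▸ hc₁) ?_ (he ▸ hJ) ?_
    (by rw [hcr]; positivity) (by rw [hcr]; exact mul_neg_of_pos_of_neg hba hk₂)
  · refine (joinedIn_segment c₁ k₁).mono (fun w hw => ⟨h₁ hw, ?_⟩)
    obtain ⟨s, hs, e⟩ := hline hc₁ w hw
    simp only [mem_ofPred_eq, hcr, e]
    positivity
  · refine JoinedIn.trans (y := c₂) ((joinedIn_segment c₂ k₂).symm.mono (fun w hw => ⟨h₂ hw, ?_⟩))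
      ((joinedIn_segment c₂ c₁).mono (fun w hw => ?_))
    · obtain ⟨s, hs, e⟩ := hline hc₂ w hw
      simp only [mem_ofPred_eq, hcr, e]
      exact mul_nonpos_of_nonneg_of_nonpos hba.le (mul_nonpos_of_nonneg_of_nonpos hs hk₂.le)
    · have := segment_subset_chord hc₂ hc₁ hw
      refine ⟨chord_subset U z v this, ?_⟩
      simp only [mem_ofPred_eq, hcr, cross_of_mem_chord this]
      simp

theorem IsHolefree.sep_mul {U : Set (Space 2)} (hU : IsHolefree U) {z v c₁ c₂ k₁ k₂ : Space 2}
    (hz : z ∈ U) (hv : v ≠ 0) (hc₁ : c₁ ∈ chord U z v) (hc₂ : c₂ ∈ chord U z v)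
    (h₁ : Sees U c₁ k₁) (h₂ : Sees U c₂ k₂) (hJ : JoinedIn (U \ chord U z v) k₁ k₂) :
    0 ≤ cross v (k₁ - z) * cross v (k₂ - z) := by
  rcases lt_trichotomy (cross v (k₁ - z)) 0 with h | h | h
  · rcases le_or_gt (cross v (k₂ - z)) 0 with h' | h'
    · exact mul_nonneg_of_nonpos_of_nonpos h.le h'
    · exact absurd (hU.sep hz hv hc₂ hc₁ h₂ h₁ hJ.symm h') (not_le.2 h)
  · rw [h, zero_mul]
  · exact mul_nonneg h.le (hU.sep hz hv hc₁ hc₂ h₁ h₂ hJ h)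

/-! ### Stars -/

/-- The points that see a point of `K` within `U`. -/
def star (U K : Set (Space 2)) : Set (Space 2) := {z | ∃ k ∈ K, Sees U z k}

/-- Any two points of `K` are joined by a path in `K`. -/
def PathJoined (K : Set (Space 2)) : Prop := ∀ ⦃x⦄, x ∈ K → ∀ ⦃y⦄, y ∈ K → JoinedIn K x y

/-- `V` is convex relative to `U`. -/
def RelConvex (U V : Set (Space 2)) : Prop :=
  ∀ ⦃x⦄, x ∈ V → ∀ ⦃y⦄, y ∈ V → Sees U x y → Sees V x y

theorem star_subset (U K : Set (Space 2)) : star U K ⊆ U := by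
  rintro z ⟨k, -, h⟩
  exact h.left

theorem subset_star {U K : Set (Space 2)} (h : K ⊆ U) : K ⊆ star U K := fun k hk =>
  ⟨k, hk, Sees.refl (h hk)⟩

theorem isOpen_star {U : Set (Space 2)} (hU : IsOpen U) (K : Set (Space 2)) :
    IsOpen (star U K) := by
  have : star U K = ⋃ k ∈ K, {z | Sees U z k} := by
    ext z; simp [star]
  rw [this]
  refine isOpen_biUnion fun k _ => ?_
  exact (isOpen_sees hU).preimage (f := fun z : Space 2 => (z, k)) (by fun_prop)

theorem Sees.star {U K : Set (Space 2)} {x k : Space 2} (hk : k ∈ K) (h : Sees U x k) :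
    Sees (star U K) x k := fun _ hz => ⟨k, hk, h.sub hz (right_mem_segment ℝ x k)⟩

theorem PathJoined.star {U K : Set (Space 2)} (hK : PathJoined K) (hKU : K ⊆ U) :
    PathJoined (star U K) := by
  rintro x ⟨k, hk, hx⟩ y ⟨l, hl, hy⟩
  exact ((hx.star hk).joinedIn.trans ((hK hk hl).mono (subset_star hKU))).trans
    (hy.star hl).symm.joinedIn

theorem notMem_chord_of_notMem_star {U K : Set (Space 2)} {z v k : Space 2} (hz : z ∉ star U K)
    (hk : k ∈ K) : k ∉ chord U z v := by
  rintro ⟨t, -, h⟩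
  exact hz ⟨k, hk, h⟩

/-- The point `z` sees its whole chord but no point of `K`, so paths in `K` avoid the chord. -/
theorem IsHolefree.star_sep {U K : Set (Space 2)} (hU : IsHolefree U) (hK : PathJoined K)
    (hKU : K ⊆ U) {z v c₁ c₂ k₁ k₂ : Space 2} (hz : z ∈ U) (hzK : z ∉ star U K) (hv : v ≠ 0)
    (hc₁ : c₁ ∈ chord U z v) (hc₂ : c₂ ∈ chord U z v) (hk₁ : k₁ ∈ K) (hk₂ : k₂ ∈ K)
    (h₁ : Sees U c₁ k₁) (h₂ : Sees U c₂ k₂) : 0 ≤ cross v (k₁ - z) * cross v (k₂ - z) :=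
  hU.sep_mul hz hv hc₁ hc₂ h₁ h₂
    ((hK hk₁ hk₂).mono fun _ hk => ⟨hKU hk, notMem_chord_of_notMem_star hzK hk⟩)

/-- A point outside the star of `K` lies on a chord that avoids the star. -/
theorem IsHolefree.exists_chord_disjoint {U K : Set (Space 2)} (hU : IsHolefree U)
    (hK : PathJoined K) (hKU : K ⊆ U) {z : Space 2} (hz : z ∈ U) (hzK : z ∉ star U K) :
    ∃ v ≠ 0, Disjoint (chord U z v) (star U K) := by
  by_contra hcon
  push Not at hcon
  -- Suppose every chord through `z` meets the star. Some point of that chord then sees a point of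
  -- `K`, which is off the line; `side 1` and `side (-1)` record on which side it can lie. These
  -- sets are open, cover the nonzero directions, are disjoint there by separation, and are
  -- exchanged by `v ↦ -v`, contrary to the connectedness of the punctured plane.
  let side : ℝ → Set (Space 2) := fun σ =>
    {v | ∃ t : ℝ, ∃ k ∈ K, Sees U z (z + t • v) ∧ Sees U (z + t • v) k ∧ 0 < σ * cross v (k - z)}
  have hopen : ∀ σ, IsOpen (side σ) := by
    intro σ
    rw [isOpen_iff_mem_nhds]
    rintro v ⟨t, k, hk, h1, h2, h3⟩
    have hc : Tendsto (fun v : Space 2 => z + t • v) (𝓝 v) (𝓝 (z + t • v)) :=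
      Continuous.tendsto (by fun_prop) v
    have hc3 : Continuous fun v : Space 2 => σ * cross v (k - z) := by fun_prop
    filter_upwards [h1.eventually hU.isOpen tendsto_const_nhds hc,
      h2.eventually hU.isOpen hc tendsto_const_nhds,
      hc3.continuousAt.eventually (lt_mem_nhds h3)] with w e1 e2 e3
    exact ⟨t, k, hk, e1, e2, e3⟩
  have hcov : ∀ v ≠ 0, v ∈ side 1 ∨ v ∈ side (-1) := by
    intro v hv
    obtain ⟨c, ⟨t, rfl, ht⟩, k, hk, hck⟩ := not_disjoint_iff.1 (hcon v hv)
    rcases lt_trichotomy (cross v (k - z)) 0 with h | h | h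
    · exact Or.inr ⟨t, k, hk, ht, hck, by linarith⟩
    · exact absurd (mem_chord_of_cross hv ⟨t, rfl, ht⟩ hck h)
        (notMem_chord_of_notMem_star hzK hk)
    · exact Or.inl ⟨t, k, hk, ht, hck, by linarith⟩
  have hdisj : ∀ v ≠ 0, v ∈ side 1 → v ∈ side (-1) → False := by
    rintro v hv ⟨t, k, hk, h1, h2, h3⟩ ⟨t', k', hk', h1', h2', h3'⟩
    have := hU.star_sep hK hKU hz hzK hv ⟨t, rfl, h1⟩ ⟨t', rfl, h1'⟩ hk hk' h2 h2'
    nlinarith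
  have hneg : ∀ σ v, v ∈ side σ → -v ∈ side (-σ) := by
    rintro σ v ⟨t, k, hk, h1, h2, h3⟩
    refine ⟨-t, k, hk, by simpa using h1, by simpa using h2, ?_⟩
    rw [cross_neg_left]; linarith
  have hconn : IsPreconnected ({0}ᶜ : Set (Space 2)) :=
    (isConnected_compl_singleton_of_one_lt_rank (by
      rw [← Module.finrank_eq_rank, finrank_euclideanSpace_fin]; norm_num) 0).isPreconnected
  let e : Space 2 := EuclideanSpace.single 0 1
  have he : e ≠ 0 := by
    intro h
    have := congrArg (fun x : Space 2 => x 0) h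
    simp [e] at this
  have hne1 : (({0}ᶜ : Set (Space 2)) ∩ side 1).Nonempty := by
    rcases hcov e he with h | h
    · exact ⟨e, he, h⟩
    · exact ⟨-e, neg_ne_zero.2 he, by simpa using hneg _ _ h⟩
  have hne2 : (({0}ᶜ : Set (Space 2)) ∩ side (-1)).Nonempty := by
    obtain ⟨w, hw, h⟩ := hne1
    exact ⟨-w, neg_ne_zero.2 hw, hneg _ _ h⟩
  obtain ⟨w, hw, h1, h2⟩ := hconn _ _ (hopen 1) (hopen (-1)) (fun v hv => hcov v hv) hne1 hne2
  exact hdisj w hw h1 h2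

/-- If a point `z` of the segment were outside the star, a chord through `z` missing the star would
have `x` and `y` strictly on opposite sides, although the path-joined star connects them off the
chord. -/
theorem IsHolefree.relConvex_star {U K : Set (Space 2)} (hU : IsHolefree U) (hK : PathJoined K)
    (hKU : K ⊆ U) : RelConvex U (star U K) := by
  intro x hx y hy hxy z hz
  by_contra hzK
  have hzU : z ∈ U := hxy hz
  obtain ⟨v, hv, hd⟩ := hU.exists_chord_disjoint hK hKU hzU hzK
  have hzx : Sees U z x := hxy.sub hz (left_mem_segment ℝ x y)
  have hzy : Sees U z y := hxy.sub hz (right_mem_segment ℝ x y)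
  have hx0 : cross v (x - z) ≠ 0 := fun h =>
    disjoint_left.1 hd (mem_chord_of_cross hv (mem_chord_self v hzU) hzx h) hx
  have hy0 : cross v (y - z) ≠ 0 := fun h =>
    disjoint_left.1 hd (mem_chord_of_cross hv (mem_chord_self v hzU) hzy h) hy
  have := hU.sep_mul hzU hv (mem_chord_self v hzU) (mem_chord_self v hzU) hzx hzy
    ((hK.star hKU hx hy).mono fun w hw =>
      ⟨star_subset U K hw, fun h => disjoint_left.1 hd h hw⟩)
  rw [segment_eq_image'] at hz
  obtain ⟨s, ⟨hs0, hs1⟩, rfl⟩ := hz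
  have e1 : x - (x + s • (y - x)) = (-s) • (y - x) := by module
  have e2 : y - (x + s • (y - x)) = (1 - s) • (y - x) := by module
  simp only [e1, e2, cross_smul_right] at this hx0 hy0
  have hs0' : 0 < s := lt_of_le_of_ne hs0 (by rintro rfl; simp at hx0)
  have hs1' : s < 1 := lt_of_le_of_ne hs1 (by rintro rfl; simp at hy0)
  have hc : cross v (y - x) ≠ 0 := fun h => hx0 (by rw [h, mul_zero])
  have : 0 < s * (1 - s) * (cross v (y - x) * cross v (y - x)) :=
    mul_pos (mul_pos hs0' (by linarith)) (mul_self_pos.2 hc)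
  nlinarith

theorem RelConvex.mem_of_mem_openSegment {U V : Set (Space 2)} (hU : IsOpen U) (hV : IsOpen V)
    (hUV : RelConvex U V) {c y z : Space 2} (hc : c ∈ closure V) (hy : y ∈ V) (hcy : Sees U c y)
    (hz : z ∈ openSegment ℝ c y) : z ∈ V := by
  obtain ⟨α, β, hα, hβ, hαβ, rfl⟩ := hz
  have := mem_closure_iff_nhdsWithin_neBot.1 hc
  -- When `c` is replaced by a nearby `c'` in `V`, the other end is shifted to `f c'` so that `z`
  -- keeps its place: `α • c' + β • f c' = α • c + β • y`.
  let f : Space 2 → Space 2 := fun c' => y + (α / β) • (c - c')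
  have hf : Tendsto f (𝓝[V] c) (𝓝 y) := by
    have : Continuous f := by fun_prop
    have h := this.tendsto c
    simp only [f, sub_self, smul_zero, add_zero] at h
    exact h.mono_left nhdsWithin_le_nhds
  obtain ⟨c', hc', h1, h2⟩ := (eventually_mem_nhdsWithin.and ((hf.eventually (hV.mem_nhds hy)).and
    (hcy.eventually hU (tendsto_id.mono_left nhdsWithin_le_nhds) hf))).exists
  refine hUV hc' h1 h2 ⟨α, β, hα.le, hβ.le, hαβ, ?_⟩
  simp only [f, smul_add, smul_smul, mul_div_cancel₀ _ hβ.ne']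
  module

/-! ### Windows -/

/-- The chord through `X` in direction `v` is a part of the boundary of `V`. -/
structure IsWindow (U V : Set (Space 2)) (X v : Space 2) : Prop where
  mem : X ∈ U
  norm_eq : ‖v‖ = 1
  disj : Disjoint (chord U X v) V
  subset_closure : chord U X v ⊆ closure V

theorem IsWindow.ne_zero {U V : Set (Space 2)} {X v : Space 2} (h : IsWindow U V X v) : v ≠ 0 := by
  rintro rfl
  simpa using h.norm_eq

/-- The direction is a limit of the directions in which points `y n` of the star, converging to `X`,
see points `p n` of `K`. Points of the chord are limits of points seeing some `p n` along these
lines, which puts the chord in the closure. -/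
theorem IsHolefree.exists_isWindow {U K : Set (Space 2)} (hU : IsHolefree U) (hK : PathJoined K)
    (hKU : K ⊆ U) {X : Space 2} (hX : X ∈ U) (hXV : X ∉ star U K) (hXc : X ∈ closure (star U K)) :
    ∃ v, IsWindow U (star U K) X v := by
  obtain ⟨r, hr, hball⟩ := Metric.isOpen_iff.1 hU.isOpen X hX
  have hseg : ∀ {q : Space 2}, q ∈ Metric.ball X r → Sees U X q := fun hq =>
    ((convex_ball X r).segment_subset (Metric.mem_ball_self hr) hq).trans hball
  have hex : ∀ n : ℕ, ∃ y ∈ star U K, dist X y < min (r / 2) (1 / ((n : ℝ) + 1)) := fun n =>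
    Metric.mem_closure_iff.1 hXc _ (lt_min (by positivity) (by positivity))
  choose y hyV hyd using hex
  choose p hp hyp using hyV
  have hyt : Tendsto y atTop (𝓝 X) := by
    rw [tendsto_iff_dist_tendsto_zero]
    refine squeeze_zero (fun _ => dist_nonneg) (fun n => ?_)
      (tendsto_one_div_add_atTop_nhds_zero_nat (𝕜 := ℝ))
    rw [dist_comm]
    exact ((hyd n).trans_le (min_le_right _ _)).le
  -- The point `X` sees its whole ball of radius `r`, so no `p n` lies in that ball.
  have hlen : ∀ n, r / 2 < ‖p n - y n‖ := by
    intro n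
    have h1 : r ≤ dist (p n) X := by
      by_contra h
      exact hXV ⟨p n, hp n, hseg (not_le.1 h)⟩
    have h2 := dist_triangle (p n) (y n) X
    have h3 := (hyd n).trans_le (min_le_left _ _)
    rw [dist_comm] at h3
    rw [dist_eq_norm (p n) (y n)] at h2
    linarith
  obtain ⟨v, hv, φ, hφ, hlim⟩ := (isCompact_sphere (0 : Space 2) 1).tendsto_subseq
    (x := fun n => ‖p n - y n‖⁻¹ • (p n - y n)) (fun n => by
      have : 0 < ‖p n - y n‖ := by linarith [hlen n]
      simp [norm_smul, this.ne'])
  have hv1 : ‖v‖ = 1 := by simpa using hv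
  have hyt' : Tendsto (fun n => y (φ n)) atTop (𝓝 X) := hyt.comp hφ.tendsto_atTop
  set u : ℕ → Space 2 := fun n => ‖p (φ n) - y (φ n)‖⁻¹ • (p (φ n) - y (φ n)) with hu
  have hut : Tendsto u atTop (𝓝 v) := hlim
  have hpu : ∀ n, p (φ n) = y (φ n) + ‖p (φ n) - y (φ n)‖ • u n := by
    intro n
    have : 0 < ‖p (φ n) - y (φ n)‖ := by linarith [hlen (φ n)]
    simp only [hu, smul_smul, mul_inv_cancel₀ this.ne', one_smul]
    abel
  have hvne : v ≠ 0 := by rintro rfl; simp at hv1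
  refine ⟨v, hX, hv1, ?_, ?_⟩
  · rw [disjoint_left]
    rintro c hc ⟨k, hk, hck⟩
    set a := cross v (k - X) with ha
    have ha0 : a ≠ 0 := fun h =>
      notMem_chord_of_notMem_star hXV hk (mem_chord_of_cross hvne hc hck h)
    obtain ⟨t, rfl, ht⟩ := hc
    -- If a point of the chord saw `k ∈ K`, the direction would be tilted slightly towards the side
    -- of `k`. The points `y n + (r / 2) • u n`, near `X + (r / 2) • v`, then lie on the side
    -- opposite to `k`; yet they are joined to `k` through `p n` and `K` without touching the tilted
    -- chord.
    let w : ℝ → Space 2 := fun δ => v + (δ * a) • rot v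
    have hw : Tendsto w (𝓝[>] 0) (𝓝 v) := by
      have : Continuous w := by fun_prop
      have h := this.tendsto 0
      simp only [w, zero_mul, zero_smul, add_zero] at h
      exact h.mono_left nhdsWithin_le_nhds
    have hwt : Tendsto (fun δ => X + t • w δ) (𝓝[>] 0) (𝓝 (X + t • v)) :=
      tendsto_const_nhds.add (hw.const_smul t)
    have hcw : Tendsto (fun δ => a * cross (w δ) (k - X)) (𝓝[>] 0) (𝓝 (a * a)) := by
      have : Continuous fun w : Space 2 => a * cross w (k - X) := by fun_prop
      exact (this.tendsto v).comp hw
    obtain ⟨δ, hδ, h1, h2, h3⟩ := (eventually_mem_nhdsWithin.and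
      ((ht.eventually hU.isOpen tendsto_const_nhds hwt).and
      ((hck.eventually hU.isOpen hwt tendsto_const_nhds).and
      (hcw.eventually (lt_mem_nhds (mul_self_pos.2 ha0)))))).exists
    have hδ0 : 0 < δ := hδ
    have hwv : cross (w δ) v = -(δ * a) := by
      simp only [w, cross_add_left, cross_smul_left, cross_self, cross_rot_left, hv1]
      ring
    have hwne : w δ ≠ 0 := by
      intro h
      rw [h] at hwv
      simp only [cross, PiLp.zero_apply, zero_mul, sub_zero] at hwv
      exact mul_ne_zero hδ0.ne' ha0 (by linarith)
    have lim1 : Tendsto (fun n => a * cross (w δ) (y (φ n) + (r / 2) • u n - X)) atTop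
        (𝓝 (a * (r / 2 * -(δ * a)))) := by
      have hc : Continuous fun q : Space 2 × Space 2 =>
          a * cross (w δ) (q.1 + (r / 2) • q.2 - X) := by fun_prop
      have := (hc.tendsto (X, v)).comp (hyt'.prodMk_nhds hut)
      simpa only [add_sub_cancel_left, cross_smul_right, hwv, Function.comp_def] using this
    have lim2 : Tendsto (fun n => a * cross (w δ) (u n)) atTop (𝓝 (a * -(δ * a))) := by
      have hc : Continuous fun q : Space 2 => a * cross (w δ) q := by fun_prop
      have := (hc.tendsto v).comp hut
      simpa only [hwv, Function.comp_def] using this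
    have haa := mul_self_pos.2 ha0
    obtain ⟨n, hn1, hn2⟩ := ((lim1.eventually (gt_mem_nhds (show a * (r / 2 * -(δ * a)) < 0 by
        have : 0 < r / 2 * δ * (a * a) := by positivity
        linarith))).and (lim2.eventually (gt_mem_nhds (show a * -(δ * a) < 0 by
        have : 0 < δ * (a * a) := by positivity
        linarith)))).exists
    have hq : y (φ n) + (r / 2) • u n ∈ Metric.ball X r := by
      have hu1 : ‖u n‖ = 1 := by
        have : 0 < ‖p (φ n) - y (φ n)‖ := by linarith [hlen (φ n)]
        simp [hu, norm_smul, this.ne']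
      have h3 := (hyd (φ n)).trans_le (min_le_left _ _)
      rw [Metric.mem_ball, dist_eq_norm]
      calc ‖y (φ n) + (r / 2) • u n - X‖ = ‖(y (φ n) - X) + (r / 2) • u n‖ := by congr 1; abel
        _ ≤ ‖y (φ n) - X‖ + ‖(r / 2) • u n‖ := norm_add_le _ _
        _ < r := by
          rw [norm_smul, hu1, Real.norm_of_nonneg (by positivity), ← dist_eq_norm, dist_comm]
          linarith
    have hJ : JoinedIn (U \ chord U X (w δ)) k (y (φ n) + (r / 2) • u n) := by
      have j1 : JoinedIn (U \ chord U X (w δ)) k (p (φ n)) := (hK hk (hp _)).mono fun q hq =>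
        ⟨hKU hq, notMem_chord_of_notMem_star hXV hq⟩
      refine j1.trans (Sees.joinedIn ?_)
      have hs : Sees U (y (φ n) + ‖p (φ n) - y (φ n)‖ • u n) (y (φ n) + (0 : ℝ) • u n) := by
        rw [← hpu, zero_smul, add_zero]; exact (hyp _).symm
      nth_rewrite 1 [hpu n]
      rw [sees_line_iff] at hs ⊢
      intro s hs'
      rw [uIcc_of_ge (hlen _).le] at hs'
      refine ⟨hs s (mem_uIcc.2 (Or.inr ⟨by linarith [hs'.1], hs'.2⟩)), fun hmem => ?_⟩
      have h0 := cross_of_mem_chord hmem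
      have e : y (φ n) + s • u n - X = (y (φ n) + (r / 2) • u n - X) + (s - r / 2) • u n := by
        module
      rw [e, cross_add_right, cross_smul_right] at h0
      have : a * (cross (w δ) (y (φ n) + (r / 2) • u n - X) +
          (s - r / 2) * cross (w δ) (u n)) = 0 := by rw [h0, mul_zero]
      nlinarith [mul_nonneg (sub_nonneg.2 hs'.1) (neg_nonneg.2 hn2.le)]
    have := hU.sep_mul hX hwne ⟨t, rfl, h1⟩ (mem_chord_self _ hX) h2 (hseg hq) hJ
    have h5 := mul_pos h3 (neg_pos.2 hn1)
    have h6 := mul_nonneg haa.le this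
    nlinarith
  · rintro c ⟨t, rfl, ht⟩
    have hct : Tendsto (fun n => y (φ n) + t • u n) atTop (𝓝 (X + t • v)) :=
      hyt'.add (hut.const_smul t)
    refine mem_closure_of_tendsto hct ?_
    filter_upwards [ht.eventually hU.isOpen hyt' hct] with n hn
    refine ⟨p (φ n), hp _, ?_⟩
    rw [hpu n]
    have h1 : Sees U (y (φ n) + t • u n) (y (φ n) + (0 : ℝ) • u n) := by simpa using hn.symm
    refine h1.line_trans ?_
    rw [← hpu]
    simpa using hyp (φ n)

/-- A segment that crosses a window of `V` meets `V`. -/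
theorem IsWindow.exists_mem_of_cross {U V : Set (Space 2)} {X v : Space 2} (h : IsWindow U V X v)
    (hU : IsOpen U) (hUV : RelConvex U V) {c P Q : Space 2} (hc : c ∈ chord U X v)
    (hcPQ : c ∈ segment ℝ P Q) (hPQ : cross v (P - X) * cross v (Q - X) < 0) :
    ∃ w ∈ segment ℝ P Q, w ∈ V := by
  have hcU : c ∈ U := chord_subset U X v hc
  have hc1 : Tendsto (fun ε : ℝ => c + ε • v) (𝓝[>] 0) (𝓝 c) := by
    have : Continuous fun ε : ℝ => c + ε • v := by fun_prop
    have h := this.tendsto 0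
    simp only [zero_smul, add_zero] at h
    exact h.mono_left nhdsWithin_le_nhds
  have hc2 : Tendsto (fun ε : ℝ => c + (-ε) • v) (𝓝[>] 0) (𝓝 c) := by
    have : Continuous fun ε : ℝ => c + (-ε) • v := by fun_prop
    have h := this.tendsto 0
    simp only [neg_zero, zero_smul, add_zero] at h
    exact h.mono_left nhdsWithin_le_nhds
  -- Two points of the chord on either side of `c` are approximated by points `a`, `b` of `V` that
  -- still see each other. Strict crossing is an open condition, so `ab` still meets `PQ`, and
  -- relative convexity puts `ab` in `V`.
  obtain ⟨ε, hε, s1, s2⟩ := (eventually_mem_nhdsWithin.and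
    (((Sees.refl hcU).eventually hU tendsto_const_nhds hc1).and
    ((Sees.refl hcU).eventually hU tendsto_const_nhds hc2))).exists
  have hε0 : 0 < ε := hε
  have m1 : c + ε • v ∈ chord U X v := by
    rw [← chord_eq_of_mem hc]; exact ⟨_, rfl, s1⟩
  have m2 : c + (-ε) • v ∈ chord U X v := by
    rw [← chord_eq_of_mem hc]; exact ⟨_, rfl, s2⟩
  have hsee := sees_of_mem_chord m1 m2
  set A := c + ε • v with hA
  set B := c + (-ε) • v with hB
  have hcl : cross (Q - P) (c - P) = 0 := by
    rw [segment_eq_image'] at hcPQ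
    obtain ⟨s, -, rfl⟩ := hcPQ
    simp [cross_smul_right, cross_self]
  have hvd : cross v (Q - P) = cross v (Q - X) - cross v (P - X) := by
    rw [← cross_sub_right]; congr 1; abel
  have hvd0 : cross v (Q - P) ≠ 0 := by
    intro h0
    rw [h0] at hvd
    have : cross v (Q - X) = cross v (P - X) := by linarith
    rw [this] at hPQ
    nlinarith [mul_self_nonneg (cross v (P - X))]
  have k1 : cross (Q - P) (A - P) * cross (Q - P) (B - P) < 0 := by
    have eA : A - P = (c - P) + ε • v := by rw [hA]; abel
    have eB : B - P = (c - P) + (-ε) • v := by rw [hB]; abel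
    rw [eA, eB, cross_add_right, cross_add_right, hcl, cross_smul_right, cross_smul_right,
      cross_swap (Q - P) v]
    have : 0 < ε * ε * (cross v (Q - P) * cross v (Q - P)) :=
      mul_pos (by positivity) (mul_self_pos.2 hvd0)
    nlinarith
  have k2 : cross (B - A) (P - A) * cross (B - A) (Q - A) < 0 := by
    have e : B - A = (-(2 * ε)) • v := by rw [hA, hB]; module
    have hP : cross v (P - A) = cross v (P - X) := by
      have : P - A = (P - X) - (A - X) := by abel
      rw [this, cross_sub_right, cross_of_mem_chord m1, sub_zero]
    have hQ : cross v (Q - A) = cross v (Q - X) := by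
      have : Q - A = (Q - X) - (A - X) := by abel
      rw [this, cross_sub_right, cross_of_mem_chord m1, sub_zero]
    rw [e, cross_smul_left, cross_smul_left, hP, hQ]
    have : 0 < 4 * ε * ε := by positivity
    nlinarith
  have nA := mem_closure_iff_nhdsWithin_neBot.1 (h.subset_closure m1)
  have nB := mem_closure_iff_nhdsWithin_neBot.1 (h.subset_closure m2)
  have t1 : Tendsto Prod.fst (𝓝[V] A ×ˢ 𝓝[V] B) (𝓝 A) :=
    tendsto_fst.mono_right nhdsWithin_le_nhds
  have t2 : Tendsto Prod.snd (𝓝[V] A ×ˢ 𝓝[V] B) (𝓝 B) :=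
    tendsto_snd.mono_right nhdsWithin_le_nhds
  have c1 : Continuous fun q : Space 2 × Space 2 =>
    cross (Q - P) (q.1 - P) * cross (Q - P) (q.2 - P) := by fun_prop
  have c2 : Continuous fun q : Space 2 × Space 2 =>
    cross (q.2 - q.1) (P - q.1) * cross (q.2 - q.1) (Q - q.1) := by fun_prop
  obtain ⟨⟨a, b⟩, ha, hb, hab, i1, i2⟩ :=
    ((tendsto_fst.eventually (eventually_mem_nhdsWithin (a := A) (s := V))).and
    ((tendsto_snd.eventually (eventually_mem_nhdsWithin (a := B) (s := V))).and
    ((hsee.eventually hU t1 t2).and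
    ((((c1.tendsto (A, B)).comp (t1.prodMk_nhds t2)).eventually (gt_mem_nhds k1)).and
    (((c2.tendsto (A, B)).comp (t1.prodMk_nhds t2)).eventually (gt_mem_nhds k2)))))).exists
  obtain ⟨w, hw1, hw2⟩ := segment_inter_of_cross i1 i2
  exact ⟨w, hw1, hUV ha hb hab hw2⟩

/-! ### Areas -/

/-- The linear map with columns `u` and `w`. -/
def columnMap (u w : Space 2) : Space 2 →ₗ[ℝ] Space 2 where
  toFun x := x 0 • u + x 1 • w
  map_add' x y := by simp only [PiLp.add_apply]; module
  map_smul' a x := by simp only [PiLp.smul_apply, smul_eq_mul, RingHom.id_apply]; module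

theorem columnMap_apply (u w x : Space 2) : columnMap u w x = x 0 • u + x 1 • w := rfl

theorem det_columnMap (u w : Space 2) : LinearMap.det (columnMap u w) = cross u w := by
  let b := (EuclideanSpace.basisFun (Fin 2) ℝ).toBasis
  rw [← LinearMap.det_toMatrix b, Matrix.det_fin_two]
  simp [LinearMap.toMatrix_apply, b, columnMap, cross]
  ring

theorem volume_rectangle (a₀ b₀ a₁ b₁ : ℝ) :
    volume {x : Space 2 | x 0 ∈ Icc a₀ b₀ ∧ x 1 ∈ Icc a₁ b₁} =
      ENNReal.ofReal (b₀ - a₀) * ENNReal.ofReal (b₁ - a₁) := by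
  have h := PiLp.volume_preserving_ofLp (ι := Fin 2)
  have e : {x : Space 2 | x 0 ∈ Icc a₀ b₀ ∧ x 1 ∈ Icc a₁ b₁} =
      (@WithLp.ofLp 2 (Fin 2 → ℝ)) ⁻¹' (Icc ![a₀, a₁] ![b₀, b₁]) := by
    ext x
    simp [Pi.le_def, Fin.forall_fin_two]
    tauto
  rw [e, h.measure_preimage measurableSet_Icc.nullMeasurableSet, Real.volume_Icc_pi]
  simp [Fin.prod_univ_two]

theorem volume_parallelogram (a u w : Space 2) (x₀ x₁ y₀ y₁ : ℝ) :
    volume {z | ∃ x ∈ Icc x₀ x₁, ∃ y ∈ Icc y₀ y₁, z = a + (x • u + y • w)} =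
      ENNReal.ofReal |cross u w| * (ENNReal.ofReal (x₁ - x₀) * ENNReal.ofReal (y₁ - y₀)) := by
  rw [← volume_rectangle, ← det_columnMap, ← Measure.addHaar_image_linearMap,
    ← measure_preimage_add volume a]
  congr 1
  ext z
  constructor
  · rintro ⟨x, hx, y, hy, h⟩
    refine ⟨!₂[x, y], by simpa using ⟨hx, hy⟩, ?_⟩
    rw [columnMap_apply, add_left_cancel h]
    simp
  · rintro ⟨p, hp, e⟩
    refine ⟨p 0, hp.1, p 1, hp.2, ?_⟩
    rw [← columnMap_apply, e]

/-- The triangle and its point reflection cover the parallelogram. -/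
theorem volume_triangle_ge (a u w : Space 2) :
    ENNReal.ofReal (|cross u w| / 2) ≤
      volume {z | ∃ x y : ℝ, 0 ≤ x ∧ 0 ≤ y ∧ x + y ≤ 1 ∧ z = a + (x • u + y • w)} := by
  set T : Set (Space 2) := {z | ∃ x y : ℝ, 0 ≤ x ∧ 0 ≤ y ∧ x + y ≤ 1 ∧ z = a + (x • u + y • w)}
  set Q : Set (Space 2) :=
    {z | ∃ x ∈ Icc (0 : ℝ) 1, ∃ y ∈ Icc (0 : ℝ) 1, z = a + (x • u + y • w)} with hQ
  have hsub : Q ⊆ T ∪ (fun z => ((2 : ℝ) • a + u + w) - z) ⁻¹' T := by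
    rintro z ⟨x, hx, y, hy, rfl⟩
    by_cases h : x + y ≤ 1
    · exact Or.inl ⟨x, y, hx.1, hy.1, h, rfl⟩
    · refine Or.inr ⟨1 - x, 1 - y, by linarith [hx.2], by linarith [hy.2], by linarith, ?_⟩
      module
  have hv : volume Q = ENNReal.ofReal |cross u w| := by
    rw [hQ, volume_parallelogram]; simp
  have h1 : ENNReal.ofReal |cross u w| ≤ 2 * volume T := by
    calc ENNReal.ofReal |cross u w| = volume Q := hv.symm
      _ ≤ _ := measure_mono hsub
      _ ≤ _ := measure_union_le _ _
      _ = 2 * volume T := by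
        have : volume ((fun z => ((2 : ℝ) • a + u + w) - z) ⁻¹' T) = volume T :=
          MeasurePreserving.measure_preimage_equiv
            (f := MeasurableEquiv.subLeft ((2 : ℝ) • a + u + w)) (Measure.measurePreserving_sub_left volume _) T
        rw [this, two_mul]
  rw [ENNReal.ofReal_div_of_pos two_pos]
  apply ENNReal.div_le_of_le_mul
  rw [mul_comm]
  simpa using h1

/-- All convex subsets of `U` have area at most `c`. -/
def ConvexAreaLE (U : Set (Space 2)) (c : ℝ) : Prop :=
  ∀ K ⊆ U, Convex ℝ K → volume K ≤ ENNReal.ofReal c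

theorem IsHolefree.triangle_mem {U : Set (Space 2)} (hU : IsHolefree U) {A B C : Space 2}
    (hAB : Sees U A B) (hBC : Sees U B C) (hCA : Sees U C A) {x y : ℝ} (hx : 0 ≤ x) (hy : 0 ≤ y)
    (hxy : x + y ≤ 1) : A + (x • (B - A) + y • (C - A)) ∈ U := by
  have := hU.hasLoopLog.convexCombo_mem hAB hBC hCA (α := 1 - x - y) (by linarith) hx hy (by ring)
  convert this using 1
  module

theorem IsHolefree.cross_le {U : Set (Space 2)} (hU : IsHolefree U) {c : ℝ} (hc0 : 0 ≤ c)
    (hc : ConvexAreaLE U c) {A B C : Space 2}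
    (hAB : Sees U A B) (hBC : Sees U B C) (hCA : Sees U C A) :
    |cross (B - A) (C - A)| ≤ 2 * c := by
  have h := (volume_triangle_ge A (B - A) (C - A)).trans (hc _ ?_ ?_)
  · rw [ENNReal.ofReal_le_ofReal_iff hc0] at h
    linarith
  · rintro z ⟨x, y, hx, hy, hxy, rfl⟩
    exact hU.triangle_mem hAB hBC hCA hx hy hxy
  · rintro z ⟨x, y, hx, hy, hxy, rfl⟩ z' ⟨x', y', hx', hy', hxy', rfl⟩ s t hs ht hst
    refine ⟨s * x + t * x', s * y + t * y', by positivity, by positivity, by nlinarith, ?_⟩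
    obtain rfl : t = 1 - s := by linarith
    module

/-! ### Points behind a window -/

/-- `A` sees a point of `V` through the window `(X, v)`. -/
def Behind (U V : Set (Space 2)) (X v A : Space 2) : Prop :=
  ∃ y ∈ V, Sees U A y ∧ (segment ℝ A y ∩ chord U X v).Nonempty

/-- The infimum of the parameters at which the segment is in the open set `V`. -/
theorem exists_first_entry {U V : Set (Space 2)} (hV : IsOpen V) {A y : Space 2} (hA : A ∉ V)
    (hy : y ∈ V) (h : Sees U A y) :
    ∃ X ∈ segment ℝ A y, X ∈ U ∧ X ∉ V ∧ X ∈ closure V := by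
  let f : ℝ → Space 2 := fun s => A + s • (y - A)
  have hf : Continuous f := by fun_prop
  let T : Set ℝ := {s | s ∈ Icc (0 : ℝ) 1 ∧ f s ∈ V}
  have h1 : (1 : ℝ) ∈ T := ⟨by simp, by simpa [f] using hy⟩
  have hbd : BddBelow T := ⟨0, fun s hs => hs.1.1⟩
  have hcl : sInf T ∈ closure T := csInf_mem_closure ⟨1, h1⟩ hbd
  have h0 : 0 ≤ sInf T := le_csInf ⟨1, h1⟩ fun s hs => hs.1.1
  have hle : sInf T ≤ 1 := csInf_le hbd h1
  have hseg : f (sInf T) ∈ segment ℝ A y := by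
    rw [segment_eq_image']; exact ⟨_, ⟨h0, hle⟩, rfl⟩
  refine ⟨f (sInf T), hseg, h hseg, fun hmem => ?_, ?_⟩
  · have hpos : 0 < sInf T := by
      refine lt_of_le_of_ne h0 (fun h => hA ?_)
      rw [← h] at hmem
      simpa [f] using hmem
    have ev : ∀ᶠ s in 𝓝[<] sInf T, f s ∈ V :=
      (hf.continuousAt.eventually (hV.mem_nhds hmem)).filter_mono nhdsWithin_le_nhds
    have ev2 : ∀ᶠ s in 𝓝[<] sInf T, s ∈ Ioo 0 (sInf T) := Ioo_mem_nhdsLT hpos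
    obtain ⟨s, hs1, hs2⟩ := (ev.and ev2).exists
    exact absurd (csInf_le hbd (show s ∈ T from ⟨⟨hs2.1.le, by linarith [hs2.2]⟩, hs1⟩))
      (not_le.2 hs2.2)
  · exact map_mem_closure hf hcl fun s hs => hs.2

theorem mul_neg_of_mem_chord {U : Set (Space 2)} {X v c P Q : Space 2} (hc : c ∈ chord U X v)
    (hPQ : c ∈ segment ℝ P Q) (hP : cross v (P - X) ≠ 0) (hQ : cross v (Q - X) ≠ 0) :
    cross v (P - X) * cross v (Q - X) < 0 := by
  have h0 := cross_of_mem_chord hc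
  rw [segment_eq_image'] at hPQ
  obtain ⟨s, ⟨hs0, hs1⟩, rfl⟩ := hPQ
  have e : P + s • (Q - P) - X = (1 - s) • (P - X) + s • (Q - X) := by module
  rw [e, cross_add_right, cross_smul_right, cross_smul_right] at h0
  have hs0' : 0 < s := lt_of_le_of_ne hs0 (by
    rintro rfl; apply hP; linarith)
  set a := cross v (P - X)
  set b := cross v (Q - X)
  by_contra hab
  have hpos : 0 < a * b := lt_of_le_of_ne (not_lt.1 hab) (mul_ne_zero hP hQ).symm
  have : (1 - s) * (a * a) + s * (a * b) = 0 := by linear_combination a * h0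
  nlinarith [mul_nonneg (sub_nonneg.2 hs1) (mul_self_nonneg a), mul_pos hs0' hpos]

theorem cross_ne_zero_of_notMem {U : Set (Space 2)} {X v c P : Space 2} (hv : v ≠ 0)
    (hc : c ∈ chord U X v) (h : Sees U c P) (hP : P ∉ chord U X v) : cross v (P - X) ≠ 0 :=
  fun h0 => hP (mem_chord_of_cross hv hc h h0)

/-- Otherwise the path from `A` through `B` and `y`, continued inside `V`, would avoid the window
and lead to `y₀`, which lies on the other side from `A`. -/
theorem Behind.inter_nonempty {U V : Set (Space 2)} (hU : IsHolefree U) (hVU : V ⊆ U)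
    (hV : PathJoined V) {X v A : Space 2} (hw : IsWindow U V X v) (hA : Behind U V X v A)
    {B y : Space 2} (hAB : Sees U A B) (hd : Disjoint (segment ℝ A B) (chord U X v)) (hy : y ∈ V)
    (h : Sees U B y) : (segment ℝ B y ∩ chord U X v).Nonempty := by
  by_contra hcon
  rw [not_nonempty_iff_eq_empty, ← disjoint_iff_inter_eq_empty] at hcon
  obtain ⟨y₀, hy₀, hAy₀, c, hc, hcw⟩ := hA
  have hAw : A ∉ chord U X v := disjoint_left.1 hd (left_mem_segment ℝ A B)
  have s1 : Sees U c A := hAy₀.sub hc (left_mem_segment ℝ A y₀)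
  have s2 : Sees U c y₀ := hAy₀.sub hc (right_mem_segment ℝ A y₀)
  have a0 := cross_ne_zero_of_notMem hw.ne_zero hcw s1 hAw
  have b0 := cross_ne_zero_of_notMem hw.ne_zero hcw s2
    (fun h => disjoint_left.1 hw.disj h hy₀)
  have hlt := mul_neg_of_mem_chord hcw hc a0 b0
  have j1 : JoinedIn (U \ chord U X v) y₀ y := (hV hy₀ hy).mono fun z hz =>
    ⟨hVU hz, fun h => disjoint_left.1 hw.disj h hz⟩
  have j2 : JoinedIn (U \ chord U X v) B y := (joinedIn_segment B y).mono fun z hz =>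
    ⟨h hz, disjoint_left.1 hcon hz⟩
  have j3 : JoinedIn (U \ chord U X v) A B := (joinedIn_segment A B).mono fun z hz =>
    ⟨hAB hz, disjoint_left.1 hd hz⟩
  have := hU.sep_mul hw.mem hw.ne_zero hcw hcw s1 s2 ((j3.trans j2).trans j1.symm)
  linarith

theorem Behind.inter_nonempty_self {U V : Set (Space 2)} (hU : IsHolefree U) (hVU : V ⊆ U)
    (hV : PathJoined V) {X v A : Space 2} (hw : IsWindow U V X v) (hA : Behind U V X v A)
    {y : Space 2} (hy : y ∈ V) (h : Sees U A y) : (segment ℝ A y ∩ chord U X v).Nonempty := by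
  by_cases hAw : A ∈ chord U X v
  · exact ⟨A, left_mem_segment ℝ A y, hAw⟩
  · refine hA.inter_nonempty hU hVU hV hw (Sees.refl h.left) ?_ hy h
    rw [segment_same]
    simpa using hAw

theorem IsHolefree.exists_window_behind {U K : Set (Space 2)} (hU : IsHolefree U)
    (hK : PathJoined K) (hKU : K ⊆ U) {A : Space 2} (hA : A ∈ star U (star U K))
    (hAV : A ∉ star U K) :
    ∃ X v, IsWindow U (star U K) X v ∧ Behind U (star U K) X v A := by
  obtain ⟨y, hy, hAy⟩ := hA
  obtain ⟨X, hX, hXU, hXV, hXc⟩ := exists_first_entry (isOpen_star hU.isOpen K) hAV hy hAy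
  obtain ⟨v, hw⟩ := hU.exists_isWindow hK hKU hXU hXV hXc
  exact ⟨X, v, hw, y, hy, hAy, X, hX, mem_chord_self v hXU⟩

/-! ### Segments that enter `V` late -/

/-- The triangle spanned by `A` and two visible points of the chord lies in `U`, so `A` also sees
every point of the chord between them. -/
theorem convex_cone_chord {U : Set (Space 2)} (hU : IsHolefree U) (X v A : Space 2) :
    Convex ℝ {w | ∃ p ∈ chord U X v, Sees U A p ∧ ∃ τ ∈ Icc (0 : ℝ) 1, w = A + τ • (p - A)} := by
  rintro w ⟨p, hp, hAp, τ, hτ, rfl⟩ w' ⟨p', hp', hAp', τ', hτ', rfl⟩ s t hs ht hst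
  have hm0 : 0 ≤ s * τ + t * τ' := add_nonneg (mul_nonneg hs hτ.1) (mul_nonneg ht hτ'.1)
  have hm1 : s * τ + t * τ' ≤ 1 := by nlinarith [hτ.2, hτ'.2]
  have e : s • (A + τ • (p - A)) + t • (A + τ' • (p' - A)) =
      A + ((s * τ) • (p - A) + (t * τ') • (p' - A)) := by
    obtain rfl : t = 1 - s := by linarith
    module
  rcases hm0.lt_or_eq with hm | hm
  · set m := s * τ + t * τ' with hmdef
    have hmem : (s * τ / m) • p + (t * τ' / m) • p' ∈ segment ℝ p p' :=
      ⟨_, _, div_nonneg (mul_nonneg hs hτ.1) hm.le, div_nonneg (mul_nonneg ht hτ'.1) hm.le,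
        by rw [← add_div, div_self hm.ne'], rfl⟩
    refine ⟨_, segment_subset_chord hp hp' hmem, ?_, m, ⟨hm0, hm1⟩, ?_⟩
    · rw [sees_iff]
      intro r hr
      have := hU.triangle_mem hAp (sees_of_mem_chord hp hp') hAp'.symm
        (x := r * (s * τ / m)) (y := r * (t * τ' / m))
        (mul_nonneg hr.1 (div_nonneg (mul_nonneg hs hτ.1) hm.le))
        (mul_nonneg hr.1 (div_nonneg (mul_nonneg ht hτ'.1) hm.le))
        (by rw [← mul_add, ← add_div, div_self hm.ne', mul_one]; exact hr.2)
      convert this using 1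
      have h1 : s * τ / m + t * τ' / m = 1 := by rw [← add_div, div_self hm.ne']
      have h2 : A = (s * τ / m + t * τ' / m) • A := by rw [h1, one_smul]
      nth_rewrite 2 [h2]
      module
    · rw [e]
      have h2 : m • ((s * τ / m) • p + (t * τ' / m) • p' - A) =
          (m * (s * τ / m)) • p + (m * (t * τ' / m)) • p' - m • A := by module
      rw [h2, mul_div_cancel₀ _ hm.ne', mul_div_cancel₀ _ hm.ne', hmdef]
      module
  · have h1 : s * τ = 0 := by nlinarith [mul_nonneg hs hτ.1, mul_nonneg ht hτ'.1]
    have h2 : t * τ' = 0 := by linarith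
    refine ⟨p, hp, hAp, 0, by simp, ?_⟩
    rw [e, h1, h2]
    simp

/-- The points `B` seen from `A` such that the segment from `A` to `B` meets `V`, but not in its
first quarter. -/
def lateSlice (U V : Set (Space 2)) (A : Space 2) : Set (Space 2) :=
  {B | Sees U A B ∧ (∀ s ∈ Icc (0 : ℝ) (1 / 4), A + s • (B - A) ∉ V) ∧ ∃ y ∈ segment ℝ A B, y ∈ V}

/-- All segments from `A` to `V` pass through one window. If the window is met at parameter at least
`1 / 4` of `AB`, then `B` lies in the image of the convex cone over the window under the homothety
of ratio `4`, whose area is at most `4 ^ 2 * c`. -/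
theorem IsHolefree.volume_lateSlice_le {U K : Set (Space 2)} (hU : IsHolefree U)
    (hK : PathJoined K) (hKU : K ⊆ U) {c : ℝ} (hc : ConvexAreaLE U c) (A : Space 2) :
    volume (lateSlice U (star U K) A) ≤ ENNReal.ofReal (16 * c) := by
  set V := star U K with hVdef
  have hVU : V ⊆ U := star_subset U K
  have hV : PathJoined V := hK.star hKU
  have hVo : IsOpen V := isOpen_star hU.isOpen K
  have hVr : RelConvex U V := hU.relConvex_star hK hKU
  rcases (lateSlice U V A).eq_empty_or_nonempty with h | ⟨B₀, hB₀, hB₀q, y₀, hy₀, hy₀V⟩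
  · rw [h]; simp
  have hAV : A ∉ V := by simpa using hB₀q 0 (by norm_num)
  have hAs : A ∈ star U V := ⟨y₀, hy₀V, hB₀.sub (left_mem_segment ℝ A B₀) hy₀⟩
  obtain ⟨X, v, hw, hA⟩ := hU.exists_window_behind hK hKU hAs hAV
  set T : Set (Space 2) :=
    {w | ∃ p ∈ chord U X v, Sees U A p ∧ ∃ τ ∈ Icc (0 : ℝ) 1, w = A + τ • (p - A)} with hT
  have hTU : T ⊆ U := by
    rintro w ⟨p, -, hAp, τ, hτ, rfl⟩
    exact sees_iff.1 hAp τ hτ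
  have hsub : lateSlice U V A ⊆ AffineMap.homothety A (4 : ℝ) '' T := by
    rintro B ⟨hAB, hq, y, hy, hyV⟩
    have hAy : Sees U A y := hAB.sub (left_mem_segment ℝ A B) hy
    obtain ⟨p, hpy, hpw⟩ := hA.inter_nonempty_self hU hVU hV hw hyV hAy
    have hpV : p ∉ V := fun h => disjoint_left.1 hw.disj hpw h
    have hpy' : Sees U p y := hAy.sub hpy (right_mem_segment ℝ A y)
    have hAp : Sees U A p := hAy.sub (left_mem_segment ℝ A y) hpy
    rw [segment_eq_image'] at hy hpy
    obtain ⟨s, hs, rfl⟩ := hy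
    obtain ⟨r, hr, rfl⟩ := hpy
    simp only [add_sub_cancel_left, smul_smul] at *
    have hrs0 : 0 ≤ r * s := mul_nonneg hr.1 hs.1
    -- Beyond a window point, which is in the closure of `V`, the segment towards `y` is in `V`. An
    -- earlier window point would therefore put parameter `1 / 4` in `V`.
    have hrs : 1 / 4 ≤ r * s := by
      by_contra hlt
      rw [not_le] at hlt
      have hs4 : 1 / 4 < s := by
        by_contra h
        exact hq s ⟨hs.1, not_lt.1 h⟩ hyV
      refine hq (1 / 4) (by norm_num) (hVr.mem_of_mem_openSegment hU.isOpen hVo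
        (hw.subset_closure hpw) hyV hpy' ⟨(s - 1 / 4) / (s - r * s), (1 / 4 - r * s) / (s - r * s),
        div_pos (by linarith) (by linarith), div_pos (by linarith) (by linarith), ?_, ?_⟩)
      · rw [← add_div, div_eq_one_iff_eq (by linarith)]; ring
      · have hne : s - r * s ≠ 0 := by linarith
        have e1 : (s - 1 / 4) / (s - r * s) + (1 / 4 - r * s) / (s - r * s) = 1 := by
          rw [← add_div, div_eq_one_iff_eq hne]; ring
        have e2 : (s - 1 / 4) / (s - r * s) * (r * s) + (1 / 4 - r * s) / (s - r * s) * s = 1 / 4 := by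
          rw [div_mul_eq_mul_div, div_mul_eq_mul_div, ← add_div, div_eq_iff hne]; ring
        calc _ = ((s - 1 / 4) / (s - r * s) + (1 / 4 - r * s) / (s - r * s)) • A +
              ((s - 1 / 4) / (s - r * s) * (r * s) + (1 / 4 - r * s) / (s - r * s) * s) • (B - A) := by
              module
          _ = _ := by rw [e1, e2, one_smul]
    have hpos : 0 < r * s := by linarith
    refine ⟨A + (1 / (4 * (r * s))) • (A + (r * s) • (B - A) - A),
      ⟨_, hpw, hAp, _, ⟨by positivity, ?_⟩, rfl⟩, ?_⟩
    · rw [div_le_one (by positivity)]; linarith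
    · rw [AffineMap.homothety_apply]
      simp only [vsub_eq_sub, vadd_eq_add, add_sub_cancel_left, smul_smul]
      have : 4 * (1 / (4 * (r * s)) * (r * s)) = 1 := by
        field_simp
        exact div_self hpos.ne'
      rw [this, one_smul]; abel
  calc volume (lateSlice U V A) ≤ volume (AffineMap.homothety A (4 : ℝ) '' T) := measure_mono hsub
    _ = ENNReal.ofReal 16 * volume T := by
      rw [Measure.addHaar_image_homothety, finrank_euclideanSpace_fin]; norm_num
    _ ≤ ENNReal.ofReal 16 * ENNReal.ofReal c := by
      gcongr; exact hc T hTU (convex_cone_chord hU X v A)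
    _ = ENNReal.ofReal (16 * c) := (ENNReal.ofReal_mul (by norm_num)).symm

/-! ### Pairs on the same level -/

/-- Pairs of points that see `V` and each other, but not through `V`. -/
def levelPairs (U V : Set (Space 2)) : Set (Space 2 × Space 2) :=
  {q | q.1 ∈ star U V \ closure V ∧ q.2 ∈ star U V \ closure V ∧ Sees U q.1 q.2 ∧
    ∀ w ∈ segment ℝ q.1 q.2, w ∉ V}

theorem levelPairs_swap {U V : Set (Space 2)} {A B : Space 2} (h : (A, B) ∈ levelPairs U V) :
    (B, A) ∈ levelPairs U V := by
  obtain ⟨h1, h2, h3, h4⟩ := h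
  refine ⟨h2, h1, h3.symm, ?_⟩
  simpa only [segment_symm] using h4

theorem sees_of_mem_inter {U : Set (Space 2)} {A y p : Space 2} (h : Sees U A y)
    (hp : p ∈ segment ℝ A y) : Sees U A p := h.sub (left_mem_segment ℝ A y) hp

section
variable {U K : Set (Space 2)}

/-- The ends are outside `closure V`, hence off the window; a segment meeting the window would cross
it strictly and so meet `V`. -/
theorem IsHolefree.disjoint_segment_of_levelPairs (hU : IsHolefree U) (hK : PathJoined K)
    (hKU : K ⊆ U) {X v A B : Space 2} (hw : IsWindow U (star U K) X v)
    (hAB : (A, B) ∈ levelPairs U (star U K)) : Disjoint (segment ℝ A B) (chord U X v) := by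
  obtain ⟨hA, hB, hs, hd⟩ := hAB
  rw [disjoint_left]
  intro p hp hpw
  have hA0 := cross_ne_zero_of_notMem hw.ne_zero hpw (hs.sub hp (left_mem_segment ℝ A B))
    (fun h => hA.2 (hw.subset_closure h))
  have hB0 := cross_ne_zero_of_notMem hw.ne_zero hpw (hs.sub hp (right_mem_segment ℝ A B))
    (fun h => hB.2 (hw.subset_closure h))
  obtain ⟨w, hw1, hw2⟩ := hw.exists_mem_of_cross hU.isOpen (hU.relConvex_star hK hKU) hpw hp
    (mul_neg_of_mem_chord hpw hp hA0 hB0)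
  exact hd w hw1 hw2

theorem IsHolefree.behind_of_levelPairs (hU : IsHolefree U) (hK : PathJoined K)
    (hKU : K ⊆ U) {X v A B : Space 2} (hw : IsWindow U (star U K) X v)
    (hA : Behind U (star U K) X v A) (hAB : (A, B) ∈ levelPairs U (star U K)) :
    Behind U (star U K) X v B := by
  have hd := hU.disjoint_segment_of_levelPairs hK hKU hw hAB
  obtain ⟨-, ⟨⟨y, hy, hBy⟩, -⟩, hs, -⟩ := hAB
  exact ⟨y, hy, hBy, hA.inter_nonempty hU (star_subset U K) (hK.star hKU) hw hs hd hy hBy⟩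

theorem Behind.exists_mem_chord {V : Set (Space 2)} {X v A : Space 2} (h : Behind U V X v A) :
    ∃ p ∈ chord U X v, Sees U A p := by
  obtain ⟨y, hy, hAy, p, hp, hpw⟩ := h
  exact ⟨p, hpw, sees_of_mem_inter hAy hp⟩

theorem IsHolefree.same_side_of_levelPairs (hU : IsHolefree U) (hK : PathJoined K)
    (hKU : K ⊆ U) {X v A B : Space 2} (hw : IsWindow U (star U K) X v)
    (hA : Behind U (star U K) X v A) (hAB : (A, B) ∈ levelPairs U (star U K)) :
    0 < cross v (A - X) * cross v (B - X) := by
  have hd := hU.disjoint_segment_of_levelPairs hK hKU hw hAB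
  obtain ⟨a, ha, hAa⟩ := hA.exists_mem_chord
  obtain ⟨b, hb, hBb⟩ := (hU.behind_of_levelPairs hK hKU hw hA hAB).exists_mem_chord
  have hA0 := cross_ne_zero_of_notMem hw.ne_zero ha hAa.symm
    (fun h => hAB.1.2 (hw.subset_closure h))
  have hB0 := cross_ne_zero_of_notMem hw.ne_zero hb hBb.symm
    (fun h => hAB.2.1.2 (hw.subset_closure h))
  refine lt_of_le_of_ne ?_ (mul_ne_zero hA0 hB0).symm
  exact hU.sep_mul hw.mem hw.ne_zero ha hb hAa.symm hBb.symm
    ((joinedIn_segment A B).mono fun z hz => ⟨hAB.2.2.1 hz, disjoint_left.1 hd hz⟩)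

/-- Makes the height over the window independent of the choice of window. Both windows meet `[A, y]`
at the same point; if they were not parallel there, one would cross the other and meet `V`. -/
theorem IsHolefree.window_unique (hU : IsHolefree U) (hK : PathJoined K)
    (hKU : K ⊆ U) {X v X' v' A : Space 2} (hw : IsWindow U (star U K) X v)
    (hw' : IsWindow U (star U K) X' v') (hA : Behind U (star U K) X v A)
    (hA' : Behind U (star U K) X' v' A) (z : Space 2) :
    |cross v (z - X)| = |cross v' (z - X')| := by
  have hVo := isOpen_star hU.isOpen K
  have hVr := hU.relConvex_star hK hKU
  obtain ⟨y, hy, hAy, p, hp, hpw⟩ := hA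
  obtain ⟨p', hp', hpw'⟩ := hA'.inter_nonempty_self hU (star_subset U K) (hK.star hKU) hw' hy hAy
  have hpV : p ∉ star U K := fun h => disjoint_left.1 hw.disj hpw h
  have hpV' : p' ∉ star U K := fun h => disjoint_left.1 hw'.disj hpw' h
  -- After a point of the closure the segment is in `V`, so no later point can lie on a window.
  have order : ∀ {s r : ℝ}, s < r → r ∈ Icc (0 : ℝ) 1 → Sees U (A + s • (y - A)) y →
      A + s • (y - A) ∈ closure (star U K) → A + r • (y - A) ∉ star U K → False := by
    intro s r hsr hr hsee hcl hn
    apply hn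
    rcases hr.2.lt_or_eq with h1 | h1
    · refine hVr.mem_of_mem_openSegment hU.isOpen hVo hcl hy hsee
        ⟨(1 - r) / (1 - s), (r - s) / (1 - s), div_pos (by linarith) (by linarith),
          div_pos (by linarith) (by linarith), ?_, ?_⟩
      · rw [← add_div, div_eq_one_iff_eq (by linarith)]; ring
      · have hne : 1 - s ≠ 0 := by linarith
        have e1 : (1 - r) / (1 - s) + (r - s) / (1 - s) = 1 := by
          rw [← add_div, div_eq_one_iff_eq hne]; ring
        have e2 : (1 - r) / (1 - s) * s + (r - s) / (1 - s) = r := by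
          field_simp; ring
        calc _ = ((1 - r) / (1 - s) + (r - s) / (1 - s)) • A +
              ((1 - r) / (1 - s) * s + (r - s) / (1 - s)) • (y - A) := by module
          _ = _ := by rw [e1, e2, one_smul]
    · rw [h1]; simpa using hy
  have hpp : p = p' := by
    have s1 := hAy.sub hp (right_mem_segment ℝ A y)
    have s2 := hAy.sub hp' (right_mem_segment ℝ A y)
    have c1 := hw.subset_closure hpw
    have c2 := hw'.subset_closure hpw'
    rw [segment_eq_image'] at hp hp'
    obtain ⟨s, hs, rfl⟩ := hp
    obtain ⟨r, hr, rfl⟩ := hp'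
    rcases lt_trichotomy s r with h | h | h
    · exact (order h hr s1 c1 hpV').elim
    · rw [h]
    · exact (order h hs s2 c2 hpV).elim
  subst hpp
  have hcr : cross v v' = 0 := by
    by_contra hne
    have hpU : p ∈ U := chord_subset _ _ _ hpw
    have ht : ∀ σ : ℝ, Tendsto (fun ε : ℝ => p + (σ * ε) • v') (𝓝[>] 0) (𝓝 p) := by
      intro σ
      have : Continuous fun ε : ℝ => p + (σ * ε) • v' := by fun_prop
      have h := this.tendsto 0
      simp only [mul_zero, zero_smul, add_zero] at h
      exact h.mono_left nhdsWithin_le_nhds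
    obtain ⟨ε, hε, s1, s2⟩ := (eventually_mem_nhdsWithin.and
      (((Sees.refl hpU).eventually hU.isOpen tendsto_const_nhds (ht 1)).and
      ((Sees.refl hpU).eventually hU.isOpen tendsto_const_nhds (ht (-1))))).exists
    have hε0 : 0 < ε := hε
    have m1 : p + (1 * ε) • v' ∈ chord U X' v' := by
      rw [← chord_eq_of_mem hpw']; exact ⟨_, rfl, s1⟩
    have m2 : p + (-1 * ε) • v' ∈ chord U X' v' := by
      rw [← chord_eq_of_mem hpw']; exact ⟨_, rfl, s2⟩
    have hmid : p ∈ segment ℝ (p + (1 * ε) • v') (p + (-1 * ε) • v') :=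
      ⟨1 / 2, 1 / 2, by norm_num, by norm_num, by norm_num, by module⟩
    have e : ∀ σ : ℝ, cross v (p + (σ * ε) • v' - X) = σ * ε * cross v v' := by
      intro σ
      have : p + (σ * ε) • v' - X = (p - X) + (σ * ε) • v' := by abel
      rw [this, cross_add_right, cross_of_mem_chord hpw, cross_smul_right, zero_add]
    obtain ⟨w, hw1, hw2⟩ := hw.exists_mem_of_cross hU.isOpen hVr hpw hmid (by
      rw [e, e]
      have : 0 < ε * ε * (cross v v' * cross v v') :=
        mul_pos (by positivity) (mul_self_pos.2 hne)
      nlinarith)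
    exact disjoint_left.1 hw'.disj (segment_subset_chord m1 m2 hw1) hw2
  obtain ⟨t, ht⟩ := exists_smul_eq_of_cross_eq_zero hw.ne_zero hcr
  have ht1 : |t| = 1 := by
    have := hw'.norm_eq
    rw [ht, norm_smul, hw.norm_eq, mul_one] at this
    simpa using this
  have e1 : cross v (z - X) = cross v (z - p) := by
    have : z - X = (z - p) + (p - X) := by abel
    rw [this, cross_add_right, cross_of_mem_chord hpw, add_zero]
  have e2 : cross v' (z - X') = cross v' (z - p) := by
    have : z - X' = (z - p) + (p - X') := by abel
    rw [this, cross_add_right, cross_of_mem_chord hpw', add_zero]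
  rw [e1, e2, ht, cross_smul_left, abs_mul, ht1, one_mul]

end

open Classical in
/-- The distance of `A` from the line of its window. -/
noncomputable def windowHeight (U V : Set (Space 2)) (A : Space 2) : ℝ :=
  if h : ∃ q : Space 2 × Space 2, IsWindow U V q.1 q.2 ∧ Behind U V q.1 q.2 A then
    |cross h.choose.2 (A - h.choose.1)| else 0

theorem IsHolefree.windowHeight_eq {U K : Set (Space 2)} (hU : IsHolefree U) (hK : PathJoined K)
    (hKU : K ⊆ U) {X v A : Space 2} (hw : IsWindow U (star U K) X v)
    (hA : Behind U (star U K) X v A) : windowHeight U (star U K) A = |cross v (A - X)| := by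
  have h : ∃ q : Space 2 × Space 2, IsWindow U (star U K) q.1 q.2 ∧ Behind U (star U K) q.1 q.2 A :=
    ⟨(X, v), hw, hA⟩
  rw [windowHeight, dif_pos h]
  exact hU.window_unique hK hKU h.choose_spec.1 hw h.choose_spec.2 hA A

/-- A nearby point forms a level pair with `A` and hence is behind the same window, so the height is
locally the distance to a fixed line. Measurability of the half of `levelPairs` where the second
point is the lower one rests on this. -/
theorem IsHolefree.continuousOn_windowHeight {U K : Set (Space 2)} (hU : IsHolefree U)
    (hK : PathJoined K) (hKU : K ⊆ U) :
    ContinuousOn (windowHeight U (star U K)) (star U (star U K) \ closure (star U K)) := by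
  intro A hA
  have hEo : IsOpen (star U (star U K) \ closure (star U K)) :=
    (isOpen_star hU.isOpen _).sdiff isClosed_closure
  obtain ⟨X, v, hw, hB⟩ := hU.exists_window_behind hK hKU hA.1 (fun h => hA.2 (subset_closure h))
  obtain ⟨r, hr, hball⟩ := Metric.isOpen_iff.1 hEo A hA
  have hev : windowHeight U (star U K) =ᶠ[𝓝 A] fun A' => |cross v (A' - X)| := by
    filter_upwards [Metric.ball_mem_nhds A hr] with A' hA'
    have hseg : segment ℝ A A' ⊆ star U (star U K) \ closure (star U K) :=
      ((convex_ball A r).segment_subset (Metric.mem_ball_self hr) hA').trans hball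
    exact hU.windowHeight_eq hK hKU hw (hU.behind_of_levelPairs hK hKU hw hB
      ⟨hA, hball hA', fun z hz => star_subset U _ (hseg hz).1,
        fun z hz h => (hseg hz).2 (subset_closure h)⟩)
  have : Continuous fun A' => |cross v (A' - X)| := by fun_prop
  exact (this.continuousAt.congr hev.symm).continuousWithinAt

/-- The area estimate behind the bound for pairs that see a common chord. -/
theorem IsHolefree.width_mul_height_le {U : Set (Space 2)} (hU : IsHolefree U) {c : ℝ}
    (hc0 : 0 ≤ c) (hc : ConvexAreaLE U c) {A B a v : Space 2} {x τ β : ℝ} (hAa : Sees U A a)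
    (hBb : Sees U B (a + β • v)) (hab : Sees U a (a + β • v)) (hAB : Sees U A B)
    (hB : B = a + x • v + τ • (A - a)) (hτ0 : 0 < τ) (hτ1 : τ ≤ 1)
    (hH : cross v (A - a) ≠ 0) : |x| * |cross v (A - a)| ≤ 4 * c := by
  set H := cross v (A - a) with hHdef
  have hBA : B - A = x • v + (τ - 1) • (A - a) := by rw [hB]; module
  have hcomb : ∀ {p q p' q' : ℝ}, p • v + q • (A - a) = p' • v + q' • (A - a) → p = p' ∧ q = q' := by
    intro p q p' q' h
    have h1 := congrArg (cross v) h
    have h2 := congrArg (fun z => cross z (A - a)) h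
    simp only [cross_add_right, cross_smul_right, cross_self, cross_add_left,
      cross_smul_left, mul_zero, zero_add, add_zero] at h1 h2
    exact ⟨mul_right_cancel₀ hH h2, mul_right_cancel₀ hH h1⟩
  by_cases hx : x = 0
  · rw [hx]; simp; exact hc0
  -- If `x` and `β` do not have opposite signs, `B` sees `a`, and the triangle `ABa` has doubled
  -- area `|x| |H|`. Indeed, let `d` point from `A` to a missing point of `aB`: the chord from `A`
  -- along `d` stops before that point, while `B → a + β • v → a` passes around it and joins the two
  -- sides of the chord.
  rcases le_or_gt 0 (x * β) with hxβ | hxβ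
  · have hBa : Sees U B a := by
      intro e he
      by_contra heU
      rw [segment_symm, segment_eq_image'] at he
      obtain ⟨l, ⟨hl0, hl1⟩, rfl⟩ := he
      have hl0' : 0 < l := lt_of_le_of_ne hl0 (by
        rintro rfl; apply heU; simpa using hAa.right)
      have hl1' : l < 1 := lt_of_le_of_ne hl1 (by
        rintro rfl; apply heU; simpa using hAB.right)
      set d := (l * x) • v + (l * τ - 1) • (A - a) with hd
      have hed : a + l • (B - a) = A + d := by rw [hd, hB]; module
      change a + l • (B - a) ∉ U at heU
      rw [hed] at heU
      have hlτ : l * τ < 1 := by nlinarith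
      have hdne : d ≠ 0 := by
        intro h0
        have := (hcomb (p' := 0) (q' := 0) (by rw [← hd, h0]; simp)).2
        linarith
      have hlt : ∀ {q : Space 2}, q ∈ chord U A d → ∃ t : ℝ, t < 1 ∧ q = A + t • d := by
        rintro q ⟨t, rfl, ht⟩
        refine ⟨t, ?_, rfl⟩
        by_contra hge
        rw [not_lt] at hge
        have ht' : Sees U (A + (0 : ℝ) • d) (A + t • d) := by simpa using ht
        rw [sees_line_iff] at ht'
        apply heU
        simpa using ht' 1 (mem_uIcc.2 (Or.inl ⟨zero_le_one, hge⟩))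
      have j1 : JoinedIn (U \ chord U A d) B (a + β • v) := (joinedIn_segment _ _).mono fun q hq => by
        refine ⟨hBb hq, fun hqc => ?_⟩
        obtain ⟨t, ht, e⟩ := hlt hqc
        rw [segment_symm, segment_eq_image'] at hq
        obtain ⟨m, ⟨hm0, hm1⟩, rfl⟩ := hq
        have e' : ((1 - m) * β + m * x) • v + (m * τ) • (A - a) =
            (t * (l * x)) • v + (1 + t * (l * τ - 1)) • (A - a) := by
          have h1 : a + β • v + m • (B - (a + β • v)) =
              a + (((1 - m) * β + m * x) • v + (m * τ) • (A - a)) := by rw [hB]; module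
          have h2 : A + t • d = a + ((t * (l * x)) • v + (1 + t * (l * τ - 1)) • (A - a)) := by
            rw [hd]; module
          change a + β • v + m • (B - (a + β • v)) = A + t • d at e
          rw [h1, h2] at e
          exact add_left_cancel e
        obtain ⟨e1, e2⟩ := hcomb e'
        have hpp := mul_pos (sub_pos.2 ht) (sub_pos.2 hlτ)
        have hml : l < m := by
          by_contra h
          have : m * τ ≤ l * τ := by nlinarith
          nlinarith
        have htl : t * l ≤ l := by nlinarith
        have hxx : 0 < x * x := mul_self_pos.2 hx
        have : (1 - m) * (x * β) + m * (x * x) = t * l * (x * x) := by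
          linear_combination x * e1
        nlinarith [mul_nonneg (sub_nonneg.2 hm1) hxβ]
      have j2 : JoinedIn (U \ chord U A d) (a + β • v) a := (joinedIn_segment _ _).mono fun q hq => by
        refine ⟨hab.symm hq, fun hqc => ?_⟩
        obtain ⟨t, ht, e⟩ := hlt hqc
        rw [segment_symm, segment_eq_image'] at hq
        obtain ⟨m, -, rfl⟩ := hq
        have e' : (m * β) • v + (0 : ℝ) • (A - a) =
            (t * (l * x)) • v + (1 + t * (l * τ - 1)) • (A - a) := by
          have h1 : a + m • (a + β • v - a) = a + ((m * β) • v + (0 : ℝ) • (A - a)) := by module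
          have h2 : A + t • d = a + ((t * (l * x)) • v + (1 + t * (l * τ - 1)) • (A - a)) := by
            rw [hd]; module
          change a + m • (a + β • v - a) = A + t • d at e
          rw [h1, h2] at e
          exact add_left_cancel e
        obtain ⟨-, e2⟩ := hcomb e'
        have hpp := mul_pos (sub_pos.2 ht) (sub_pos.2 hlτ)
        have := mul_pos hl0' hτ0
        nlinarith
      have hAU := hAa.left
      have hsep := hU.sep_mul hAU hdne (mem_chord_self d hAU) (mem_chord_self d hAU) hAB hAa
        (j1.trans j2)
      have e1 : cross d (B - A) = x * (1 - l) * H := by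
        rw [hBA, hd]
        simp only [cross_add_left, cross_add_right, cross_smul_left, cross_smul_right, cross_self,
          cross_swap (A - a) v, ← hHdef]
        ring
      have e2 : cross d (a - A) = -(l * x * H) := by
        have : a - A = (-1 : ℝ) • (A - a) := by module
        rw [this, hd]
        simp only [cross_add_left, cross_smul_left, cross_smul_right, cross_self, ← hHdef]
        ring
      rw [e1, e2] at hsep
      have : 0 < l * (1 - l) * ((x * x) * (H * H)) :=
        mul_pos (mul_pos hl0' (by linarith)) (mul_pos (mul_self_pos.2 hx) (mul_self_pos.2 hH))
      nlinarith
    have := hU.cross_le hc0 hc hAB hBa hAa.symm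
    have e : cross (B - A) (a - A) = -(x * H) := by
      have : a - A = (-1 : ℝ) • (A - a) := by module
      rw [this, hBA]
      simp only [cross_add_left, cross_smul_left, cross_smul_right, cross_self, ← hHdef]
      ring
    rw [e, abs_neg, abs_mul] at this
    linarith
  · have hβx : β - x ≠ 0 := by
      intro h
      have : β = x := by linarith
      rw [this] at hxβ
      nlinarith [mul_self_nonneg x]
    -- For opposite signs, `Aa` and the segment from `B` to `a + β • v` cross at a point `O`, which
    -- is at the fraction `s` of the latter.
    set s := β / (β - x) with hs
    have hs01 : 0 < s ∧ s < 1 := by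
      rcases lt_or_gt_of_ne hx with h | h
      · have : 0 < β := by by_contra h'; nlinarith
        exact ⟨div_pos this (by linarith), (div_lt_one (by linarith)).2 (by linarith)⟩
      · have : β < 0 := by by_contra h'; nlinarith
        exact ⟨div_pos_of_neg_of_neg this (by linarith),
          (div_lt_one_of_neg (by linarith)).2 (by linarith)⟩
    have hsβ : β * (1 - s) = -(s * x) := by rw [hs]; field_simp; ring
    set O := a + (s * τ) • (A - a) with hO
    have hO1 : O ∈ segment ℝ a A := by
      rw [segment_eq_image']
      exact ⟨s * τ, ⟨by nlinarith, by nlinarith⟩, rfl⟩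
    have hO2 : O ∈ segment ℝ (a + β • v) B := by
      rw [segment_eq_image']
      refine ⟨s, ⟨hs01.1.le, hs01.2.le⟩, ?_⟩
      have : a + β • v + s • (B - (a + β • v)) =
          a + (β * (1 - s) + s * x) • v + (s * τ) • (A - a) := by rw [hB]; module
      simp only [this, hsβ, hO]
      simp
    have t1 := hU.cross_le hc0 hc hAB (hBb.symm.sub (right_mem_segment ℝ _ _) hO2)
      (hAa.symm.sub hO1 (right_mem_segment ℝ _ _))
    have t2 := hU.cross_le hc0 hc hab (hBb.symm.sub (left_mem_segment ℝ _ _) hO2)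
      (hAa.symm.sub hO1 (left_mem_segment ℝ _ _))
    have e1 : cross (B - A) (O - A) = x * (s * τ - 1) * H := by
      have : O - A = (s * τ - 1) • (A - a) := by rw [hO]; module
      rw [this, hBA]
      simp only [cross_add_left, cross_smul_left, cross_smul_right, cross_self, ← hHdef]
      ring
    have e2 : cross (a + β • v - a) (O - a) = s * τ * β * H := by
      have h1 : O - a = (s * τ) • (A - a) := by rw [hO]; module
      rw [h1, add_sub_cancel_left]
      simp only [cross_smul_left, cross_smul_right, ← hHdef]
      ring
    have hμ0 : 0 < s * τ := mul_pos hs01.1 hτ0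
    have hμs : s * τ ≤ s := by nlinarith [hs01.1]
    rw [e1, abs_mul, abs_mul, abs_of_nonpos (by linarith [hs01.2] : s * τ - 1 ≤ 0)] at t1
    rw [e2, abs_mul, abs_mul, abs_of_pos hμ0] at t2
    have t3 : |β| * (1 - s) = s * |x| := by
      have := congrArg abs hsβ
      rwa [abs_neg, abs_mul, abs_mul, abs_of_pos hs01.1,
        abs_of_pos (by linarith [hs01.2] : 0 < 1 - s)] at this
    have hN : 0 ≤ |x| * |H| := by positivity
    set N := |x| * |H|
    have t1' : (1 - s * τ) * N ≤ 2 * c := by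
      calc (1 - s * τ) * N = |x| * -(s * τ - 1) * |H| := by simp only [N]; ring
        _ ≤ _ := t1
    -- The triangles at `O` over `AB` and over the window have doubled areas `(1 - s * τ) N` and `s
    -- * τ |β| |H|`. For `s * τ ≤ 1 / 2` the first gives the bound; otherwise `s > 1 / 2` forces
    -- `|β| ≥ |x|` and the second does.
    rcases le_or_gt (s * τ) (1 / 2) with hμ | hμ
    · nlinarith
    · have hsh : 1 / 2 < s := by linarith
      have hM : N ≤ |β| * |H| := by
        have h1 : (1 - s) * N ≤ (1 - s) * (|β| * |H|) := by
          calc (1 - s) * N ≤ s * N := by nlinarith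
            _ = (|β| * (1 - s)) * |H| := by rw [t3]; simp only [N]; ring
            _ = _ := by ring
        exact le_of_mul_le_mul_left h1 (by linarith [hs01.2])
      have t2' : (s * τ) * (|β| * |H|) ≤ 2 * c := by
        calc (s * τ) * (|β| * |H|) = s * τ * |β| * |H| := by ring
          _ ≤ _ := t2
      nlinarith

/-- In coordinates along the window and along `A - a`, the lower point `B` has height ratio in `(0,
1]` and horizontal coordinate at most `4 * c / |H|` in absolute value. -/
theorem IsHolefree.volume_levelSlice_le {U K : Set (Space 2)} (hU : IsHolefree U)
    (hK : PathJoined K) (hKU : K ⊆ U) {c : ℝ} (hc0 : 0 ≤ c) (hc : ConvexAreaLE U c) (A : Space 2) :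
    volume {B | (A, B) ∈ levelPairs U (star U K) ∧
      windowHeight U (star U K) B ≤ windowHeight U (star U K) A} ≤ ENNReal.ofReal (8 * c) := by
  by_cases hA : A ∈ star U (star U K) \ closure (star U K)
  swap
  · have : {B | (A, B) ∈ levelPairs U (star U K) ∧
        windowHeight U (star U K) B ≤ windowHeight U (star U K) A} = ∅ := by
      ext B
      simp only [mem_ofPred_eq, mem_empty_iff_false, iff_false]
      exact fun h => hA h.1.1
    rw [this]; simp
  obtain ⟨X, v, hw, hA'⟩ := hU.exists_window_behind hK hKU hA.1 (fun h => hA.2 (subset_closure h))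
  obtain ⟨a, ha, hAa⟩ := hA'.exists_mem_chord
  have hH : cross v (A - X) ≠ 0 := cross_ne_zero_of_notMem hw.ne_zero ha hAa.symm
    (fun h => hA.2 (hw.subset_closure h))
  have hshift : ∀ z, cross v (z - a) = cross v (z - X) := by
    intro z
    have : z - a = (z - X) - (a - X) := by abel
    rw [this, cross_sub_right, cross_of_mem_chord ha, sub_zero]
  set H := cross v (A - X) with hHdef
  have hHpos : 0 < |H| := abs_pos.2 hH
  calc volume _ ≤ volume {z | ∃ x ∈ Icc (-(4 * c / |H|)) (4 * c / |H|), ∃ y ∈ Icc (0 : ℝ) 1,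
        z = a + (x • v + y • (A - a))} := measure_mono ?_
    _ = ENNReal.ofReal (8 * c) := by
      rw [volume_parallelogram, hshift, ← ENNReal.ofReal_mul (by
        have : 0 ≤ 4 * c / |H| := by positivity
        linarith), ← ENNReal.ofReal_mul (abs_nonneg _)]
      congr 1
      field_simp
      ring
  rintro B ⟨hAB, hh⟩
  have hB' := hU.behind_of_levelPairs hK hKU hw hA' hAB
  rw [hU.windowHeight_eq hK hKU hw hA', hU.windowHeight_eq hK hKU hw hB'] at hh
  have hside := hU.same_side_of_levelPairs hK hKU hw hA' hAB
  obtain ⟨b, hb, hBb⟩ := hB'.exists_mem_chord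
  have hsab := sees_of_mem_chord ha hb
  set τ := cross v (B - X) / H with hτ
  have hτ0 : 0 < τ := by
    have : τ = (H * cross v (B - X)) / (H * H) := by rw [hτ]; field_simp
    rw [this]
    exact div_pos hside (mul_self_pos.2 hH)
  have hτ1 : τ ≤ 1 := by
    rw [← abs_of_pos hτ0, hτ, abs_div, div_le_one hHpos]
    exact hh
  have h0 : cross v (B - a - τ • (A - a)) = 0 := by
    rw [cross_sub_right, cross_smul_right, hshift, hshift, hτ, ← hHdef]
    field_simp
    ring
  obtain ⟨x, hx⟩ := exists_smul_eq_of_cross_eq_zero hw.ne_zero h0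
  have hBeq : B = a + x • v + τ • (A - a) := by rw [← hx]; abel
  rw [← chord_eq_of_mem ha] at hb
  obtain ⟨β, rfl, -⟩ := hb
  have key := hU.width_mul_height_le hc0 hc hAa hBb hsab hAB.2.2.1 hBeq hτ0 hτ1
    (by rw [hshift]; exact hH)
  rw [hshift, ← le_div_iff₀ hHpos] at key
  exact ⟨x, abs_le.1 key, τ, ⟨hτ0.le, hτ1⟩, by rw [hBeq]; abel⟩

/-- The bound for pairs of points that see a common point. -/
theorem IsHolefree.volume_rootSlice_le {U : Set (Space 2)} (hU : IsHolefree U) {c : ℝ}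
    (hc0 : 0 ≤ c) (hc : ConvexAreaLE U c) (O A : Space 2) :
    volume {B | Sees U O A ∧ Sees U O B ∧ Sees U A B ∧ ‖B - O‖ ≤ ‖A - O‖} ≤
      ENNReal.ofReal (8 * c) := by
  by_cases hAO : A = O
  · calc volume _ ≤ volume {O} := measure_mono ?_
      _ ≤ _ := by simp
    rintro B ⟨-, -, -, h⟩
    rw [hAO, sub_self, norm_zero] at h
    exact sub_eq_zero.1 (norm_le_zero_iff.1 h)
  set u := A - O with hu
  have hu0 : u ≠ 0 := sub_ne_zero.2 hAO
  have hn : 0 < ‖u‖ ^ 2 := by positivity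
  -- The triangle `OAB` bounds the component of `B - O` orthogonal to `u` by `2 * c / ‖u‖`; the norm
  -- comparison bounds the component along `u` by `‖u‖`.
  calc volume _ ≤ volume {z | ∃ x ∈ Icc (-1 : ℝ) 1, ∃ y ∈ Icc (-(2 * c / ‖u‖ ^ 2)) (2 * c / ‖u‖ ^ 2),
        z = O + (x • u + y • rot u)} := measure_mono ?_
    _ = ENNReal.ofReal (8 * c) := by
      rw [volume_parallelogram, cross_rot_right, ← ENNReal.ofReal_mul (by norm_num),
        ← ENNReal.ofReal_mul (abs_nonneg _), abs_of_pos hn]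
      congr 1
      field_simp
      ring
  rintro B ⟨h1, h2, h3, h4⟩
  have hcr := hU.cross_le hc0 hc h1 h3 h2.symm
  set w := B - O with hw
  have hw2 : ‖w‖ ^ 2 ≤ ‖u‖ ^ 2 := by gcongr
  have hn' := hn
  rw [norm_sq_eq] at hw2 hn'
  rw [norm_sq_eq u] at hw2
  have hcs : (u 0 * w 0 + u 1 * w 1) ^ 2 ≤ (u 0 ^ 2 + u 1 ^ 2) ^ 2 := by
    have : (u 0 * w 0 + u 1 * w 1) ^ 2 ≤ (u 0 ^ 2 + u 1 ^ 2) * (w 0 ^ 2 + w 1 ^ 2) := by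
      nlinarith [sq_nonneg (u 0 * w 1 - u 1 * w 0)]
    nlinarith
  have hcs' := abs_le_of_sq_le_sq' hcs hn'.le
  refine ⟨(u 0 * w 0 + u 1 * w 1) / ‖u‖ ^ 2, ?_, cross u w / ‖u‖ ^ 2, ?_, ?_⟩
  · rw [norm_sq_eq]
    constructor
    · rw [le_div_iff₀ hn']; linarith [hcs'.1]
    · rw [div_le_one hn']; exact hcs'.2
  · rw [mem_Icc, ← abs_le, abs_div, abs_of_pos hn]
    gcongr
  · rw [norm_sq_eq]
    have e : B = O + w := by rw [hw]; abel
    rw [e]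
    congr 1
    ext i
    fin_cases i
    · simp [rot, cross]; field_simp; ring
    · simp [rot, cross]; field_simp; ring

/-! ### Measures of sets of pairs -/

theorem volume_le_of_slice_le {P : Set (Space 2 × Space 2)} (hP : MeasurableSet P)
    {D : Set (Space 2)} (hD : MeasurableSet D) (hPD : ∀ q ∈ P, q.1 ∈ D) {m : ℝ≥0∞}
    (h : ∀ A, volume {B | (A, B) ∈ P} ≤ m) : volume P ≤ m * volume D := by
  rw [Measure.volume_eq_prod, Measure.prod_apply hP]
  calc ∫⁻ A, volume (Prod.mk A ⁻¹' P) ≤ ∫⁻ A, D.indicator (fun _ => m) A := by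
        refine lintegral_mono fun A => ?_
        by_cases hA : A ∈ D
        · rw [indicator_of_mem hA]; exact h A
        · rw [indicator_of_notMem hA]
          have : Prod.mk A ⁻¹' P = ∅ := by
            ext B
            simp only [mem_preimage, mem_empty_iff_false, iff_false]
            exact fun hB => hA (hPD _ hB)
          rw [this, measure_empty]
    _ = m * volume D := by rw [lintegral_indicator hD, setLIntegral_const]

theorem volume_preimage_swap (P : Set (Space 2 × Space 2)) :
    volume (Prod.swap ⁻¹' P) = volume P :=
  MeasurePreserving.measure_preimage_equiv (f := MeasurableEquiv.prodComm)
    Measure.measurePreserving_swap P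

/-- By symmetry `F` is covered by the half where the second point is not higher, together with its
mirror image; Tonelli bounds that half. -/
theorem volume_le_of_half_slice_le {F : Set (Space 2 × Space 2)} {h : Space 2 → ℝ}
    (hF : MeasurableSet {q | q ∈ F ∧ h q.2 ≤ h q.1})
    (hsymm : ∀ A B, (A, B) ∈ F → (B, A) ∈ F) {D : Set (Space 2)} (hD : MeasurableSet D)
    (hFD : ∀ q ∈ F, q.1 ∈ D) {m : ℝ≥0∞} (hm : ∀ A, volume {B | (A, B) ∈ F ∧ h B ≤ h A} ≤ m) :
    volume F ≤ 2 * m * volume D := by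
  set P := {q | q ∈ F ∧ h q.2 ≤ h q.1} with hPdef
  have hsub : F ⊆ P ∪ Prod.swap ⁻¹' P := by
    rintro ⟨A, B⟩ hq
    rcases le_total (h B) (h A) with h' | h'
    · exact Or.inl ⟨hq, h'⟩
    · exact Or.inr ⟨hsymm A B hq, h'⟩
  have hP := volume_le_of_slice_le hF hD (fun q hq => hFD q hq.1) hm
  calc volume F ≤ volume P + volume (Prod.swap ⁻¹' P) := (measure_mono hsub).trans (measure_union_le _ _)
    _ = volume P + volume P := by rw [volume_preimage_swap]
    _ ≤ m * volume D + m * volume D := add_le_add hP hP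
    _ = 2 * m * volume D := by ring

theorem volume_scale_snd {P : Set (Space 2 × Space 2)} (hP : MeasurableSet P) {t : ℝ} (ht : 0 < t) :
    volume {q : Space 2 × Space 2 | (q.1, q.1 + t • (q.2 - q.1)) ∈ P} =
      ENNReal.ofReal (1 / t ^ 2) * volume P := by
  have hm : MeasurableSet {q : Space 2 × Space 2 | (q.1, q.1 + t • (q.2 - q.1)) ∈ P} := by
    have : Continuous fun q : Space 2 × Space 2 => (q.1, q.1 + t • (q.2 - q.1)) := by fun_prop
    exact this.measurable hP
  rw [Measure.volume_eq_prod, Measure.prod_apply hm, Measure.prod_apply hP,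
    ← lintegral_const_mul _ (measurable_measure_prodMk_left hP)]
  refine lintegral_congr fun A => ?_
  have e : Prod.mk A ⁻¹' {q : Space 2 × Space 2 | (q.1, q.1 + t • (q.2 - q.1)) ∈ P} =
      AffineMap.homothety A (t⁻¹) '' (Prod.mk A ⁻¹' P) := by
    ext B
    simp only [mem_preimage, mem_ofPred_eq, mem_image]
    constructor
    · intro h
      refine ⟨_, h, ?_⟩
      simp [AffineMap.homothety_apply, smul_smul, ht.ne']
    · rintro ⟨C, hC, rfl⟩
      simpa [AffineMap.homothety_apply, smul_smul, ht.ne'] using hC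
  rw [e, Measure.addHaar_image_homothety, finrank_euclideanSpace_fin]
  congr 2
  rw [abs_of_pos (by positivity)]
  field_simp

/-- Move both points towards each other by the proportion `δ` of their distance. -/
def shrink (δ : ℝ) (q : Space 2 × Space 2) : Space 2 × Space 2 :=
  (q.1 + δ • (q.2 - q.1), q.1 + (1 - δ) • (q.2 - q.1))

theorem volume_preimage_shrink {P : Set (Space 2 × Space 2)} (hP : MeasurableSet P) {δ : ℝ}
    (hδ : δ < 1 / 2) :
    volume (shrink δ ⁻¹' P) = ENNReal.ofReal (1 / (1 - 2 * δ) ^ 2) * volume P := by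
  have h1 : 0 < 1 - δ := by linarith
  have h2 : 0 < 1 - 2 * δ := by linarith
  -- The map `shrink δ` is a contraction of the second point towards the first by `1 - δ`, followed
  -- by one of the first towards the new second by `s`; the product of the ratios is `1 - 2 * δ`.
  set s := (1 - 2 * δ) / (1 - δ) with hs
  have hs0 : 0 < s := div_pos h2 h1
  set P₁ : Set (Space 2 × Space 2) := Prod.swap ⁻¹' P with hP₁
  have hP₁m : MeasurableSet P₁ := measurable_swap hP
  set P₂ : Set (Space 2 × Space 2) := {q | (q.1, q.1 + s • (q.2 - q.1)) ∈ P₁} with hP₂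
  have hP₂m : MeasurableSet P₂ := by
    have : Continuous fun q : Space 2 × Space 2 => (q.1, q.1 + s • (q.2 - q.1)) := by fun_prop
    exact this.measurable hP₁m
  have e : shrink δ ⁻¹' P = {q | (q.1, q.1 + (1 - δ) • (q.2 - q.1)) ∈ Prod.swap ⁻¹' P₂} := by
    ext ⟨A, B⟩
    simp only [hP₂, hP₁, mem_preimage, mem_ofPred_eq, Prod.swap_prod_mk, shrink]
    have : A + (1 - δ) • (B - A) + s • (A - (A + (1 - δ) • (B - A))) = A + δ • (B - A) := by
      have h3 : (1 - δ) * s = 1 - 2 * δ := by rw [hs]; field_simp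
      calc _ = A + ((1 - δ) - (1 - δ) * s) • (B - A) := by module
        _ = _ := by rw [h3]; congr 2; ring
    rw [this]
  rw [e, volume_scale_snd (measurable_swap hP₂m) h1, volume_preimage_swap, hP₂,
    volume_scale_snd hP₁m hs0, hP₁, volume_preimage_swap, ← mul_assoc,
    ← ENNReal.ofReal_mul (by positivity)]
  congr 2
  rw [hs]
  field_simp

/-! ### Measurability -/

/-- The pairs that see each other. -/
def seePairs (U : Set (Space 2)) : Set (Space 2 × Space 2) := {q | Sees U q.1 q.2}

theorem isOpen_meets {V : Set (Space 2)} (hV : IsOpen V) (I : Set ℝ) :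
    IsOpen {q : Space 2 × Space 2 | ∃ s ∈ I, q.1 + s • (q.2 - q.1) ∈ V} := by
  have : {q : Space 2 × Space 2 | ∃ s ∈ I, q.1 + s • (q.2 - q.1) ∈ V} =
      ⋃ s ∈ I, {q | q.1 + s • (q.2 - q.1) ∈ V} := by ext; simp
  rw [this]
  refine isOpen_biUnion fun s _ => ?_
  have : Continuous fun q : Space 2 × Space 2 => q.1 + s • (q.2 - q.1) := by fun_prop
  exact hV.preimage this

theorem exists_mem_segment_iff {V : Set (Space 2)} {A B : Space 2} :
    (∃ w ∈ segment ℝ A B, w ∈ V) ↔ ∃ s ∈ Icc (0 : ℝ) 1, A + s • (B - A) ∈ V := by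
  rw [segment_eq_image']
  simp

theorem measurableSet_levelPairs {U V : Set (Space 2)} (hU : IsOpen U) (hV : IsOpen V) :
    MeasurableSet (levelPairs U V) := by
  have hE : MeasurableSet (star U V \ closure V) :=
    (isOpen_star hU V).measurableSet.diff isClosed_closure.measurableSet
  have h4 : MeasurableSet {q : Space 2 × Space 2 | ∀ w ∈ segment ℝ q.1 q.2, w ∉ V} := by
    have : {q : Space 2 × Space 2 | ∀ w ∈ segment ℝ q.1 q.2, w ∉ V} =
        {q : Space 2 × Space 2 | ∃ s ∈ Icc (0 : ℝ) 1, q.1 + s • (q.2 - q.1) ∈ V}ᶜ := by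
      ext q
      rw [mem_compl_iff, mem_ofPred_eq, mem_ofPred_eq, ← exists_mem_segment_iff]
      push Not
      rfl
    rw [this]
    exact (isOpen_meets hV _).measurableSet.compl
  exact (measurable_fst hE).inter ((measurable_snd hE).inter
    ((isOpen_sees hU).measurableSet.inter h4))

theorem measurableSet_latePairs {U V : Set (Space 2)} (hU : IsOpen U) (hV : IsOpen V) :
    MeasurableSet {q : Space 2 × Space 2 | q.2 ∈ lateSlice U V q.1} := by
  have h3 : MeasurableSet {q : Space 2 × Space 2 | ∃ y ∈ segment ℝ q.1 q.2, y ∈ V} := by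
    simp only [exists_mem_segment_iff]
    exact (isOpen_meets hV _).measurableSet
  have h2 : MeasurableSet {q : Space 2 × Space 2 |
      ∀ s ∈ Icc (0 : ℝ) (1 / 4), q.1 + s • (q.2 - q.1) ∉ V} := by
    have : {q : Space 2 × Space 2 | ∀ s ∈ Icc (0 : ℝ) (1 / 4), q.1 + s • (q.2 - q.1) ∉ V} =
        {q : Space 2 × Space 2 | ∃ s ∈ Icc (0 : ℝ) (1 / 4), q.1 + s • (q.2 - q.1) ∈ V}ᶜ := by
      ext q
      rw [mem_compl_iff, mem_ofPred_eq, mem_ofPred_eq]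
      push Not
      rfl
    rw [this]
    exact (isOpen_meets hV _).measurableSet.compl
  exact (isOpen_sees hU).measurableSet.inter (h2.inter h3)

theorem IsHolefree.volume_levelPairs_le {U K : Set (Space 2)} (hU : IsHolefree U)
    (hK : PathJoined K) (hKU : K ⊆ U) {c : ℝ} (hc0 : 0 ≤ c) (hc : ConvexAreaLE U c) :
    volume (levelPairs U (star U K)) ≤
      ENNReal.ofReal (16 * c) * volume (star U (star U K) \ star U K) := by
  have hVo := isOpen_star hU.isOpen K
  have hEo : IsOpen (star U (star U K) \ closure (star U K)) :=
    (isOpen_star hU.isOpen _).sdiff isClosed_closure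
  classical
  have hh : Measurable ((star U (star U K) \ closure (star U K)).piecewise
      (windowHeight U (star U K)) (fun _ => 0)) :=
    (hU.continuousOn_windowHeight hK hKU).measurable_piecewise continuousOn_const hEo.measurableSet
  have hm : MeasurableSet {q | q ∈ levelPairs U (star U K) ∧
      windowHeight U (star U K) q.2 ≤ windowHeight U (star U K) q.1} := by
    have : {q | q ∈ levelPairs U (star U K) ∧
        windowHeight U (star U K) q.2 ≤ windowHeight U (star U K) q.1} =
        levelPairs U (star U K) ∩ {q | (star U (star U K) \ closure (star U K)).piecewise
          (windowHeight U (star U K)) (fun _ => 0) q.2 ≤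
          (star U (star U K) \ closure (star U K)).piecewise
          (windowHeight U (star U K)) (fun _ => 0) q.1} := by
      ext q
      refine and_congr_right fun hq => ?_
      rw [mem_ofPred_eq, piecewise_eq_of_mem _ _ _ hq.1, piecewise_eq_of_mem _ _ _ hq.2.1]
    rw [this]
    exact (measurableSet_levelPairs hU.isOpen hVo).inter
      (measurableSet_le (hh.comp measurable_snd) (hh.comp measurable_fst))
  have := volume_le_of_half_slice_le hm (fun A B => levelPairs_swap)
    ((isOpen_star hU.isOpen (star U K)).measurableSet.diff hVo.measurableSet)
    (fun q hq => ⟨hq.1.1, fun h => hq.1.2 (subset_closure h)⟩)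
    (hU.volume_levelSlice_le hK hKU hc0 hc)
  have e : (2 : ℝ≥0∞) * ENNReal.ofReal (8 * c) = ENNReal.ofReal (16 * c) := by
    rw [show (2 : ℝ≥0∞) = ENNReal.ofReal 2 by simp, ← ENNReal.ofReal_mul (by norm_num)]
    congr 1; ring
  rwa [e] at this

/-- In a ball inside `U` the set `V` is convex, and frontiers of convex sets are null. -/
theorem RelConvex.volume_boundary {U V : Set (Space 2)} (hU : IsOpen U)
    (h : RelConvex U V) : volume (U ∩ (closure V \ V)) = 0 := by
  refine measure_null_of_locally_null _ fun x hx => ?_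
  obtain ⟨r, hr, hball⟩ := Metric.isOpen_iff.1 hU x hx.1
  refine ⟨(U ∩ (closure V \ V)) ∩ Metric.ball x r,
    inter_mem self_mem_nhdsWithin (mem_nhdsWithin_of_mem_nhds (Metric.ball_mem_nhds x hr)), ?_⟩
  have hconv : Convex ℝ (V ∩ Metric.ball x r) := by
    rw [convex_iff_segment_subset]
    intro a ha b hb
    have hs := (convex_ball x r).segment_subset ha.2 hb.2
    exact subset_inter (h ha.1 hb.1 (hs.trans hball)) hs
  refine measure_mono_null ?_ (hconv.addHaar_frontier volume)
  rintro z ⟨⟨-, hzc, hzV⟩, hzb⟩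
  refine ⟨?_, fun hz => hzV (interior_subset hz).1⟩
  have := Metric.isOpen_ball.inter_closure ⟨hzb, hzc⟩
  rwa [inter_comm] at this

theorem volume_fst_mem_eq_zero {N : Set (Space 2)} (hN : volume N = 0) :
    volume {q : Space 2 × Space 2 | q.1 ∈ N} = 0 := by
  have : {q : Space 2 × Space 2 | q.1 ∈ N} = N ×ˢ univ := by ext; simp
  rw [this, Measure.volume_eq_prod, Measure.prod_prod, hN, zero_mul]

theorem volume_snd_mem_eq_zero {N : Set (Space 2)} (hN : volume N = 0) :
    volume {q : Space 2 × Space 2 | q.2 ∈ N} = 0 := by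
  have : {q : Space 2 × Space 2 | q.2 ∈ N} = univ ×ˢ N := by ext; simp
  rw [this, Measure.volume_eq_prod, Measure.prod_prod, hN, mul_zero]

/-! ### Levels of visibility -/

/-- The points reached from `O` by a polygonal curve in `U` of at most `k` segments. -/
def level (U : Set (Space 2)) (O : Space 2) : ℕ → Set (Space 2)
  | 0 => {O}
  | k + 1 => star U (level U O k)

section
variable {U : Set (Space 2)} {O : Space 2}

theorem level_subset (hO : O ∈ U) : ∀ k, level U O k ⊆ U
  | 0 => by simpa [level] using hO
  | k + 1 => star_subset U _

theorem pathJoined_level (hO : O ∈ U) : ∀ k, PathJoined (level U O k)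
  | 0 => by
    rintro x rfl y rfl
    exact JoinedIn.refl rfl
  | k + 1 => (pathJoined_level hO k).star (level_subset hO k)

theorem level_mono (hO : O ∈ U) : Monotone (level U O) :=
  monotone_nat_of_le_succ fun k => subset_star (level_subset hO k)

theorem level_trans {P Q : Space 2} {j : ℕ} (hP : P ∈ level U O j) :
    ∀ {k : ℕ}, Q ∈ level U P k → Q ∈ level U O (j + k) := by
  intro k
  induction k generalizing Q with
  | zero => rintro rfl; exact hP
  | succ k ih =>
    rintro ⟨R, hR, hQR⟩
    exact ⟨R, ih hR, hQR⟩

theorem level_symm (hO : O ∈ U) {P : Space 2} :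
    ∀ {k : ℕ}, P ∈ level U O k → O ∈ level U P k := by
  intro k
  induction k generalizing P with
  | zero => rintro rfl; rfl
  | succ k ih =>
    rintro ⟨R, hR, hPR⟩
    have h1 : R ∈ level U P 1 := ⟨P, rfl, hPR.symm⟩
    have := level_trans h1 (ih hR)
    rwa [add_comm] at this

/-- The set of points that are joined to `O` by polygonal curves in `U`. -/
def linkClass (U : Set (Space 2)) (O : Space 2) : Set (Space 2) := ⋃ k, level U O k

theorem mem_linkClass_self (U : Set (Space 2)) (O : Space 2) : O ∈ linkClass U O :=
  mem_iUnion.2 ⟨0, rfl⟩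

theorem isOpen_linkClass (hU : IsOpen U) (hO : O ∈ U) : IsOpen (linkClass U O) := by
  have : linkClass U O = ⋃ k, level U O (k + 1) := by
    refine subset_antisymm (iUnion_subset fun k => ?_) (iUnion_subset fun k => ?_)
    · exact (level_mono hO (Nat.le_succ k)).trans (subset_iUnion (fun k => level U O (k + 1)) k)
    · exact subset_iUnion (level U O) (k + 1)
  rw [this]
  exact isOpen_iUnion fun k => isOpen_star hU _

theorem linkClass_subset (hO : O ∈ U) : linkClass U O ⊆ U := iUnion_subset (level_subset hO)

theorem linkClass_eq {P : Space 2} (hO : O ∈ U) (h : P ∈ linkClass U O) :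
    linkClass U P = linkClass U O := by
  obtain ⟨j, hj⟩ := mem_iUnion.1 h
  refine subset_antisymm (iUnion_subset fun k Q hQ => ?_) (iUnion_subset fun k Q hQ => ?_)
  · exact mem_iUnion.2 ⟨_, level_trans hj hQ⟩
  · exact mem_iUnion.2 ⟨_, level_trans (level_symm hO hj) hQ⟩

/-- The points on the level `k + 1`; the root belongs to the first of these sets. -/
def shell (U : Set (Space 2)) (O : Space 2) : ℕ → Set (Space 2)
  | 0 => level U O 1
  | k + 1 => level U O (k + 2) \ level U O (k + 1)

theorem measurableSet_shell (hU : IsOpen U) : ∀ k, MeasurableSet (shell U O k)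
  | 0 => (isOpen_star hU _).measurableSet
  | _ + 1 => (isOpen_star hU _).measurableSet.diff (isOpen_star hU _).measurableSet

theorem shell_subset : ∀ k, shell U O k ⊆ level U O (k + 1)
  | 0 => subset_rfl
  | _ + 1 => Set.sdiff_subset

theorem tsum_volume_shell_le (hU : IsOpen U) (hO : O ∈ U) :
    ∑' k, volume (shell U O k) ≤ volume (linkClass U O) := by
  have hdisj : Pairwise (Function.onFun Disjoint (shell U O)) := by
    rw [pairwise_disjoint_on]
    intro i j hij
    rw [disjoint_left]
    intro z hi hj
    obtain ⟨j, rfl⟩ := Nat.exists_eq_succ_of_ne_zero (Nat.ne_of_gt (Nat.lt_of_le_of_lt (Nat.zero_le i) hij))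
    exact hj.2 (level_mono hO (by omega) (shell_subset i hi))
  rw [← measure_iUnion hdisj (measurableSet_shell hU)]
  exact measure_mono (iUnion_subset fun k => (shell_subset k).trans (subset_iUnion _ _))

/-- Pairs on the level `k + 1`, both seeing the level `k` but not through it. -/
def shellPairs (U : Set (Space 2)) (O : Space 2) : ℕ → Set (Space 2 × Space 2)
  | 0 => {q | Sees U O q.1 ∧ Sees U O q.2 ∧ Sees U q.1 q.2}
  | k + 1 => {q | q.1 ∈ level U O (k + 2) ∧ q.2 ∈ level U O (k + 2) ∧ Sees U q.1 q.2 ∧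
      ∀ w ∈ segment ℝ q.1 q.2, w ∉ level U O (k + 1)}

/-- Pairs that enter the level `k` late. -/
def latePairs (U : Set (Space 2)) (O : Space 2) : ℕ → Set (Space 2 × Space 2)
  | 0 => ∅
  | k + 1 => {q | q.2 ∈ lateSlice U (level U O (k + 1)) q.1 ∧ q.1 ∈ level U O (k + 2)}

theorem measurableSet_shellPairs (hU : IsOpen U) : ∀ k, MeasurableSet (shellPairs U O k)
  | 0 => by
    have h : Continuous fun q : Space 2 × Space 2 => (O, q.1) := by fun_prop
    have h' : Continuous fun q : Space 2 × Space 2 => (O, q.2) := by fun_prop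
    exact ((isOpen_sees hU).preimage h).measurableSet.inter
      (((isOpen_sees hU).preimage h').measurableSet.inter (isOpen_sees hU).measurableSet)
  | k + 1 => by
    have hE : MeasurableSet (level U O (k + 2)) := (isOpen_star hU _).measurableSet
    have h4 : MeasurableSet {q : Space 2 × Space 2 |
        ∀ w ∈ segment ℝ q.1 q.2, w ∉ level U O (k + 1)} := by
      have : {q : Space 2 × Space 2 | ∀ w ∈ segment ℝ q.1 q.2, w ∉ level U O (k + 1)} =
          {q : Space 2 × Space 2 |
            ∃ s ∈ Icc (0 : ℝ) 1, q.1 + s • (q.2 - q.1) ∈ level U O (k + 1)}ᶜ := by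
        ext q
        rw [mem_compl_iff, mem_ofPred_eq, mem_ofPred_eq, ← exists_mem_segment_iff]
        push Not
        rfl
      rw [this]
      exact (isOpen_meets (isOpen_star hU _) _).measurableSet.compl
    exact (measurable_fst hE).inter ((measurable_snd hE).inter
      ((isOpen_sees hU).measurableSet.inter h4))

theorem IsHolefree.volume_shellPairs_le (hU : IsHolefree U) (hO : O ∈ U) {c : ℝ} (hc0 : 0 ≤ c)
    (hc : ConvexAreaLE U c) :
    ∀ k, volume (shellPairs U O k) ≤ ENNReal.ofReal (16 * c) * volume (shell U O k)
  | 0 => by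
    have hm : MeasurableSet {q | q ∈ shellPairs U O 0 ∧ ‖q.2 - O‖ ≤ ‖q.1 - O‖} := by
      have h2 : MeasurableSet {q : Space 2 × Space 2 | ‖q.2 - O‖ ≤ ‖q.1 - O‖} :=
        measurableSet_le (Continuous.measurable (by fun_prop)) (Continuous.measurable (by fun_prop))
      exact (measurableSet_shellPairs hU.isOpen 0).inter h2
    have := volume_le_of_half_slice_le (h := fun z => ‖z - O‖) hm
      (fun A B h => ⟨h.2.1, h.1, h.2.2.symm⟩) (measurableSet_shell hU.isOpen 0)
      (fun q hq => (⟨O, rfl, hq.1.symm⟩ : q.1 ∈ level U O 1)) (m := ENNReal.ofReal (8 * c))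
      (fun A => by
        refine (measure_mono ?_).trans (hU.volume_rootSlice_le hc0 hc O A)
        rintro B ⟨⟨h1, h2, h3⟩, h4⟩
        exact ⟨h1, h2, h3, h4⟩)
    have e : (2 : ℝ≥0∞) * ENNReal.ofReal (8 * c) = ENNReal.ofReal (16 * c) := by
      rw [show (2 : ℝ≥0∞) = ENNReal.ofReal 2 by simp, ← ENNReal.ofReal_mul (by norm_num)]
      congr 1; ring
    rwa [e] at this
  | k + 1 => by
    have hK := pathJoined_level hO k
    have hKU := level_subset hO k
    have hnull : volume (U ∩ (closure (level U O (k + 1)) \ level U O (k + 1))) = 0 :=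
      (hU.relConvex_star hK hKU).volume_boundary hU.isOpen
    -- Only `levelPairs` excludes the closure of the level; the difference is null.
    have hsub : shellPairs U O (k + 1) ⊆ levelPairs U (level U O (k + 1)) ∪
        ({q | q.1 ∈ U ∩ (closure (level U O (k + 1)) \ level U O (k + 1))} ∪
        {q | q.2 ∈ U ∩ (closure (level U O (k + 1)) \ level U O (k + 1))}) := by
      rintro q ⟨h1, h2, h3, h4⟩
      by_cases c1 : q.1 ∈ closure (level U O (k + 1))
      · exact Or.inr (Or.inl ⟨h3.left, c1, h4 _ (left_mem_segment ℝ _ _)⟩)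
      by_cases c2 : q.2 ∈ closure (level U O (k + 1))
      · exact Or.inr (Or.inr ⟨h3.right, c2, h4 _ (right_mem_segment ℝ _ _)⟩)
      exact Or.inl ⟨⟨h1, c1⟩, ⟨h2, c2⟩, h3, h4⟩
    calc volume (shellPairs U O (k + 1)) ≤ volume (levelPairs U (level U O (k + 1))) + (0 + 0) := by
          refine (measure_mono hsub).trans ((measure_union_le _ _).trans ?_)
          gcongr
          refine (measure_union_le _ _).trans ?_
          rw [volume_fst_mem_eq_zero hnull, volume_snd_mem_eq_zero hnull]
      _ ≤ _ := by
          rw [add_zero, add_zero]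
          exact hU.volume_levelPairs_le hK hKU hc0 hc

theorem IsHolefree.volume_latePairs_le (hU : IsHolefree U) (hO : O ∈ U) {c : ℝ}
    (hc : ConvexAreaLE U c) :
    ∀ k, volume (latePairs U O k) ≤ ENNReal.ofReal (16 * c) * volume (shell U O k)
  | 0 => by simp [latePairs]
  | k + 1 => by
    have hm : MeasurableSet (latePairs U O (k + 1)) :=
      (measurableSet_latePairs hU.isOpen (isOpen_star hU.isOpen _)).inter
        (measurable_fst (isOpen_star hU.isOpen _).measurableSet)
    refine volume_le_of_slice_le hm (measurableSet_shell hU.isOpen _) (fun q hq => ?_) (fun A => ?_)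
    · exact ⟨hq.2, by simpa using hq.1.2.1 0 (by norm_num)⟩
    · refine (measure_mono ?_).trans
        (hU.volume_lateSlice_le (pathJoined_level hO k) (level_subset hO k) hc A)
      exact fun B hB => hB.1

/-- With `k` least such that the segment meets `level (k + 1)`, the whole segment is in `level (k +
2)` and the part in `level (k + 1)` is an interval. Either that interval contains the middle half,
or some parameter `m` of the middle half is missing and the interval lies on one side of `m`. -/
theorem IsHolefree.seePairs_subset (hU : IsHolefree U) (hO : O ∈ U) :
    {q | q ∈ seePairs U ∧ q.1 ∈ linkClass U O} ⊆ ⋃ k, (shrink (1 / 4) ⁻¹' shellPairs U O k ∪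
      (latePairs U O k ∪ Prod.swap ⁻¹' latePairs U O k)) := by
  rintro ⟨A, B⟩ ⟨hAB, hA⟩
  have hAB' : Sees U A B := hAB
  obtain ⟨j, hj⟩ := mem_iUnion.1 hA
  have hex : ∃ k, ∃ s ∈ Icc (0 : ℝ) 1, A + s • (B - A) ∈ level U O (k + 1) :=
    ⟨j, 0, by simp, by simpa using level_mono hO (Nat.le_succ j) hj⟩
  classical
  set k := Nat.find hex with hk
  obtain ⟨ω, hω, hωV⟩ := Nat.find_spec hex
  have hmin : ∀ i < k, ∀ s ∈ Icc (0 : ℝ) 1, A + s • (B - A) ∉ level U O (i + 1) :=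
    fun i hi s hs h => Nat.find_min hex hi ⟨s, hs, h⟩
  rw [← hk] at hωV
  have hrel : RelConvex U (level U O (k + 1)) :=
    hU.relConvex_star (pathJoined_level hO k) (level_subset hO k)
  have hsee : ∀ {s t : ℝ}, s ∈ Icc (0 : ℝ) 1 → t ∈ Icc (0 : ℝ) 1 →
      Sees U (A + s • (B - A)) (A + t • (B - A)) := fun hs ht =>
    hAB'.sub (by rw [segment_eq_image']; exact ⟨_, hs, rfl⟩)
      (by rw [segment_eq_image']; exact ⟨_, ht, rfl⟩)
  have hnext : ∀ s ∈ Icc (0 : ℝ) 1, A + s • (B - A) ∈ level U O (k + 2) := fun s hs =>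
    ⟨_, hωV, hsee hs hω⟩
  have hbetween : ∀ {s t m : ℝ}, s ∈ Icc (0 : ℝ) 1 → t ∈ Icc (0 : ℝ) 1 →
      A + s • (B - A) ∈ level U O (k + 1) → A + t • (B - A) ∈ level U O (k + 1) → m ∈ uIcc s t →
      A + m • (B - A) ∈ level U O (k + 1) := fun hs ht h1 h2 hm =>
    sees_line_iff.1 (hrel h1 h2 (hsee hs ht)) _ hm
  rw [mem_iUnion]
  have q1 : (1 / 4 : ℝ) ∈ Icc (0 : ℝ) 1 := by norm_num
  have q3 : (1 - 1 / 4 : ℝ) ∈ Icc (0 : ℝ) 1 := by norm_num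
  by_cases hmid : ∀ m ∈ Icc (1 / 4 : ℝ) (1 - 1 / 4), A + m • (B - A) ∈ level U O (k + 1)
  · refine ⟨k, Or.inl ?_⟩
    have m1 := hmid (1 / 4) (by norm_num)
    have m3 := hmid (1 - 1 / 4) (by norm_num)
    rcases hk0 : k with _ | i
    · rw [hk0] at m1 m3
      obtain ⟨O', hO', h1⟩ := m1
      obtain ⟨O'', hO'', h3⟩ := m3
      rw [mem_singleton_iff.1 hO'] at h1
      rw [mem_singleton_iff.1 hO''] at h3
      exact ⟨h1.symm, h3.symm, hsee q1 q3⟩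
    · rw [hk0] at m1 m3
      refine ⟨m1, m3, hsee q1 q3, ?_⟩
      have hs : Sees (level U O (i + 1))ᶜ (A + (1 / 4 : ℝ) • (B - A))
          (A + (1 - 1 / 4 : ℝ) • (B - A)) := by
        rw [sees_line_iff]
        intro s hs
        rw [uIcc_of_le (by norm_num)] at hs
        exact hmin i (by omega) s ⟨by linarith [hs.1], by linarith [hs.2]⟩
      exact fun w hw => hs hw
  · push Not at hmid
    obtain ⟨m, hm, hmV⟩ := hmid
    -- The late pair is charged to the next index, since its base point is in `level (k + 2)` and
    -- not in `level (k + 1)`. If the interval lies before `m`, the last quarter of `AB` misses it,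
    -- so the pair is late when read from `B`; if after, when read from `A`.
    refine ⟨k + 1, Or.inr ?_⟩
    have hne : ω ≠ m := by rintro rfl; exact hmV hωV
    have hwit : A + ω • (B - A) ∈ segment ℝ A B := by
      rw [segment_eq_image']; exact ⟨ω, hω, rfl⟩
    rcases lt_or_gt_of_ne hne with hlt | hlt
    · right
      refine ⟨⟨hAB'.symm, fun s hs h => ?_, A + ω • (B - A), by rwa [segment_symm], hωV⟩, ?_⟩
      · have e : B + s • (A - B) = A + (1 - s) • (B - A) := by module
        change B + s • (A - B) ∈ _ at h
        rw [e] at h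
        refine hmV (hbetween hω ⟨by linarith [hs.2], by linarith [hs.1]⟩ hωV h
          (mem_uIcc.2 (Or.inl ⟨hlt.le, by linarith [hs.2, hm.2]⟩)))
      · have := hnext 1 (by norm_num)
        simpa using this
    · left
      refine ⟨⟨hAB', fun s hs h => ?_, A + ω • (B - A), hwit, hωV⟩, ?_⟩
      · exact hmV (hbetween ⟨hs.1, by linarith [hs.2]⟩ hω h hωV
          (mem_uIcc.2 (Or.inl ⟨by linarith [hs.2, hm.1], hlt.le⟩)))
      · have := hnext 0 (by norm_num)
        simpa using this

/-- Shrinking to the middle half costs a factor `4`, and late pairs count in both orders: `96 = 4 *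
16 + 16 + 16`. -/
theorem IsHolefree.volume_seePairs_linkClass_le (hU : IsHolefree U) (hO : O ∈ U) {c : ℝ}
    (hc0 : 0 ≤ c) (hc : ConvexAreaLE U c) :
    volume {q | q ∈ seePairs U ∧ q.1 ∈ linkClass U O} ≤
      ENNReal.ofReal (96 * c) * volume (linkClass U O) := by
  calc _ ≤ ∑' k, volume (shrink (1 / 4) ⁻¹' shellPairs U O k ∪
      (latePairs U O k ∪ Prod.swap ⁻¹' latePairs U O k)) :=
        (measure_mono (hU.seePairs_subset hO)).trans (measure_iUnion_le _)
    _ ≤ ∑' k, ENNReal.ofReal (96 * c) * volume (shell U O k) := by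
        refine ENNReal.tsum_le_tsum fun k => ?_
        have h1 := hU.volume_shellPairs_le hO hc0 hc k
        have h2 := hU.volume_latePairs_le hO hc k
        have h4 : ENNReal.ofReal (1 / (1 - 2 * (1 / 4)) ^ 2) = 4 := by norm_num
        have e : ENNReal.ofReal (96 * c) = 6 * ENNReal.ofReal (16 * c) := by
          rw [show (6 : ℝ≥0∞) = ENNReal.ofReal 6 by simp, ← ENNReal.ofReal_mul (by norm_num)]
          congr 1; ring
        calc _ ≤ volume (shrink (1 / 4) ⁻¹' shellPairs U O k) + (volume (latePairs U O k) +
              volume (Prod.swap ⁻¹' latePairs U O k)) :=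
              (measure_union_le _ _).trans (add_le_add_right (measure_union_le _ _) _)
          _ = 4 * volume (shellPairs U O k) + (volume (latePairs U O k) +
              volume (latePairs U O k)) := by
              rw [volume_preimage_shrink (measurableSet_shellPairs hU.isOpen k) (by norm_num),
                volume_preimage_swap, h4]
          _ ≤ 4 * (ENNReal.ofReal (16 * c) * volume (shell U O k)) +
              (ENNReal.ofReal (16 * c) * volume (shell U O k) +
              ENNReal.ofReal (16 * c) * volume (shell U O k)) := by gcongr
          _ = _ := by rw [e]; ring
    _ = ENNReal.ofReal (96 * c) * ∑' k, volume (shell U O k) := ENNReal.tsum_mul_left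
    _ ≤ _ := by gcongr; exact tsum_volume_shell_le hU.isOpen hO

theorem IsHolefree.volume_seePairs_le (hU : IsHolefree U) {c : ℝ}
    (hc0 : 0 ≤ c) (hc : ConvexAreaLE U c) :
    volume (seePairs U) ≤ ENNReal.ofReal (96 * c) * volume U := by
  let 𝒲 : Set (Set (Space 2)) := linkClass U '' U
  have hdisj : 𝒲.PairwiseDisjoint id := by
    rintro _ ⟨O, hO, rfl⟩ _ ⟨P, hP, rfl⟩ hne
    rw [Function.onFun, id, id, disjoint_left]
    intro z hz hz'
    exact hne ((linkClass_eq hO hz).symm.trans (linkClass_eq hP hz'))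
  have hopen : ∀ W ∈ 𝒲, IsOpen W := by
    rintro _ ⟨O, hO, rfl⟩
    exact isOpen_linkClass hU.isOpen hO
  -- The link classes partition `U` into nonempty open sets.
  have hcount : 𝒲.Countable := hdisj.countable_of_isOpen hopen (by
    rintro _ ⟨O, hO, rfl⟩
    exact ⟨O, mem_linkClass_self U O⟩)
  have hsub : seePairs U ⊆ ⋃ W ∈ 𝒲, {q | q ∈ seePairs U ∧ q.1 ∈ W} := by
    intro q hq
    have hq1 : q.1 ∈ U := Sees.left hq
    exact mem_biUnion (mem_image_of_mem _ hq1) ⟨hq, mem_linkClass_self U q.1⟩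
  have := hcount.to_subtype
  calc volume (seePairs U) ≤ ∑' W : 𝒲, volume {q | q ∈ seePairs U ∧ q.1 ∈ (W : Set (Space 2))} :=
        (measure_mono hsub).trans (measure_biUnion_le volume hcount _)
    _ ≤ ∑' W : 𝒲, ENNReal.ofReal (96 * c) * volume (W : Set (Space 2)) := by
        refine ENNReal.tsum_le_tsum ?_
        rintro ⟨_, O, hO, rfl⟩
        exact hU.volume_seePairs_linkClass_le hO hc0 hc
    _ = ENNReal.ofReal (96 * c) * volume (⋃ W ∈ 𝒲, W) := by
        have hb := measure_biUnion (μ := volume) hcount hdisj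
          (fun W hW => (hopen W hW).measurableSet)
        simp only [id] at hb
        rw [ENNReal.tsum_mul_left, hb]
    _ ≤ _ := by
        gcongr
        refine iUnion₂_subset ?_
        rintro _ ⟨O, hO, rfl⟩
        exact linkClass_subset hO

end

/-! ### Unbounded open sets -/

theorem volume_seePairs_le {U : Set (Space 2)} (hU : IsOpen U) (hlog : HasLoopLog U) {c : ℝ}
    (hc0 : 0 ≤ c) (hc : ConvexAreaLE U c) :
    volume (seePairs U) ≤ ENNReal.ofReal (96 * c) * volume U := by
  let V : ℕ → Set (Space 2) := fun n => U ∩ Metric.ball 0 n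
  have hV : ∀ n, IsHolefree (V n) := fun n =>
    ⟨hU.inter Metric.isOpen_ball, Metric.isBounded_ball.subset inter_subset_right,
      hlog.inter_convex (convex_ball 0 _)⟩
  have hmono : Monotone fun n => seePairs (V n) := fun m n hmn q hq =>
    Subset.trans hq (inter_subset_inter_right U (Metric.ball_subset_ball (by exact_mod_cast hmn)))
  have hsub : seePairs U ⊆ ⋃ n, seePairs (V n) := by
    intro q hq
    obtain ⟨n, hn⟩ := exists_nat_gt (max ‖q.1‖ ‖q.2‖)
    rw [max_lt_iff] at hn
    exact mem_iUnion.2 ⟨n, subset_inter hq ((convex_ball 0 _).segment_subset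
      (mem_ball_zero_iff.2 hn.1) (mem_ball_zero_iff.2 hn.2))⟩
  calc volume (seePairs U) ≤ volume (⋃ n, seePairs (V n)) := measure_mono hsub
    _ = ⨆ n, volume (seePairs (V n)) := hmono.measure_iUnion
    _ ≤ _ := iSup_le fun n =>
      ((hV n).volume_seePairs_le hc0 fun K hK => hc K (hK.trans inter_subset_left)).trans
        (by gcongr; exact inter_subset_left)

/-! ### Triangles spanned by three crossing segments -/

/-- A set that contains every triangle whose sides it contains. -/
def TriangleClosed (X : Set (Space 2)) : Prop :=
  ∀ ⦃A B C : Space 2⦄, segment ℝ A B ⊆ X → segment ℝ B C ⊆ X → segment ℝ C A ⊆ X →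
    ∀ ⦃α β γ : ℝ⦄, 0 ≤ α → 0 ≤ β → 0 ≤ γ → α + β + γ = 1 → α • A + β • B + γ • C ∈ X

theorem eq_zero_of_cross_eq_zero {u v w : Space 2} (huv : cross u v ≠ 0) (hu : cross u w = 0)
    (hv : cross v w = 0) : w = 0 := by
  simp only [cross] at huv hu hv
  ext i
  fin_cases i
  · have : (u 0 * v 1 - u 1 * v 0) * w 0 = 0 := by linear_combination v 0 * hu - u 0 * hv
    simpa [huv] using this
  · have : (u 0 * v 1 - u 1 * v 0) * w 1 = 0 := by linear_combination v 1 * hu - u 1 * hv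
    simpa [huv] using this

theorem cross_sub_eq_zero_of_mem_segment {a b P : Space 2} (h : P ∈ segment ℝ a b) :
    cross (b - a) (P - a) = 0 := by
  rw [segment_eq_image'] at h
  obtain ⟨s, -, rfl⟩ := h
  change cross (b - a) (a + s • (b - a) - a) = 0
  rw [add_sub_cancel_left, cross_smul_right, cross_self, mul_zero]

/-- The expression in `key` is constant in `z` because its linear part vanishes identically. Its
three terms at `M`, divided by the constant, are the barycentric coordinates with respect to `Q`,
`R`, `P`, and the sign conditions make them positive. -/
theorem exists_convexCombo_of_lines {a₁ a₂ a₃ d₁ d₂ d₃ P Q R M : Space 2}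
    (hP₁ : cross d₁ (P - a₁) = 0) (hP₂ : cross d₂ (P - a₂) = 0)
    (hQ₂ : cross d₂ (Q - a₂) = 0) (hQ₃ : cross d₃ (Q - a₃) = 0)
    (hR₃ : cross d₃ (R - a₃) = 0) (hR₁ : cross d₁ (R - a₁) = 0)
    (h₁ : cross d₁ (M - a₁) * cross d₂ d₃ < 0) (h₂ : cross d₂ (M - a₂) * cross d₃ d₁ < 0)
    (h₃ : cross d₃ (M - a₃) * cross d₁ d₂ < 0) :
    ∃ α β γ : ℝ, 0 ≤ α ∧ 0 ≤ β ∧ 0 ≤ γ ∧ α + β + γ = 1 ∧ α • P + β • Q + γ • R = M := by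
  set Δ := cross d₁ (M - a₁) * cross d₂ d₃ + cross d₂ (M - a₂) * cross d₃ d₁ +
    cross d₃ (M - a₃) * cross d₁ d₂ with hΔ
  have hΔ0 : Δ < 0 := by linarith
  have key : ∀ z : Space 2, cross d₁ (z - a₁) * cross d₂ d₃ + cross d₂ (z - a₂) * cross d₃ d₁ +
      cross d₃ (z - a₃) * cross d₁ d₂ = Δ := by
    intro z
    rw [hΔ]
    simp only [cross, PiLp.sub_apply]
    ring
  have hQ := key Q
  have hR := key R
  rw [hQ₂, hQ₃, zero_mul, zero_mul, add_zero, add_zero] at hQ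
  rw [hR₁, hR₃, zero_mul, zero_mul, add_zero, zero_add] at hR
  set β := cross d₁ (M - a₁) * cross d₂ d₃ / Δ with hβ
  set γ := cross d₂ (M - a₂) * cross d₃ d₁ / Δ with hγ
  set α := cross d₃ (M - a₃) * cross d₁ d₂ / Δ with hα
  have hsum : α + β + γ = 1 := by
    rw [hα, hβ, hγ, ← add_div, ← add_div, div_eq_one_iff_eq hΔ0.ne, hΔ]; ring
  refine ⟨α, β, γ, div_nonneg_of_nonpos h₃.le hΔ0.le, div_nonneg_of_nonpos h₁.le hΔ0.le,
    div_nonneg_of_nonpos h₂.le hΔ0.le, hsum, ?_⟩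
  have hcomb : ∀ d a : Space 2, cross d (α • P + β • Q + γ • R - M) =
      α * cross d (P - a) + β * cross d (Q - a) + γ * cross d (R - a) - cross d (M - a) := by
    intro d a
    have : γ = 1 - α - β := by linarith
    rw [this]
    simp only [cross, PiLp.sub_apply, PiLp.add_apply, PiLp.smul_apply, smul_eq_mul]
    ring
  refine sub_eq_zero.1 (eq_zero_of_cross_eq_zero (u := d₁) (v := d₂) (fun h => ?_) ?_ ?_)
  · rw [h, mul_zero] at h₃; exact h₃.false
  · have h23 : cross d₂ d₃ ≠ 0 := fun h => by rw [h, mul_zero] at h₁; exact h₁.false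
    rw [hcomb d₁ a₁, hP₁, hR₁, mul_zero, mul_zero, zero_add, add_zero, sub_eq_zero]
    refine mul_right_cancel₀ h23 ?_
    rw [mul_assoc, hQ, hβ, div_mul_cancel₀ _ hΔ0.ne]
  · have h31 : cross d₃ d₁ ≠ 0 := fun h => by rw [h, mul_zero] at h₂; exact h₂.false
    rw [hcomb d₂ a₂, hP₂, hQ₂, mul_zero, mul_zero, zero_add, zero_add, sub_eq_zero]
    refine mul_right_cancel₀ h31 ?_
    rw [mul_assoc, hR, hγ, div_mul_cancel₀ _ hΔ0.ne]

/-- The ends of each segment lie strictly on different sides of the line through the other. -/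
def Crossing (l m : Space 2 × Space 2) : Prop :=
  cross (l.2 - l.1) (m.1 - l.1) * cross (l.2 - l.1) (m.2 - l.1) < 0 ∧
    cross (m.2 - m.1) (l.1 - m.1) * cross (m.2 - m.1) (l.2 - m.1) < 0

/-- Three pairwise crossing segments that form a triangle around `M`. -/
def Surrounds (p : (Fin 3 → Space 2 × Space 2) × Space 2) : Prop :=
  (Crossing (p.1 0) (p.1 1) ∧ Crossing (p.1 1) (p.1 2) ∧ Crossing (p.1 2) (p.1 0)) ∧
    cross ((p.1 0).2 - (p.1 0).1) (p.2 - (p.1 0).1) *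
      cross ((p.1 1).2 - (p.1 1).1) ((p.1 2).2 - (p.1 2).1) < 0 ∧
    cross ((p.1 1).2 - (p.1 1).1) (p.2 - (p.1 1).1) *
      cross ((p.1 2).2 - (p.1 2).1) ((p.1 0).2 - (p.1 0).1) < 0 ∧
    cross ((p.1 2).2 - (p.1 2).1) (p.2 - (p.1 2).1) *
      cross ((p.1 0).2 - (p.1 0).1) ((p.1 1).2 - (p.1 1).1) < 0

theorem isOpen_crossing : IsOpen {p : (Space 2 × Space 2) × (Space 2 × Space 2) |
    Crossing p.1 p.2} := by
  refine IsOpen.and ?_ ?_ <;> exact isOpen_lt (by fun_prop) continuous_const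

theorem isOpen_surrounds : IsOpen {p | Surrounds p} := by
  refine IsOpen.and (IsOpen.and ?_ (IsOpen.and ?_ ?_)) (IsOpen.and ?_ (IsOpen.and ?_ ?_))
  · exact isOpen_crossing.preimage
      (f := fun p : (Fin 3 → Space 2 × Space 2) × Space 2 => (p.1 0, p.1 1)) (by fun_prop)
  · exact isOpen_crossing.preimage
      (f := fun p : (Fin 3 → Space 2 × Space 2) × Space 2 => (p.1 1, p.1 2)) (by fun_prop)
  · exact isOpen_crossing.preimage
      (f := fun p : (Fin 3 → Space 2 × Space 2) × Space 2 => (p.1 2, p.1 0)) (by fun_prop)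
  all_goals exact isOpen_lt (by fun_prop) continuous_const

theorem TriangleClosed.mem_of_surrounds {X : Set (Space 2)} (hX : TriangleClosed X)
    {l : Fin 3 → Space 2 × Space 2} (hl : ∀ i, Sees X (l i).1 (l i).2) {M : Space 2}
    (h : Surrounds (l, M)) : M ∈ X := by
  obtain ⟨⟨h01, h12, h20⟩, g0, g1, g2⟩ := h
  obtain ⟨P, hP0, hP1⟩ := segment_inter_of_cross h01.1 h01.2
  obtain ⟨Q, hQ1, hQ2⟩ := segment_inter_of_cross h12.1 h12.2
  obtain ⟨R, hR2, hR0⟩ := segment_inter_of_cross h20.1 h20.2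
  have edge : ∀ {i : Fin 3} {x y : Space 2}, x ∈ segment ℝ (l i).1 (l i).2 →
      y ∈ segment ℝ (l i).1 (l i).2 → segment ℝ x y ⊆ X := fun hx hy =>
    ((convex_segment _ _).segment_subset hx hy).trans (hl _)
  obtain ⟨α, β, γ, hα, hβ, hγ, hs, rfl⟩ := exists_convexCombo_of_lines
    (cross_sub_eq_zero_of_mem_segment hP0) (cross_sub_eq_zero_of_mem_segment hP1)
    (cross_sub_eq_zero_of_mem_segment hQ1) (cross_sub_eq_zero_of_mem_segment hQ2)
    (cross_sub_eq_zero_of_mem_segment hR2) (cross_sub_eq_zero_of_mem_segment hR0) g0 g1 g2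
  exact hX (edge hP1 hQ1) (edge hQ2 hR2) (edge hR0 hP0) hα hβ hγ hs

/-- Three segments over `[0, 1]` forming a triangle around `(s, 0)`. -/
noncomputable def guide (s : ℝ) : Fin 3 → Space 2 × Space 2 :=
  ![(!₂[0, 3 / 100 - 4 / 5 * s], !₂[1, 3 / 100 + 4 / 5 * (1 - s)]),
    (!₂[0, 3 / 100 + 4 / 5 * s], !₂[1, 3 / 100 - 4 / 5 * (1 - s)]),
    (!₂[0, -3 / 100], !₂[1, -3 / 100])]

theorem guide_fst_zero (s : ℝ) (i : Fin 3) : (guide s i).1 0 = 0 := by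
  fin_cases i <;> simp [guide]

theorem guide_snd_zero (s : ℝ) (i : Fin 3) : (guide s i).2 0 = 1 := by
  fin_cases i <;> simp [guide]

/-- The extreme value is `4 / 5 * (9 / 10) + 3 / 100 = 3 / 4`. The remaining quarter leaves room for
the balls around the end points. -/
theorem abs_guide_le {s : ℝ} (hs : s ∈ Icc (1 / 10 : ℝ) (9 / 10)) (i : Fin 3) :
    |(guide s i).1 1| ≤ 3 / 4 ∧ |(guide s i).2 1| ≤ 3 / 4 := by
  obtain ⟨h1, h2⟩ := hs
  simp only [abs_le]
  fin_cases i <;> simp [guide] <;> repeat' apply And.intro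
  all_goals linarith

/-- The slanted segments cross at `(s, 3 / 100)` and meet the line at height `-3 / 100` at `s ± 3 /
40`, which stays inside `(0, 1)`. -/
theorem surrounds_guide {s : ℝ} (hs : s ∈ Icc (1 / 10 : ℝ) (9 / 10)) :
    Surrounds (guide s, !₂[s, 0]) := by
  obtain ⟨h1, h2⟩ := hs
  simp only [Surrounds, Crossing, cross, guide, PiLp.sub_apply, Matrix.cons_val_zero,
    Matrix.cons_val_one, Matrix.cons_val]
  refine ⟨⟨⟨?_, ?_⟩, ⟨?_, ?_⟩, ?_, ?_⟩, ?_, ?_, ?_⟩ <;> nlinarith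

theorem TriangleClosed.mem_interior_of_near_guide {s : ℝ} (hs : s ∈ Icc (1 / 10 : ℝ) (9 / 10)) :
    ∃ ε > 0, ∀ X : Set (Space 2), TriangleClosed X → ∀ l : Fin 3 → Space 2 × Space 2,
      (∀ i, Sees X (l i).1 (l i).2) → (∀ i, dist (l i) (guide s i) < ε) →
      !₂[s, 0] ∈ interior X := by
  obtain ⟨ε, hε, hball⟩ := Metric.isOpen_iff.1 isOpen_surrounds _ (surrounds_guide hs)
  refine ⟨ε, hε, fun X hX l hl hd => mem_interior.2 ⟨Metric.ball !₂[s, 0] ε, fun M hM => ?_,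
    Metric.isOpen_ball, Metric.mem_ball_self hε⟩⟩
  refine hX.mem_of_surrounds hl (hball ?_)
  rw [Metric.mem_ball, Prod.dist_eq, max_lt_iff]
  exact ⟨(dist_pi_lt_iff hε).2 hd, hM⟩

/-! ### Density points of the segment set -/

/-- Near a density point of `T`, every ball of a fixed relative size meets `T`. -/
theorem eventually_closedBall_inter_nonempty {F : Type*} [NormedAddCommGroup F] [NormedSpace ℝ F]
    [MeasurableSpace F] [BorelSpace F] [FiniteDimensional ℝ F] (μ : Measure F) [μ.IsAddHaarMeasure]
    {T : Set F} {q : F}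
    (hq : Tendsto (fun r => μ (T ∩ Metric.closedBall q r) / μ (Metric.closedBall q r)) (𝓝[>] 0)
      (𝓝 1)) {η : ℝ} (hη : 0 < η) :
    ∀ᶠ r in 𝓝[>] (0 : ℝ), ∀ p, Metric.closedBall p (η * r) ⊆ Metric.closedBall q r →
      (T ∩ Metric.closedBall p (η * r)).Nonempty := by
  -- A ball of relative radius `η` occupies the fraction `η ^ dim` of the large ball, so it cannot
  -- be missed once the density of `T` exceeds `1 - η ^ dim`.
  have hlt : 1 - ENNReal.ofReal (η ^ Module.finrank ℝ F) < 1 :=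
    ENNReal.sub_lt_self ENNReal.one_ne_top one_ne_zero (by positivity)
  filter_upwards [hq.eventually (lt_mem_nhds hlt), self_mem_nhdsWithin] with r hr hr0 p hp
  have hr0 : 0 < r := hr0
  by_contra hne
  rw [not_nonempty_iff_eq_empty] at hne
  have hsub : T ∩ Metric.closedBall q r ⊆ Metric.closedBall q r \ Metric.closedBall p (η * r) :=
    fun x hx => ⟨hx.2, fun h => (hne ▸ (⟨hx.1, h⟩ : x ∈ T ∩ Metric.closedBall p (η * r)) :
      x ∈ (∅ : Set F))⟩
  have hfin : μ (Metric.closedBall q r) ≠ ∞ := measure_closedBall_lt_top.ne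
  have hpos : μ (Metric.closedBall q r) ≠ 0 := (Metric.measure_closedBall_pos μ q hr0).ne'
  have hsmall : μ (Metric.closedBall p (η * r)) =
      ENNReal.ofReal (η ^ Module.finrank ℝ F) * μ (Metric.closedBall q r) := by
    rw [Measure.addHaar_closedBall' μ p (by positivity), Measure.addHaar_closedBall' μ q hr0.le,
      mul_pow, ENNReal.ofReal_mul (by positivity), mul_assoc]
  have := measure_mono (μ := μ) hsub
  rw [measure_sdiff hp measurableSet_closedBall.nullMeasurableSet (measure_ne_top_of_subset hp hfin),
    hsmall] at this
  refine absurd hr (not_lt.2 (ENNReal.div_le_of_le_mul (this.trans ?_)))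
  rw [ENNReal.sub_mul (fun _ _ => hfin), one_mul]

/-- The affine chart with `(0, 0) ↦ A`, `(1, 0) ↦ A + v` and second axis `ρ • rot v`. -/
def chart (A v : Space 2) (ρ : ℝ) (z : Space 2) : Space 2 := A + z 0 • v + (z 1 * ρ) • rot v

/-- The inverse of `chart A v ρ`. -/
noncomputable def chartInv (A v : Space 2) (ρ : ℝ) (z : Space 2) : Space 2 :=
  !₂[cross (z - A) (rot v) / ‖v‖ ^ 2, cross v (z - A) / (ρ * ‖v‖ ^ 2)]

theorem chart_chartInv {v : Space 2} (hv : v ≠ 0) {ρ : ℝ} (hρ : ρ ≠ 0) (A z : Space 2) :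
    chart A v ρ (chartInv A v ρ z) = z := by
  have hn : ‖v‖ ^ 2 ≠ 0 := by positivity
  have h0 : chartInv A v ρ z 0 = cross (z - A) (rot v) / ‖v‖ ^ 2 := rfl
  have h1 : chartInv A v ρ z 1 = cross v (z - A) / (ρ * ‖v‖ ^ 2) := rfl
  have h2 : cross v (z - A) / (ρ * ‖v‖ ^ 2) * ρ = cross v (z - A) / ‖v‖ ^ 2 := by field_simp
  rw [chart, h0, h1, h2]
  rw [norm_sq_eq] at *
  ext i
  fin_cases i
  · simp [cross, rot]
    field_simp
    ring
  · simp [cross, rot]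
    field_simp
    ring

theorem continuous_chartInv (A v : Space 2) (ρ : ℝ) : Continuous (chartInv A v ρ) := by
  unfold chartInv
  refine (PiLp.continuous_toLp 2 _).comp (continuous_pi fun i => ?_)
  fin_cases i
  · change Continuous fun z => cross (z - A) (rot v) / ‖v‖ ^ 2
    fun_prop
  · change Continuous fun z => cross v (z - A) / (ρ * ‖v‖ ^ 2)
    fun_prop

theorem chart_combo (A v : Space 2) (ρ : ℝ) {α β γ : ℝ} (h : α + β + γ = 1) (a b c : Space 2) :
    chart A v ρ (α • a + β • b + γ • c) =
      α • chart A v ρ a + β • chart A v ρ b + γ • chart A v ρ c := by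
  have hA : A = (α + β + γ) • A := by rw [h, one_smul]
  simp only [chart, PiLp.add_apply, PiLp.smul_apply, smul_eq_mul]
  nth_rewrite 1 [hA]
  module

theorem image_chart_segment (A v : Space 2) (ρ : ℝ) (a b : Space 2) :
    chart A v ρ '' segment ℝ a b = segment ℝ (chart A v ρ a) (chart A v ρ b) := by
  have h : ∀ x y : ℝ, x + y = 1 → chart A v ρ (x • a + y • b) =
      x • chart A v ρ a + y • chart A v ρ b := fun x y hxy => by
    simpa using chart_combo A v ρ (γ := 0) (by rw [add_zero, hxy]) a b a
  ext z
  constructor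
  · rintro ⟨_, ⟨x, y, hx, hy, hxy, rfl⟩, rfl⟩
    exact ⟨x, y, hx, hy, hxy, (h x y hxy).symm⟩
  · rintro ⟨x, y, hx, hy, hxy, rfl⟩
    exact ⟨_, ⟨x, y, hx, hy, hxy, rfl⟩, h x y hxy⟩

theorem sees_preimage_chart {X : Set (Space 2)} {A v : Space 2} {ρ : ℝ} {a b : Space 2} :
    Sees (chart A v ρ ⁻¹' X) a b ↔ Sees X (chart A v ρ a) (chart A v ρ b) := by
  rw [Sees, ← image_subset_iff, image_chart_segment, Sees]

theorem TriangleClosed.preimage_chart {X : Set (Space 2)} (hX : TriangleClosed X) (A v : Space 2)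
    (ρ : ℝ) : TriangleClosed (chart A v ρ ⁻¹' X) := by
  intro a b c hab hbc hca α β γ hα hβ hγ hs
  rw [mem_preimage, chart_combo A v ρ hs]
  exact hX (sees_preimage_chart.1 hab) (sees_preimage_chart.1 hbc) (sees_preimage_chart.1 hca)
    hα hβ hγ hs

theorem abs_cross_le_norm (u w : Space 2) : |cross u w| ≤ ‖u‖ * ‖w‖ := by
  refine abs_le_of_sq_le_sq ?_ (by positivity)
  rw [mul_pow, norm_sq_eq, norm_sq_eq]
  simp only [cross]
  nlinarith [sq_nonneg (u 0 * w 0 + u 1 * w 1)]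

theorem norm_rot (v : Space 2) : ‖rot v‖ = ‖v‖ := by
  have : ‖rot v‖ ^ 2 = ‖v‖ ^ 2 := by
    rw [norm_sq_eq, norm_sq_eq]; simp [rot]; ring
  exact (sq_eq_sq₀ (norm_nonneg _) (norm_nonneg _)).1 this

/-- Points close to `chart A v ρ p` have `chartInv`-coordinates close to `p`. -/
theorem dist_chartInv_le {A v p z : Space 2} (hv : v ≠ 0) {ρ η : ℝ} (hρ : 0 < ρ) (hρ1 : ρ ≤ 1)
    (hη : 0 < η) (h : dist z (chart A v ρ p) ≤ η * (ρ * ‖v‖)) :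
    dist (chartInv A v ρ z) p ≤ 2 * η := by
  have hn : 0 < ‖v‖ := norm_pos_iff.2 hv
  set e := z - chart A v ρ p with he
  rw [dist_eq_norm] at h
  have e0 : chartInv A v ρ z 0 - p 0 = cross e (rot v) / ‖v‖ ^ 2 := by
    have : z - A = e + p 0 • v + (p 1 * ρ) • rot v := by rw [he, chart]; module
    change cross (z - A) (rot v) / ‖v‖ ^ 2 - p 0 = _
    rw [this, cross_add_left, cross_add_left, cross_smul_left, cross_smul_left, cross_self,
      cross_rot_right]
    field_simp
    ring
  have e1 : chartInv A v ρ z 1 - p 1 = cross v e / (ρ * ‖v‖ ^ 2) := by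
    have : z - A = e + p 0 • v + (p 1 * ρ) • rot v := by rw [he, chart]; module
    change cross v (z - A) / (ρ * ‖v‖ ^ 2) - p 1 = _
    rw [this, cross_add_right, cross_add_right, cross_smul_right, cross_smul_right, cross_self,
      cross_rot_right]
    field_simp
    ring
  have b0 : |chartInv A v ρ z 0 - p 0| ≤ η := by
    rw [e0, abs_div, abs_of_pos (by positivity : 0 < ‖v‖ ^ 2), div_le_iff₀ (by positivity)]
    refine (abs_cross_le_norm _ _).trans ?_
    rw [norm_rot]
    calc ‖e‖ * ‖v‖ ≤ η * (ρ * ‖v‖) * ‖v‖ := by gcongr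
      _ ≤ η * (1 * ‖v‖) * ‖v‖ := by gcongr
      _ = η * ‖v‖ ^ 2 := by ring
  have b1 : |chartInv A v ρ z 1 - p 1| ≤ η := by
    rw [e1, abs_div, abs_of_pos (by positivity : 0 < ρ * ‖v‖ ^ 2), div_le_iff₀ (by positivity)]
    refine (abs_cross_le_norm _ _).trans ?_
    calc ‖v‖ * ‖e‖ ≤ ‖v‖ * (η * (ρ * ‖v‖)) := by gcongr
      _ = η * (ρ * ‖v‖ ^ 2) := by ring
  rw [dist_eq_norm]
  refine abs_le_of_sq_le_sq' ?_ (by positivity) |>.2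
  rw [norm_sq_eq, PiLp.sub_apply, PiLp.sub_apply]
  nlinarith [sq_le_sq' (neg_le_of_abs_le b0) (le_of_abs_le b0),
    sq_le_sq' (neg_le_of_abs_le b1) (le_of_abs_le b1)]

/-- In the chart, `AB` becomes the unit segment and the scale `r` of the density ball becomes the
unit across it. Pairs of `segSet S` close to the three guides then enclose a neighbourhood of the
point. -/
theorem TriangleClosed.mem_interior_of_density {S : Set (Space 2)} (hS : TriangleClosed S)
    {q : Space 2 × Space 2} (hne : q.1 ≠ q.2)
    (hq : Tendsto (fun r => volume (segSet S ∩ Metric.closedBall q r) /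
      volume (Metric.closedBall q r)) (𝓝[>] 0) (𝓝 1))
    {s : ℝ} (hs : s ∈ Icc (1 / 10 : ℝ) (9 / 10)) : q.1 + s • (q.2 - q.1) ∈ interior S := by
  obtain ⟨A, B⟩ := q
  change A ≠ B at hne
  change A + s • (B - A) ∈ interior S
  obtain ⟨ε, hε, hkey⟩ := TriangleClosed.mem_interior_of_near_guide hs
  set v := B - A with hvdef
  have hv : v ≠ 0 := sub_ne_zero.2 hne.symm
  have hn : 0 < ‖v‖ := norm_pos_iff.2 hv
  -- The bound `1 / 4` keeps the balls around the guide ends inside the ball of radius `r`; `ε / 3`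
  -- makes the chart error `2 * η` smaller than `ε`.
  set η := min (1 / 4) (ε / 3) with hηdef
  have hη : 0 < η := by positivity
  have hη4 : η ≤ 1 / 4 := min_le_left _ _
  have hη3 : η ≤ ε / 3 := min_le_right _ _
  have : (volume : Measure (Space 2 × Space 2)).IsAddHaarMeasure := by
    rw [Measure.volume_eq_prod]; infer_instance
  obtain ⟨r, hr, hr0, hrv⟩ := ((eventually_closedBall_inter_nonempty volume hq hη).and
    (Ioc_mem_nhdsGT hn)).exists
  set ρ := r / ‖v‖ with hρdef
  have hρ : 0 < ρ := by positivity
  have hρ1 : ρ ≤ 1 := (div_le_one hn).2 hrv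
  have hrρ : r = ρ * ‖v‖ := by rw [hρdef]; field_simp
  have hoff : ∀ y : ℝ, |y| ≤ 3 / 4 → ‖(y * ρ) • rot v‖ ≤ 3 / 4 * r := by
    intro y hy
    rw [norm_smul, norm_rot, norm_mul, Real.norm_eq_abs, Real.norm_eq_abs, abs_of_pos hρ, mul_assoc,
      ← hrρ]
    gcongr
  have hex : ∀ i : Fin 3, ∃ l : Space 2 × Space 2, l ∈ segSet S ∧
      dist l.1 (chart A v ρ (guide s i).1) ≤ η * r ∧
      dist l.2 (chart A v ρ (guide s i).2) ≤ η * r := by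
    intro i
    obtain ⟨l, hl, hld⟩ := hr (chart A v ρ (guide s i).1, chart A v ρ (guide s i).2) (by
      refine Metric.closedBall_subset_closedBall' ?_
      have d1 : dist (chart A v ρ (guide s i).1) A ≤ 3 / 4 * r := by
        rw [dist_eq_norm, chart, guide_fst_zero, zero_smul, add_zero, add_sub_cancel_left]
        exact hoff _ (abs_guide_le hs i).1
      have d2 : dist (chart A v ρ (guide s i).2) B ≤ 3 / 4 * r := by
        rw [dist_eq_norm, chart, guide_snd_zero, one_smul, hvdef, add_sub_cancel, ← hvdef,
          add_sub_cancel_left]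
        exact hoff _ (abs_guide_le hs i).2
      rw [Prod.dist_eq]
      have := max_le d1 d2
      nlinarith)
    rw [Metric.mem_closedBall, Prod.dist_eq, max_le_iff] at hld
    exact ⟨l, hl, hld⟩
  choose l hl hl1 hl2 using hex
  rw [hrρ] at hl1 hl2
  have hint := hkey (chart A v ρ ⁻¹' S) (hS.preimage_chart A v ρ)
    (fun i => (chartInv A v ρ (l i).1, chartInv A v ρ (l i).2))
    (fun i => by
      rw [sees_preimage_chart]
      change Sees S (chart A v ρ (chartInv A v ρ (l i).1)) (chart A v ρ (chartInv A v ρ (l i).2))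
      rw [chart_chartInv hv hρ.ne', chart_chartInv hv hρ.ne']
      exact (hl i).2.2)
    (fun i => by
      rw [Prod.dist_eq, max_lt_iff]
      exact ⟨(dist_chartInv_le hv hρ hρ1 hη (hl1 i)).trans_lt (by linarith),
        (dist_chartInv_le hv hρ hρ1 hη (hl2 i)).trans_lt (by linarith)⟩)
  have hM : chartInv A v ρ (A + s • v) = !₂[s, 0] := by
    unfold chartInv
    rw [add_sub_cancel_left, cross_smul_left, cross_smul_right, cross_self, cross_rot_right]
    congr 2
    · field_simp
    · simp
  rw [mem_interior]
  refine ⟨chartInv A v ρ ⁻¹' interior (chart A v ρ ⁻¹' S), fun z hz => ?_,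
    isOpen_interior.preimage (continuous_chartInv A v ρ), ?_⟩
  · have := interior_subset hz
    rwa [mem_preimage, chart_chartInv hv hρ.ne'] at this
  · rw [mem_preimage, hM]
    exact hint

theorem volume_diagonal : volume {q : Space 2 × Space 2 | q.1 = q.2} = 0 := by
  have hm : MeasurableSet {q : Space 2 × Space 2 | q.1 = q.2} :=
    measurableSet_eq_fun measurable_fst measurable_snd
  rw [Measure.volume_eq_prod, Measure.measure_prod_null hm]
  refine Eventually.of_forall fun A => ?_
  have : Prod.mk A ⁻¹' {q : Space 2 × Space 2 | q.1 = q.2} = {A} := by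
    ext B; simp [eq_comm]
  change volume (Prod.mk A ⁻¹' {q : Space 2 × Space 2 | q.1 = q.2}) = 0
  rw [this, measure_singleton]

/-- Almost every pair of the measurable set `segSet S` is a density point of it, and the diagonal is
null. -/
theorem TriangleClosed.volume_segSet_le {S : Set (Space 2)} (hS : TriangleClosed S)
    (hm : NullMeasurableSet (segSet S) volume) :
    volume (segSet S) ≤ volume (shrink (1 / 10) ⁻¹' seePairs (interior S)) := by
  have h1 := Besicovitch.ae_tendsto_measure_inter_div (volume : Measure (Space 2 × Space 2))
    (segSet S)
  rw [ae_restrict_iff'₀ hm] at h1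
  have h2 : ∀ᵐ q : Space 2 × Space 2, q.1 ≠ q.2 := by
    rw [ae_iff]
    simpa using volume_diagonal
  refine measure_mono_ae ?_
  filter_upwards [h1, h2] with q hq hne hqS
  change Sees (interior S) (q.1 + (1 / 10 : ℝ) • (q.2 - q.1))
    (q.1 + (1 - 1 / 10 : ℝ) • (q.2 - q.1))
  rw [sees_line_iff, uIcc_of_le (by norm_num)]
  intro s hs
  exact hS.mem_interior_of_density hne (hq hqS) ⟨hs.1, by linarith [hs.2]⟩

theorem volume_segSet_le {S : Set (Space 2)} (hS : PComponentwiseSimplyConnected S)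
    (hm : NullMeasurableSet (segSet S) volume) {c : ℝ} (hc0 : 0 ≤ c) (hc : ConvexAreaLE S c) :
    volume (segSet S) ≤ ENNReal.ofReal (150 * c) * volume S := by
  have hT : TriangleClosed S := fun A B C hAB hBC hCA α β γ hα hβ hγ hs =>
    hS.convexCombo_mem hAB hBC hCA hα hβ hγ hs
  calc volume (segSet S) ≤ volume (shrink (1 / 10) ⁻¹' seePairs (interior S)) :=
        hT.volume_segSet_le hm
    _ = ENNReal.ofReal (1 / (1 - 2 * (1 / 10)) ^ 2) * volume (seePairs (interior S)) :=
        volume_preimage_shrink (isOpen_sees isOpen_interior).measurableSet (by norm_num)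
    _ ≤ ENNReal.ofReal (1 / (1 - 2 * (1 / 10)) ^ 2) *
        (ENNReal.ofReal (96 * c) * volume (interior S)) := by
        gcongr
        exact volume_seePairs_le isOpen_interior hS.hasLoopLog_interior hc0
          fun K hK => hc K (hK.trans interior_subset)
    _ = ENNReal.ofReal (150 * c) * volume (interior S) := by
        rw [← mul_assoc, ← ENNReal.ofReal_mul (by norm_num)]
        congr 2
        -- The constant is `96 / (4 / 5) ^ 2 = 150`.
        ring
    _ ≤ _ := by gcongr; exact interior_subset

end BeerConvexity

theorem mainTheorem1 (S : Set (BeerConvexity.Space 2))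
    (hS : BeerConvexity.PComponentwiseSimplyConnected S)
    (hb : BeerConvexity.BeerIndexDefined S) :
    BeerConvexity.beerIndex S ≤ 180 * BeerConvexity.convexityRatio S := by
  have hfin : BeerConvexity.convexSup S ≠ ∞ := by
    refine ((sSup_le ?_).trans_lt hb.finite).ne
    rintro _ ⟨K, hK, -, rfl⟩
    exact measure_mono hK
  set c := (BeerConvexity.convexSup S).toReal with hc
  have hc0 : 0 ≤ c := ENNReal.toReal_nonneg
  have hle := BeerConvexity.volume_segSet_le hS hb.measurable_seg hc0 fun K hK hconv => by
    rw [hc, ENNReal.ofReal_toReal hfin]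
    exact le_sSup ⟨K, hK, hconv, rfl⟩
  have hV : 0 < (volume S).toReal := ENNReal.toReal_pos hb.pos.ne' hb.finite.ne
  have hreal : (volume (BeerConvexity.segSet S)).toReal ≤ 150 * c * (volume S).toReal := by
    have := ENNReal.toReal_mono (ENNReal.mul_ne_top ENNReal.ofReal_ne_top hb.finite.ne) hle
    rwa [ENNReal.toReal_mul, ENNReal.toReal_ofReal (by positivity)] at this
  rw [BeerConvexity.beerIndex, BeerConvexity.convexityRatio, ← hc, ← mul_div_assoc,
    div_le_div_iff₀ (by positivity) hV]
  nlinarith [mul_le_mul_of_nonneg_right hreal hV.le, mul_nonneg hc0 (sq_nonneg (volume S).toReal)]
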